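/- **Setting.** Two players have finite non-empty action sets of cardinalities $A$ and $B$, with $AB\ge 2$. For each pair of actions $(a,b)$ let $p(a,b)$ be a probability distribution on $[0,1]$ with mean $L(a,b)$. For mixed policies $\mu\in\Delta_A$, $\nu\in\Delta_B$ put $L(\mu,\nu)=\sum_{a,b}\mu(a)\nu(b)L(a,b)$ and let $EG(\mu,\nu)=\max_{\nu'\in\Delta_B}L(\mu,\nu')-\min_{\mu'\in\Delta_A}L(\mu',\nu)$ be the exploitability gap. For a real random variable $X$, $\|X\|_2=\mathbb E[|X|^2]^{1/2}$. **Regularized EXP3** with regularization $\tau>0$ and learning rates $\eta^s=2/(\tau(s+1))$: let $\mu^0,\nu^0$ be the uniform policies and start from $\mu^{\tau,1}=\mu^0$, $\nu^{\tau,1}=\nu^0$. Iteration $s=1,2,\dots$ uses the policies $$\mu^s=\operatorname*{argmin}_{\mu\in\Delta_A}\,(1-\tau\eta^s)\mathrm{KL}(\mu,\mu^{\tau,s})+\tau\eta^s\mathrm{KL}(\mu,\mu^0),\qquad \nu^s=\operatorname*{argmin}_{\nu\in\Delta_B}\,(1-\tau\eta^s)\mathrm{KL}(\nu,\nu^{\tau,s})+\tau\eta^s\mathrm{KL}(\nu,\nu^0),$$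 the actions $a^s\sim\mu^s$ and $b^s\sim\nu^s$ are drawn independently given the past, the loss $\ell^s\sim p(a^s,b^s)$ is observed, and $$\mu^{\tau,s+1}=\operatorname*{argmin}_{\mu\in\Delta_A}\,\eta^s\Big\langle \tfrac{\ell^s}{\mu^s(a^s)}\mathbf 1_{a^s},\mu\Big\rangle+\mathrm{KL}(\mu,\mu^s),\qquad \nu^{\tau,s+1}=\operatorname*{argmin}_{\nu\in\Delta_B}\,\eta^s\Big\langle \tfrac{1-\ell^s}{\nu^s(b^s)}\mathbf 1_{b^s},\nu\Big\rangle+\mathrm{KL}(\nu,\nu^s).$$ **Modified doubling trick.** Let $T_i=32\,i\,2^i$ and $S_i=8\cdot 2^i$. For $i\ge 1$ let $\mathcal A_i$ be an instance of regularized EXP3 with $\tau_i=\big((A+B)/T_i\big)^{1/4}\sqrt{2/(\log A+\log B)}$, and let $\mathcal A_0$ be an instance with an arbitrary $\tau_0>0$. Draw one seed $u\sim\mathcal U([0,1])$ common to both players. For $i=1,2,\dots$ and $j=1,\dots,T_i$, put $$p_i^j=\min\Big\{1,\frac{e^{j/S_i}}{T_i}\Big\},\qquad k_i^j=\Big\lfloor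 \sum_{l=1}^{j}p_i^l+u\Big\rfloor ,$$ and in round $t=T_1+\dots+T_{i-1}+j$ play one further iteration of $\mathcal A_i$ if $k_i^j>k_i^{j-1}$, and one further iteration of $\mathcal A_{i-1}$ otherwise; the other instances are left unchanged. Let $(\mu^t,\nu^t)$ be the profile played in round $t$. **Theorem.** For every round $t\ge 2$, $$\|EG(\mu^t,\nu^t)\|_2\le 30\Big(\frac{A+B}{t}\Big)^{1/4}\sqrt{\log(AB)\,\log t}.$$ -/

import Mathlib

open MeasureTheory

noncomputable section

namespace MatrixGame

/-! ## Zero-sum matrix games.  Mixed policies are the elements of `stdSimplex ℝ A`. -/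

section Games

variable {A B : Type*} [Fintype A] [Fintype B]

/-- Expected loss `L(μ, ν)` of a profile. -/
def expLoss (L : A → B → ℝ) (μ : A → ℝ) (ν : B → ℝ) : ℝ :=
  ∑ a, ∑ b, μ a * ν b * L a b

/-- The exploitability gap `max_{ν'} L(μ, ν') - min_{μ'} L(μ', ν)`, both extrema being taken
over the simplex (they are attained, since the simplex is compact). -/
def exploitabilityGap (L : A → B → ℝ) (μ : A → ℝ) (ν : B → ℝ) : ℝ :=
  (⨆ ν' : stdSimplex ℝ B, expLoss L μ (ν' : B → ℝ)) -
    ⨅ μ' : stdSimplex ℝ A, expLoss L (μ' : A → ℝ) ν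

/-- Mean loss matrix of a family `p(a, b)` of loss distributions. -/
def meanLoss (p : A → B → Measure ℝ) (a : A) (b : B) : ℝ :=
  ∫ x, x ∂(p a b)

open Classical in
/-- Kullback-Leibler divergence of two distributions on a finite set; it is `⊤` when the first
one is not absolutely continuous with respect to the second one. -/
def kl (p q : A → ℝ) : EReal :=
  if ∀ a, q a = 0 → p a = 0 then ((∑ a, p a * Real.log (p a / q a) : ℝ) : EReal) else ⊤

/-- The uniform policy. -/
def uniformPolicy (A : Type*) [Fintype A] : A → ℝ := fun _ => 1 / (Fintype.card A : ℝ)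

/-- A minimizer of `f` over `s` (meaningful when one exists). -/
def argminOn {X : Type*} [Nonempty X] (s : Set X) (f : X → EReal) : X :=
  Classical.epsilon fun x => x ∈ s ∧ IsMinOn f s x

/-- First half-step, for one player:
`argmin_μ (1 - τ η) KL(μ, base) + τ η KL(μ, uniform)` over the simplex. -/
def regularizeStep (τ η : ℝ) (base : A → ℝ) : A → ℝ :=
  argminOn (stdSimplex ℝ A) fun μ =>
    ((1 - τ * η : ℝ) : EReal) * kl μ base + ((τ * η : ℝ) : EReal) * kl μ (uniformPolicy A)

/-- Second half-step, for one player: the mirror step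
`argmin_μ η ⟨g, μ⟩ + KL(μ, base)` over the simplex. -/
def mirrorStep (η : ℝ) (g base : A → ℝ) : A → ℝ :=
  argminOn (stdSimplex ℝ A) fun μ =>
    ((η * ∑ a, g a * μ a : ℝ) : EReal) + kl μ base

/-- Importance sampling estimator: `x / μ(a)` at the action `a` that was played, `0` elsewhere. -/
def lossEstimate [DecidableEq A] (μ : A → ℝ) (a : A) (x : ℝ) : A → ℝ :=
  fun a' => if a' = a then x / μ a else 0

end Games

/-! ## Uncoupled regularized EXP3 -/

/-- Input of regularized EXP3: the regularization and the learning rates. -/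
structure Params where
  τ : ℝ
  η : ℕ → ℝ

/-- State of an instance of regularized EXP3: the number `iter` of iterations it has already
performed, and the policies `μ^{τ,s}`, `ν^{τ,s}` with `s = iter + 1`. -/
structure InstState (A B : Type*) where
  iter : ℕ
  muTau : A → ℝ
  nuTau : B → ℝ

namespace InstState

variable {A B : Type*} [Fintype A] [Fintype B]

/-- Initial state: uniform policies. -/
def init (A B : Type*) [Fintype A] [Fintype B] : InstState A B :=
  ⟨0, uniformPolicy A, uniformPolicy B⟩

/-- Policy `μ^s` that the min-player uses in the next iteration `s = iter + 1`. -/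
def mu (q : Params) (st : InstState A B) : A → ℝ :=
  regularizeStep q.τ (q.η (st.iter + 1)) st.muTau

/-- Policy `ν^s` that the max-player uses in the next iteration `s = iter + 1`. -/
def nu (q : Params) (st : InstState A B) : B → ℝ :=
  regularizeStep q.τ (q.η (st.iter + 1)) st.nuTau

/-- State after one more iteration, in which `a`, `b` were played and the loss `x` observed. -/
def next [DecidableEq A] [DecidableEq B] (q : Params) (st : InstState A B)
    (a : A) (b : B) (x : ℝ) : InstState A B where
  iter := st.iter + 1
  muTau := mirrorStep (q.η (st.iter + 1)) (lossEstimate (st.mu q) a x) (st.mu q)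
  nuTau := mirrorStep (q.η (st.iter + 1)) (lossEstimate (st.nu q) b (1 - x)) (st.nu q)

end InstState

/-! ## The modified doubling trick -/

section Doubling

/-- The pair `(i, j)` of loop and iteration in the loop that round `t` belongs to, that is
`t = T 1 + ... + T (i - 1) + j` with `1 ≤ j ≤ T i`, for `t ≥ 1` (and positive horizons). -/
def roundPos (T : ℕ → ℕ) : ℕ → ℕ × ℕ
  | 0 => (1, 0)
  | t + 1 =>
    if (roundPos T t).2 < T (roundPos T t).1 then ((roundPos T t).1, (roundPos T t).2 + 1)
    else ((roundPos T t).1 + 1, 1)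

/-- `p_i^j = min {1, e^{j / S_i} / T_i}`. -/
def newProb (T : ℕ → ℕ) (S : ℕ → ℝ) (i j : ℕ) : ℝ :=
  min 1 (Real.exp ((j : ℝ) / S i) / (T i : ℝ))

/-- `k_i^j = ⌊p_i^1 + ... + p_i^j + u⌋`. -/
def callCount (T : ℕ → ℕ) (S : ℕ → ℝ) (u : ℝ) (i j : ℕ) : ℕ :=
  ⌊(∑ l ∈ Finset.Icc 1 j, newProb T S i l) + u⌋₊

/-- Index of the instance played in round `t ≥ 1` with the seed `u`: at position `(i, j)`, the
new instance `i` if `k_i^j > k_i^{j-1}`, and the old instance `i - 1` otherwise. -/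
def activeInst (T : ℕ → ℕ) (S : ℕ → ℝ) (u : ℝ) (t : ℕ) : ℕ :=
  if callCount T S u (roundPos T t).1 ((roundPos T t).2 - 1)
      < callCount T S u (roundPos T t).1 (roundPos T t).2
  then (roundPos T t).1 else (roundPos T t).1 - 1

variable {A B : Type*} [Fintype A] [Fintype B] [DecidableEq A] [DecidableEq B]

/-- States of all the instances after `t` rounds, given the seed `u` and the actions `a s`, `b s`
and losses `x s` of the rounds `s ≥ 1`.  Only the instance that is played is updated. -/
def statesAfter (par : ℕ → Params) (T : ℕ → ℕ) (S : ℕ → ℝ) (u : ℝ)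
    (a : ℕ → A) (b : ℕ → B) (x : ℕ → ℝ) : ℕ → ℕ → InstState A B
  | 0 => fun _ => InstState.init A B
  | t + 1 =>
    Function.update (statesAfter par T S u a b x t) (activeInst T S u (t + 1))
      ((statesAfter par T S u a b x t (activeInst T S u (t + 1))).next
        (par (activeInst T S u (t + 1))) (a (t + 1)) (b (t + 1)) (x (t + 1)))

/-- Policy `μ^t` of the min-player in round `t ≥ 1`. -/
def playedMu (par : ℕ → Params) (T : ℕ → ℕ) (S : ℕ → ℝ) (u : ℝ)
    (a : ℕ → A) (b : ℕ → B) (x : ℕ → ℝ) (t : ℕ) : A → ℝ :=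
  (statesAfter par T S u a b x (t - 1) (activeInst T S u t)).mu (par (activeInst T S u t))

/-- Policy `ν^t` of the max-player in round `t ≥ 1`. -/
def playedNu (par : ℕ → Params) (T : ℕ → ℕ) (S : ℕ → ℝ) (u : ℝ)
    (a : ℕ → A) (b : ℕ → B) (x : ℕ → ℝ) (t : ℕ) : B → ℝ :=
  (statesAfter par T S u a b x (t - 1) (activeInst T S u t)).nu (par (activeInst T S u t))

end Doubling

/-! ## Interaction with the game under bandit feedback -/

section Interaction

variable {Ω A B : Type*} [MeasurableSpace A] [MeasurableSpace B]

/-- `ℱ^t = σ(u, a^1, b^1, ℓ^1, ..., a^t, b^t, ℓ^t)`. -/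
@[reducible] def history (U : Ω → ℝ) (a : ℕ → Ω → A) (b : ℕ → Ω → B) (x : ℕ → Ω → ℝ) (t : ℕ) :
    MeasurableSpace Ω :=
  MeasurableSpace.comap U inferInstance ⊔
    ⨆ s ∈ Finset.Icc 1 t, (MeasurableSpace.comap (a s) inferInstance ⊔
      MeasurableSpace.comap (b s) inferInstance ⊔ MeasurableSpace.comap (x s) inferInstance)

/-- The seed `U`, the actions `a t`, `b t` and the losses `x t` (rounds `t ≥ 1`) are produced, on
the probability space `(Ω, P)`, by the modified doubling trick playing against the game with loss
distributions `p`: the seed is uniform on `[0, 1]`; in each round the two actions are drawn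
independently from the current policies given the past; and the loss is drawn from `p(a, b)`
given the past and the two actions. -/
structure IsDoublingRun [MeasurableSpace Ω] [Fintype A] [Fintype B]
    [DecidableEq A] [DecidableEq B]
    (P : Measure Ω) (p : A → B → Measure ℝ) (par : ℕ → Params) (T : ℕ → ℕ) (S : ℕ → ℝ)
    (U : Ω → ℝ) (a : ℕ → Ω → A) (b : ℕ → Ω → B) (x : ℕ → Ω → ℝ) : Prop where
  measurable_seed : Measurable U
  measurable_min : ∀ t, Measurable (a t)
  measurable_max : ∀ t, Measurable (b t)
  measurable_loss : ∀ t, Measurable (x t)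
  seed_law : P.map U = volume.restrict (Set.Icc (0 : ℝ) 1)
  action_law : ∀ (t : ℕ) (a₀ : A) (b₀ : B),
    P[Set.indicator {ω | a (t + 1) ω = a₀ ∧ b (t + 1) ω = b₀} (fun _ => (1 : ℝ)) |
        history U a b x t]
      =ᵐ[P] fun ω =>
        playedMu par T S (U ω) (fun s => a s ω) (fun s => b s ω) (fun s => x s ω) (t + 1) a₀ *
        playedNu par T S (U ω) (fun s => a s ω) (fun s => b s ω) (fun s => x s ω) (t + 1) b₀
  loss_law : ∀ (t : ℕ) (E : Set ℝ), MeasurableSet E →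
    P[Set.indicator {ω | x (t + 1) ω ∈ E} (fun _ => (1 : ℝ)) |
        history U a b x t ⊔ MeasurableSpace.comap (a (t + 1)) inferInstance ⊔
          MeasurableSpace.comap (b (t + 1)) inferInstance]
      =ᵐ[P] fun ω => (p (a (t + 1) ω) (b (t + 1) ω)).real E

end Interaction

/-! ## The parameters -/

/-- `T_i = 32 i 2^i`. -/
def horizon (i : ℕ) : ℕ := 32 * (i * 2 ^ i)

/-- `S_i = 8 · 2^i`. -/
def scale (i : ℕ) : ℝ := 8 * 2 ^ i

/-- Regularization `τ = ((A + B) / T)^{1/4} √(2 / (log A + log B))` for the horizon `T`, where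
`nA`, `nB` are the numbers of actions. -/
def tuning (nA nB T : ℕ) : ℝ :=
  (((nA : ℝ) + nB) / T) ^ (1 / 4 : ℝ) * Real.sqrt (2 / (Real.log nA + Real.log nB))

/-- Parameters with regularization `τ` and learning rates `η^t = 2 / (τ (t + 1))`. -/
def paramsOf (τ : ℝ) : Params := ⟨τ, fun t => 2 / (τ * ((t : ℝ) + 1))⟩

/-- Parameters of the instances: instance `i ≥ 1` is tuned for the horizon `T_i`.  As `T_0 = 0`
gives no tuning for the auxiliary instance `0`, its regularization `τ₀` is left free. -/
def instParams (nA nB : ℕ) (τ₀ : ℝ) (i : ℕ) : Params :=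
  if i = 0 then paramsOf τ₀ else paramsOf (tuning nA nB (horizon i))

end MatrixGame

end

/-! Fix one instance, with regularization τ, and a saddle point (m, n) of L(μ, ν) + τ ψ(μ) - τ ψ(ν),
where ψ is the negative entropy. Let D be the sum of the divergences of m and n from the current
policies. A regularization step multiplies D by 1 - τη up to entropy differences. A mirror step
adds, on average, the linear term η (L(m, ν) - L(μ, n)) and a variance of at most η² (A + B) / 2.
The saddle inequality bounds the linear term by exactly the entropy differences, which cancel
(`average_next_le`). After N iterations τη = 2 / (N + 2), so N (N + 1) D - c N with c = 2 (A + B) /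
τ² is a supermartingale started at 0, and D is of order c / N on average. A Pinsker inequality
converts this into a bound on the gap: EG² ≤ 2 (τ log(AB))² + 4 D, with D taken at the played
policies (`sq_exploitabilityGap_le`).

The seed alone decides which instance plays in which round, hence also every count N. As the seed
belongs to every history, the supermartingale property survives multiplication by a nonnegative
bounded function of the seed (`integral_lyapunov_succ_le`). Weighting by 1 / ((N + 1)(N + 2)) on the
event that instance i plays bounds the second moment of the gap on that event by the mean of a
quantity α + β / (N + 2), with N random through the seed only (`integral_indicator_sq_gap_le`).

It remains to study the handover from the old instance to the new one. The old instance has played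
about half of its own loop or more, so its N is of order T. The new instance may be immature, but
then it is rarely played. In round j it plays with probability of order q = p_i^j, after at least
p_i^1 + ... + p_i^j - 2 iterations. Since p_i^j grows by a factor of at most e over S_i rounds, S_i
q is at most e times that sum, so q / (N + 2) is of order 1 / S_i = 4 i / T_i (`integral_new_le`).
The tuning of τ makes both α and β / T of order log(AB) √((A + B) / T), and the extra factor i is of
order log t. In the first 4096 rounds the trivial bound EG ≤ 1 suffices. -/

namespace MatrixGame

/-! ### Divergences on the simplex and closed forms of the two half-steps -/

section Divergence

variable {A : Type*}

/-- The weights whose normalization is the mirror step. -/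
noncomputable def mirrorWeight (η : ℝ) (g base : A → ℝ) : A → ℝ :=
  fun a => base a * Real.exp (-(η * g a))

theorem mirrorWeight_pos (η : ℝ) (g : A → ℝ) {base : A → ℝ} (hb : ∀ a, 0 < base a) (a : A) :
    0 < mirrorWeight η g base a :=
  mul_pos (hb a) (Real.exp_pos _)

variable [Fintype A]

/-- Real-valued Kullback-Leibler divergence, for a positive second argument. -/
noncomputable def klReal (p q : A → ℝ) : ℝ := ∑ a, p a * Real.log (p a / q a)

/-- Negative entropy. -/
noncomputable def negEntropy (p : A → ℝ) : ℝ := ∑ a, p a * Real.log (p a)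

/-- The open simplex. -/
def openSimplex (A : Type*) [Fintype A] : Set (A → ℝ) := {p | (∀ a, 0 < p a) ∧ ∑ a, p a = 1}

/-- The distribution proportional to the weights `w`. -/
noncomputable def normalize (w : A → ℝ) : A → ℝ := fun a => w a / ∑ a', w a'

theorem kl_eq_klReal (p : A → ℝ) {q : A → ℝ} (hq : ∀ a, 0 < q a) :
    kl p q = ((klReal p q : ℝ) : EReal) := by
  unfold kl klReal
  rw [if_pos fun a h => absurd h (hq a).ne']

theorem openSimplex_subset : openSimplex A ⊆ stdSimplex ℝ A :=
  fun _ h => ⟨fun a => (h.1 a).le, h.2⟩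

theorem nonempty_of_mem_stdSimplex {p : A → ℝ} (hp : p ∈ stdSimplex ℝ A) : Nonempty A := by
  by_contra h
  rw [not_nonempty_iff] at h
  simpa using hp.2

theorem sum_pos_of_pos [Nonempty A] {w : A → ℝ} (hw : ∀ a, 0 < w a) : 0 < ∑ a, w a :=
  Finset.sum_pos (fun a _ => hw a) Finset.univ_nonempty

theorem normalize_mem [Nonempty A] {w : A → ℝ} (hw : ∀ a, 0 < w a) :
    normalize w ∈ openSimplex A := by
  have h := sum_pos_of_pos hw
  refine ⟨fun a => div_pos (hw a) h, ?_⟩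
  unfold normalize
  rw [← Finset.sum_div, div_self h.ne']

theorem uniformPolicy_mem [Nonempty A] : uniformPolicy A ∈ openSimplex A := by
  have h : (0 : ℝ) < Fintype.card A := by exact_mod_cast Fintype.card_pos
  refine ⟨fun a => div_pos one_pos h, ?_⟩
  simp [uniformPolicy, h.ne']

/-- Write log(p / q) = -2 log √(q / p) and apply log y ≤ y - 1. The terms p - q disappear after
summation over two distributions, leaving the squared Hellinger distance. -/
theorem hellinger_le_log {p q : ℝ} (hp : 0 ≤ p) (hq : 0 < q) :
    (√p - √q) ^ 2 + p - q ≤ p * Real.log (p / q) := by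
  have hs : 0 < √q := Real.sqrt_pos.2 hq
  have hq2 : √q ^ 2 = q := Real.sq_sqrt hq.le
  have hp2 : √p ^ 2 = p := Real.sq_sqrt hp
  rcases hp.eq_or_lt with rfl | hp0
  · simp [hq2]
  have hr : 0 < √p := Real.sqrt_pos.2 hp0
  have h1 : Real.log (p / q) = -2 * Real.log (√q / √p) := by
    rw [Real.log_div hp0.ne' hq.ne', Real.log_div hs.ne' hr.ne', Real.log_sqrt hp,
      Real.log_sqrt hq.le]
    ring
  have h2 := Real.log_le_sub_one_of_pos (div_pos hs hr)
  have h3 : p * (√q / √p) = √p * √q := by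
    field_simp
    rw [hp2]
  rw [h1]
  nlinarith

theorem hellinger_le_klReal {p q : A → ℝ} (hp : p ∈ stdSimplex ℝ A) (hq : q ∈ openSimplex A) :
    ∑ a, (√(p a) - √(q a)) ^ 2 ≤ klReal p q := by
  have h := Finset.sum_le_sum fun a (_ : a ∈ Finset.univ) =>
    hellinger_le_log (hp.1 a) (hq.1 a)
  rw [Finset.sum_sub_distrib, Finset.sum_add_distrib, hp.2, hq.2] at h
  unfold klReal
  linarith

theorem klReal_nonneg {p q : A → ℝ} (hp : p ∈ stdSimplex ℝ A) (hq : q ∈ openSimplex A) :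
    0 ≤ klReal p q :=
  (Finset.sum_nonneg fun _ _ => sq_nonneg _).trans (hellinger_le_klReal hp hq)

theorem klReal_self {q : A → ℝ} (hq : q ∈ openSimplex A) : klReal q q = 0 :=
  Finset.sum_eq_zero fun a _ => by rw [div_self (hq.1 a).ne', Real.log_one, mul_zero]

theorem eq_of_klReal_nonpos {p q : A → ℝ} (hp : p ∈ stdSimplex ℝ A) (hq : q ∈ openSimplex A)
    (h : klReal p q ≤ 0) : p = q := by
  have h0 : ∑ a, (√(p a) - √(q a)) ^ 2 = 0 :=
    le_antisymm ((hellinger_le_klReal hp hq).trans h) (Finset.sum_nonneg fun _ _ => sq_nonneg _)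
  rw [Finset.sum_eq_zero_iff_of_nonneg fun _ _ => sq_nonneg _] at h0
  funext a
  have h1 := h0 a (Finset.mem_univ a)
  rw [sq_eq_zero_iff, sub_eq_zero, Real.sqrt_inj (hp.1 a) (hq.1 a).le] at h1
  exact h1

/-- A Pinsker-type inequality. -/
theorem sq_sum_abs_sub_le_klReal {p q : A → ℝ} (hp : p ∈ stdSimplex ℝ A)
    (hq : q ∈ openSimplex A) : (∑ a, |p a - q a|) ^ 2 ≤ 4 * klReal p q := by
  have h1 : ∀ a, |p a - q a| = |√(p a) - √(q a)| * (√(p a) + √(q a)) := fun a => by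
    have h : p a - q a = (√(p a) - √(q a)) * (√(p a) + √(q a)) := by
      have e1 := Real.sq_sqrt (hp.1 a)
      have e2 := Real.sq_sqrt (hq.1 a).le
      linear_combination -e1 + e2
    rw [h, abs_mul, abs_of_nonneg (a := √(p a) + √(q a)) (by positivity)]
  have h2 : ∑ a, (√(p a) + √(q a)) ^ 2 ≤ 4 := by
    calc ∑ a, (√(p a) + √(q a)) ^ 2 ≤ ∑ a, (2 * p a + 2 * q a) :=
          Finset.sum_le_sum fun a _ => by
            have e1 := Real.sq_sqrt (hp.1 a)
            have e2 := Real.sq_sqrt (hq.1 a).le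
            nlinarith [sq_nonneg (√(p a) - √(q a))]
      _ = 4 := by
        rw [Finset.sum_add_distrib, ← Finset.mul_sum, ← Finset.mul_sum, hp.2, hq.2]
        norm_num
  -- Cauchy-Schwarz on |p - q| = |√p - √q| (√p + √q). The second factor has squared norm at most 4,
  -- whence the constant.
  have h3 := Finset.sum_mul_sq_le_sq_mul_sq Finset.univ (fun a => |√(p a) - √(q a)|)
    (fun a => √(p a) + √(q a))
  simp only [sq_abs, ← h1] at h3
  have h4 := hellinger_le_klReal hp hq
  have h5 : 0 ≤ ∑ a, (√(p a) - √(q a)) ^ 2 := Finset.sum_nonneg fun _ _ => sq_nonneg _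
  nlinarith [h3]

/-- Divergence from a normalized weight. -/
theorem klReal_normalize {p w : A → ℝ} (hp : p ∈ stdSimplex ℝ A) (hw : ∀ a, 0 < w a) :
    klReal p (normalize w) = ∑ a, p a * Real.log (p a / w a) + Real.log (∑ a, w a) := by
  have := nonempty_of_mem_stdSimplex hp
  have hZ := sum_pos_of_pos hw
  have h : Real.log (∑ a, w a) = ∑ a, p a * Real.log (∑ a, w a) := by
    rw [← Finset.sum_mul, hp.2, one_mul]
  rw [h, ← Finset.sum_add_distrib]
  refine Finset.sum_congr rfl fun a _ => ?_
  rcases (hp.1 a).eq_or_lt with h0 | h0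
  · simp [← h0]
  · unfold normalize
    rw [div_div_eq_mul_div, mul_div_right_comm, Real.log_mul (div_pos h0 (hw a)).ne' hZ.ne']
    ring

theorem klReal_uniformPolicy {p : A → ℝ} (hp : p ∈ stdSimplex ℝ A) :
    klReal p (uniformPolicy A) = negEntropy p + Real.log (Fintype.card A) := by
  have := nonempty_of_mem_stdSimplex hp
  have hn : (0 : ℝ) < Fintype.card A := by exact_mod_cast Fintype.card_pos
  have h : Real.log (Fintype.card A) = ∑ a, p a * Real.log (Fintype.card A) := by
    rw [← Finset.sum_mul, hp.2, one_mul]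
  rw [h, negEntropy, ← Finset.sum_add_distrib]
  refine Finset.sum_congr rfl fun a _ => ?_
  rcases (hp.1 a).eq_or_lt with h0 | h0
  · simp [← h0]
  · unfold uniformPolicy
    rw [div_div_eq_mul_div, div_one, Real.log_mul h0.ne' hn.ne']
    ring

theorem negEntropy_nonpos {p : A → ℝ} (hp : p ∈ stdSimplex ℝ A) : negEntropy p ≤ 0 :=
  Finset.sum_nonpos fun a _ => Real.mul_log_nonpos (hp.1 a)
    (hp.2 ▸ Finset.single_le_sum (fun i _ => hp.1 i) (Finset.mem_univ a))

theorem neg_log_card_le_negEntropy {p : A → ℝ} (hp : p ∈ stdSimplex ℝ A) :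
    -Real.log (Fintype.card A) ≤ negEntropy p := by
  have := nonempty_of_mem_stdSimplex hp
  have h := klReal_nonneg hp uniformPolicy_mem
  rw [klReal_uniformPolicy hp] at h
  linarith

/-- An objective that is, up to a constant, the divergence from `q` has the argmin `q`. -/
theorem argminOn_eq_of_klReal {f : (A → ℝ) → EReal} {q : A → ℝ} (hq : q ∈ openSimplex A) (C : ℝ)
    (hf : ∀ p ∈ stdSimplex ℝ A, f p = ((klReal p q + C : ℝ) : EReal)) :
    argminOn (stdSimplex ℝ A) f = q := by
  have hq' := openSimplex_subset hq
  have hmin : q ∈ stdSimplex ℝ A ∧ IsMinOn f (stdSimplex ℝ A) q := by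
    refine ⟨hq', fun p hp => ?_⟩
    change f q ≤ f p
    rw [hf q hq', hf p hp, klReal_self hq, EReal.coe_le_coe_iff]
    linarith [klReal_nonneg hp hq]
  -- The choice operator returns some minimizer, so identifying it with `q` requires uniqueness,
  -- which comes from the equality case of `klReal_nonneg`.
  have hspec := Classical.epsilon_spec (p := fun x => x ∈ stdSimplex ℝ A ∧
    IsMinOn f (stdSimplex ℝ A) x) ⟨q, hmin⟩
  change argminOn (stdSimplex ℝ A) f ∈ _ ∧ _ at hspec
  obtain ⟨h1, h2⟩ := hspec
  refine eq_of_klReal_nonpos h1 hq ?_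
  have h3 : f (argminOn (stdSimplex ℝ A) f) ≤ f q := h2 hq'
  rw [hf q hq', hf _ h1, klReal_self hq, EReal.coe_le_coe_iff] at h3
  linarith

/-- The weights whose normalization is the regularized policy. -/
noncomputable def regWeight (θ : ℝ) (base : A → ℝ) : A → ℝ :=
  fun a => base a ^ (1 - θ) * uniformPolicy A a ^ θ

theorem regWeight_pos [Nonempty A] (θ : ℝ) {base : A → ℝ} (hb : ∀ a, 0 < base a) (a : A) :
    0 < regWeight θ base a :=
  mul_pos (Real.rpow_pos_of_pos (hb a) _) (Real.rpow_pos_of_pos (uniformPolicy_mem.1 a) _)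

/-- A weighted sum of divergences is, up to a constant, the divergence from the normalized weighted
geometric mean. This gives the argmin and, by comparing two values of the objective, the three-point
inequality. -/
theorem regularize_objective (θ : ℝ) {p base : A → ℝ} (hp : p ∈ stdSimplex ℝ A)
    (hb : ∀ a, 0 < base a) :
    (1 - θ) * klReal p base + θ * klReal p (uniformPolicy A) =
      klReal p (normalize (regWeight θ base)) - Real.log (∑ a, regWeight θ base a) := by
  have := nonempty_of_mem_stdSimplex hp
  rw [klReal_normalize hp (regWeight_pos θ hb), add_sub_cancel_right, klReal, klReal,
    Finset.mul_sum, Finset.mul_sum, ← Finset.sum_add_distrib]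
  refine Finset.sum_congr rfl fun a _ => ?_
  rcases (hp.1 a).eq_or_lt with h0 | h0
  · simp [← h0]
  · have hu := (uniformPolicy_mem (A := A)).1 a
    have hx := hb a
    have h1 := Real.rpow_pos_of_pos hx (1 - θ)
    have h2 := Real.rpow_pos_of_pos hu θ
    unfold regWeight
    rw [Real.log_div h0.ne' hx.ne', Real.log_div h0.ne' hu.ne',
      Real.log_div h0.ne' (mul_pos h1 h2).ne', Real.log_mul h1.ne' h2.ne', Real.log_rpow hx,
      Real.log_rpow hu]
    ring

theorem mirror_objective (η : ℝ) (g : A → ℝ) {p base : A → ℝ} (hp : p ∈ stdSimplex ℝ A)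
    (hb : ∀ a, 0 < base a) :
    η * ∑ a, g a * p a + klReal p base =
      klReal p (normalize (mirrorWeight η g base)) - Real.log (∑ a, mirrorWeight η g base a) := by
  have := nonempty_of_mem_stdSimplex hp
  rw [klReal_normalize hp (mirrorWeight_pos η g hb), add_sub_cancel_right, klReal,
    Finset.mul_sum, ← Finset.sum_add_distrib]
  refine Finset.sum_congr rfl fun a _ => ?_
  rcases (hp.1 a).eq_or_lt with h0 | h0
  · simp [← h0]
  · have hx := hb a
    have h2 := Real.exp_pos (-(η * g a))
    unfold mirrorWeight
    rw [Real.log_div h0.ne' hx.ne', Real.log_div h0.ne' (mul_pos hx h2).ne',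
      Real.log_mul hx.ne' h2.ne', Real.log_exp]
    ring

theorem regularizeStep_eq [Nonempty A] (τ η : ℝ) {base : A → ℝ} (hb : ∀ a, 0 < base a) :
    regularizeStep τ η base = normalize (regWeight (τ * η) base) := by
  refine argminOn_eq_of_klReal (normalize_mem (regWeight_pos _ hb))
    (-Real.log (∑ a, regWeight (τ * η) base a)) fun p hp => ?_
  rw [kl_eq_klReal p hb, kl_eq_klReal p uniformPolicy_mem.1, ← sub_eq_add_neg,
    ← regularize_objective _ hp hb]
  push_cast
  rfl

theorem mirrorStep_eq [Nonempty A] (η : ℝ) (g : A → ℝ) {base : A → ℝ} (hb : ∀ a, 0 < base a) :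
    mirrorStep η g base = normalize (mirrorWeight η g base) := by
  refine argminOn_eq_of_klReal (normalize_mem (mirrorWeight_pos _ _ hb))
    (-Real.log (∑ a, mirrorWeight η g base a)) fun p hp => ?_
  rw [kl_eq_klReal p hb, ← sub_eq_add_neg, ← mirror_objective _ _ hp hb]
  push_cast
  rfl

/-- Three-point inequality of the regularization step. -/
theorem klReal_regularized_le {θ : ℝ} (hθ : θ ≤ 1) {p base : A → ℝ} (hp : p ∈ stdSimplex ℝ A)
    (hb : base ∈ openSimplex A) :
    klReal p (normalize (regWeight θ base)) + θ * negEntropy (normalize (regWeight θ base)) ≤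
      (1 - θ) * klReal p base + θ * negEntropy p := by
  have := nonempty_of_mem_stdSimplex hp
  have hq := normalize_mem (regWeight_pos θ hb.1)
  have hq' := openSimplex_subset hq
  have h1 := regularize_objective θ hp hb.1
  have h2 := regularize_objective θ hq' hb.1
  rw [klReal_self hq, klReal_uniformPolicy hq'] at h2
  rw [klReal_uniformPolicy hp] at h1
  -- The divergence of the regularized policy from `base`, with weight 1 - θ, is discarded. The two
  -- log-cardinalities and the log-normalizers cancel between `h1` and `h2`.
  have h3 := mul_nonneg (sub_nonneg.2 hθ) (klReal_nonneg hq' hb)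
  linarith

/-- (1 - y + y²/2)(1 + y + y²/2) = 1 + y⁴/4 ≥ 1, and the second factor is at most exp y. -/
theorem exp_neg_le_quadratic {y : ℝ} (hy : 0 ≤ y) : Real.exp (-y) ≤ 1 - y + y ^ 2 / 2 := by
  rw [Real.exp_neg, inv_le_iff_one_le_mul₀ (Real.exp_pos y)]
  have h := Real.quadratic_le_exp_of_nonneg hy
  nlinarith [sq_nonneg (y ^ 2), mul_le_mul_of_nonneg_left h
    (show 0 ≤ 1 - y + y ^ 2 / 2 by nlinarith [sq_nonneg (y - 1)])]

/-- One-step inequality of the mirror step with nonnegative losses. -/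
theorem klReal_mirror_le {η : ℝ} (hη : 0 ≤ η) {g p base : A → ℝ} (hg : ∀ a, 0 ≤ g a)
    (hp : p ∈ stdSimplex ℝ A) (hb : base ∈ openSimplex A) :
    klReal p (normalize (mirrorWeight η g base)) ≤
      klReal p base + η * (∑ a, g a * p a - ∑ a, g a * base a) +
        η ^ 2 / 2 * ∑ a, g a ^ 2 * base a := by
  have := nonempty_of_mem_stdSimplex hp
  have h1 := mirror_objective η g hp hb.1
  -- The only error made in the mirror step is in the log-normalizer: log Z ≤ Z - 1, followed by the
  -- quadratic bound on each exponential. This is where nonnegative losses matter, as no upper bound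
  -- on them is needed.
  have h2 := Real.log_le_sub_one_of_pos (sum_pos_of_pos (mirrorWeight_pos η g hb.1))
  have h3 : ∑ a, mirrorWeight η g base a ≤
      1 - η * ∑ a, g a * base a + η ^ 2 / 2 * ∑ a, g a ^ 2 * base a := by
    rw [← hb.2, Finset.mul_sum, Finset.mul_sum, ← Finset.sum_sub_distrib,
      ← Finset.sum_add_distrib]
    refine Finset.sum_le_sum fun a _ => ?_
    have h4 := mul_le_mul_of_nonneg_left (exp_neg_le_quadratic (mul_nonneg hη (hg a)))
      (hb.1 a).le
    unfold mirrorWeight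
    linarith
  linarith

end Divergence

/-! ### Exploitability gap and regularized equilibria -/

section GapBounds

variable {A B : Type*} [Fintype A] [Fintype B]

theorem expLoss_eq_sum_left (L : A → B → ℝ) (μ : A → ℝ) (ν : B → ℝ) :
    expLoss L μ ν = ∑ a, μ a * ∑ b, ν b * L a b := by
  unfold expLoss
  simp only [Finset.mul_sum, mul_assoc]

theorem expLoss_eq_sum_right (L : A → B → ℝ) (μ : A → ℝ) (ν : B → ℝ) :
    expLoss L μ ν = ∑ b, ν b * ∑ a, μ a * L a b := by
  unfold expLoss
  rw [Finset.sum_comm]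
  simp only [Finset.mul_sum]
  exact Finset.sum_congr rfl fun b _ => Finset.sum_congr rfl fun a _ => by ring

theorem sum_mul_mem_Icc {μ f : A → ℝ} (hμ : μ ∈ stdSimplex ℝ A)
    (hf : ∀ a, f a ∈ Set.Icc (0 : ℝ) 1) : ∑ a, μ a * f a ∈ Set.Icc (0 : ℝ) 1 := by
  refine ⟨Finset.sum_nonneg fun a _ => mul_nonneg (hμ.1 a) (hf a).1, ?_⟩
  rw [← hμ.2]
  exact Finset.sum_le_sum fun a _ => mul_le_of_le_one_right (hμ.1 a) (hf a).2

variable {L : A → B → ℝ} (hL : ∀ a b, L a b ∈ Set.Icc (0 : ℝ) 1)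

include hL in
theorem expLoss_mem_Icc {μ : A → ℝ} {ν : B → ℝ} (hμ : μ ∈ stdSimplex ℝ A)
    (hν : ν ∈ stdSimplex ℝ B) : expLoss L μ ν ∈ Set.Icc (0 : ℝ) 1 := by
  rw [expLoss_eq_sum_left]
  exact sum_mul_mem_Icc hμ fun a => sum_mul_mem_Icc hν (hL a)

/-- Both distributions have the same mass, so f may be recentred at 1/2, where it is at most 1/2 in
absolute value. This gains the factor 1/2. -/
theorem sub_sum_mul_le {μ μ' f : A → ℝ} (hμ : ∑ a, μ a = 1) (hμ' : ∑ a, μ' a = 1)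
    (hf : ∀ a, f a ∈ Set.Icc (0 : ℝ) 1) :
    ∑ a, μ a * f a - ∑ a, μ' a * f a ≤ (∑ a, |μ' a - μ a|) / 2 := by
  have h : ∑ a, μ a * f a - ∑ a, μ' a * f a = ∑ a, (μ a - μ' a) * (f a - 1 / 2) := by
    have h1 : ∑ a, (μ a - μ' a) * (f a - 1 / 2) = (∑ a, μ a * f a - ∑ a, μ' a * f a) -
        (∑ a, μ a - ∑ a, μ' a) * (1 / 2) := by
      rw [← Finset.sum_sub_distrib, ← Finset.sum_sub_distrib, Finset.sum_mul,
        ← Finset.sum_sub_distrib]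
      exact Finset.sum_congr rfl fun a _ => by ring
    rw [h1, hμ, hμ']
    ring
  rw [h, Finset.sum_div]
  refine Finset.sum_le_sum fun a _ => (le_abs_self _).trans ?_
  rw [abs_mul, abs_sub_comm, div_eq_mul_inv]
  refine mul_le_mul_of_nonneg_left ?_ (abs_nonneg _)
  rw [abs_le]
  constructor <;> norm_num <;> linarith [(hf a).1, (hf a).2]

include hL in
theorem exploitabilityGap_nonneg {μ : A → ℝ} {ν : B → ℝ} (hμ : μ ∈ stdSimplex ℝ A)
    (hν : ν ∈ stdSimplex ℝ B) : 0 ≤ exploitabilityGap L μ ν := by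
  have h1 : expLoss L μ ν ≤ ⨆ ν' : stdSimplex ℝ B, expLoss L μ (ν' : B → ℝ) :=
    le_ciSup (f := fun ν' : stdSimplex ℝ B => expLoss L μ (ν' : B → ℝ))
      ⟨1, by rintro _ ⟨ν', rfl⟩; exact (expLoss_mem_Icc hL hμ ν'.2).2⟩ ⟨ν, hν⟩
  have h2 : ⨅ μ' : stdSimplex ℝ A, expLoss L (μ' : A → ℝ) ν ≤ expLoss L μ ν :=
    ciInf_le (f := fun μ' : stdSimplex ℝ A => expLoss L (μ' : A → ℝ) ν)
      ⟨0, by rintro _ ⟨μ', rfl⟩; exact (expLoss_mem_Icc hL μ'.2 hν).1⟩ ⟨μ, hμ⟩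
  unfold exploitabilityGap
  linarith

theorem exploitabilityGap_le [Nonempty A] [Nonempty B] {μ : A → ℝ} {ν : B → ℝ} {C : ℝ}
    (h : ∀ μ' ∈ stdSimplex ℝ A, ∀ ν' ∈ stdSimplex ℝ B,
      expLoss L μ ν' - expLoss L μ' ν ≤ C) :
    exploitabilityGap L μ ν ≤ C := by
  have hA : Nonempty (stdSimplex ℝ A) := ⟨⟨_, openSimplex_subset uniformPolicy_mem⟩⟩
  have hB : Nonempty (stdSimplex ℝ B) := ⟨⟨_, openSimplex_subset uniformPolicy_mem⟩⟩
  unfold exploitabilityGap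
  rw [sub_le_iff_le_add]
  refine ciSup_le fun ν' => ?_
  rw [← sub_le_iff_le_add']
  refine le_ciInf fun μ' => ?_
  linarith [h μ' μ'.2 ν' ν'.2]

include hL in
theorem exploitabilityGap_le_one [Nonempty A] [Nonempty B] {μ : A → ℝ} {ν : B → ℝ}
    (hμ : μ ∈ stdSimplex ℝ A) (hν : ν ∈ stdSimplex ℝ B) : exploitabilityGap L μ ν ≤ 1 :=
  exploitabilityGap_le fun μ' hμ' ν' hν' => by
    linarith [(expLoss_mem_Icc hL hμ hν').2, (expLoss_mem_Icc hL hμ' hν).1]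

/-- `(m, n)` is an equilibrium of the game with loss `L` and entropy regularization `τ`. -/
def IsRegularizedEquilibrium (L : A → B → ℝ) (τ : ℝ) (m : A → ℝ) (n : B → ℝ) : Prop :=
  m ∈ stdSimplex ℝ A ∧ n ∈ stdSimplex ℝ B ∧
    ∀ μ ∈ stdSimplex ℝ A, ∀ ν ∈ stdSimplex ℝ B,
      expLoss L m ν - expLoss L μ n ≤
        τ * (negEntropy μ - negEntropy m + (negEntropy ν - negEntropy n))

theorem continuous_negEntropy : Continuous (negEntropy : (A → ℝ) → ℝ) :=
  continuous_finsetSum _ fun a _ => Real.continuous_mul_log.comp (continuous_apply a)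

theorem convexOn_negEntropy : ConvexOn ℝ (stdSimplex ℝ A) (negEntropy : (A → ℝ) → ℝ) := by
  refine ⟨convex_stdSimplex ℝ A, fun μ hμ μ' hμ' s t hs ht hst => ?_⟩
  simp only [negEntropy, Finset.smul_sum]
  rw [← Finset.sum_add_distrib]
  exact Finset.sum_le_sum fun a _ => Real.convexOn_mul_log.2 (hμ.1 a) (hμ'.1 a) hs ht hst

/-- The regularized loss is convex in μ, concave in ν and continuous on compact convex sets, so
Sion's theorem gives a saddle point. The defining inequality is the saddle inequality at (m, n)
rearranged. -/
theorem exists_isRegularizedEquilibrium [Nonempty A] [Nonempty B] (L : A → B → ℝ) {τ : ℝ}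
    (hτ : 0 ≤ τ) : ∃ m n, IsRegularizedEquilibrium L τ m n := by
  have hA : (stdSimplex ℝ A).Nonempty := ⟨_, openSimplex_subset uniformPolicy_mem⟩
  have hB : (stdSimplex ℝ B).Nonempty := ⟨_, openSimplex_subset uniformPolicy_mem⟩
  have hcA := continuous_negEntropy (A := A)
  have hcB := continuous_negEntropy (A := B)
  have hcx : ∀ ν ∈ stdSimplex ℝ B, QuasiconvexOn ℝ (stdSimplex ℝ A)
      fun μ => expLoss L μ ν + τ * negEntropy μ - τ * negEntropy ν := by
    intro ν _
    refine ConvexOn.quasiconvexOn ⟨convex_stdSimplex ℝ A, fun μ hμ μ' hμ' s t hs ht hst => ?_⟩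
    have h1 := mul_le_mul_of_nonneg_left (convexOn_negEntropy.2 hμ hμ' hs ht hst) hτ
    have h2 : expLoss L (s • μ + t • μ') ν = s * expLoss L μ ν + t * expLoss L μ' ν := by
      simp only [expLoss_eq_sum_left, Finset.mul_sum (s := Finset.univ (α := A))]
      rw [← Finset.sum_add_distrib]
      refine Finset.sum_congr rfl fun a _ => ?_
      simp only [Pi.add_apply, Pi.smul_apply, smul_eq_mul]
      ring
    simp only [smul_eq_mul] at h1 ⊢
    rw [h2]
    have h3 : τ * negEntropy ν = s * (τ * negEntropy ν) + t * (τ * negEntropy ν) := by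
      rw [← add_mul, hst, one_mul]
    linarith
  have hcv : ∀ μ ∈ stdSimplex ℝ A, QuasiconcaveOn ℝ (stdSimplex ℝ B)
      fun ν => expLoss L μ ν + τ * negEntropy μ - τ * negEntropy ν := by
    intro μ _
    refine ConcaveOn.quasiconcaveOn ⟨convex_stdSimplex ℝ B, fun ν hν ν' hν' s t hs ht hst => ?_⟩
    have h1 := mul_le_mul_of_nonneg_left (convexOn_negEntropy.2 hν hν' hs ht hst) hτ
    have h2 : expLoss L μ (s • ν + t • ν') = s * expLoss L μ ν + t * expLoss L μ ν' := by
      simp only [expLoss_eq_sum_right, Finset.mul_sum (s := Finset.univ (α := B))]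
      rw [← Finset.sum_add_distrib]
      refine Finset.sum_congr rfl fun a _ => ?_
      simp only [Pi.add_apply, Pi.smul_apply, smul_eq_mul]
      ring
    simp only [smul_eq_mul] at h1 ⊢
    rw [h2]
    have h3 : τ * negEntropy μ = s * (τ * negEntropy μ) + t * (τ * negEntropy μ) := by
      rw [← add_mul, hst, one_mul]
    linarith
  obtain ⟨m, hm, n, hn, h⟩ := Sion.exists_isSaddlePointOn
    (f := fun μ ν => expLoss L μ ν + τ * negEntropy μ - τ * negEntropy ν)
    hA (convex_stdSimplex ℝ A) (isCompact_stdSimplex ℝ A)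
    (fun ν _ => Continuous.lowerSemicontinuous (by unfold expLoss; fun_prop)
      |>.lowerSemicontinuousOn _)
    hcx (convex_stdSimplex ℝ B) hB (isCompact_stdSimplex ℝ B)
    (fun μ _ => Continuous.upperSemicontinuous (by unfold expLoss; fun_prop)
      |>.upperSemicontinuousOn _)
    hcv
  refine ⟨m, n, hm, hn, fun μ hμ ν hν => ?_⟩
  have := h μ hμ ν hν
  simp only at this
  linarith

include hL in
/-- The exploitability gap is controlled by the divergence from a regularized equilibrium. -/
theorem sq_exploitabilityGap_le {τ : ℝ} (hτ : 0 ≤ τ) {m μ : A → ℝ} {n ν : B → ℝ}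
    (heq : IsRegularizedEquilibrium L τ m n) (hμ : μ ∈ openSimplex A) (hν : ν ∈ openSimplex B) :
    exploitabilityGap L μ ν ^ 2 ≤
      2 * (τ * (Real.log (Fintype.card A) + Real.log (Fintype.card B))) ^ 2 +
        4 * (klReal m μ + klReal n ν) := by
  obtain ⟨hm, hn, h⟩ := heq
  have := nonempty_of_mem_stdSimplex hm
  have := nonempty_of_mem_stdSimplex hn
  have hμ' := openSimplex_subset hμ
  have hν' := openSimplex_subset hν
  set l := Real.log (Fintype.card A) + Real.log (Fintype.card B) with hl
  have hgap : exploitabilityGap L μ ν ≤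
      τ * l + ((∑ a, |m a - μ a|) + ∑ b, |n b - ν b|) / 2 := by
    refine exploitabilityGap_le fun μ₁ hμ₁ ν₁ hν₁ => ?_
    have h1 := h μ₁ hμ₁ ν₁ hν₁
    have h2 : τ * (negEntropy μ₁ - negEntropy m + (negEntropy ν₁ - negEntropy n)) ≤ τ * l := by
      refine mul_le_mul_of_nonneg_left ?_ hτ
      linarith [negEntropy_nonpos hμ₁, negEntropy_nonpos hν₁, neg_log_card_le_negEntropy hm,
        neg_log_card_le_negEntropy hn]
    have h3 : expLoss L μ ν₁ - expLoss L m ν₁ ≤ (∑ a, |m a - μ a|) / 2 := by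
      rw [expLoss_eq_sum_left, expLoss_eq_sum_left]
      exact sub_sum_mul_le hμ.2 hm.2 fun a => sum_mul_mem_Icc hν₁ (hL a)
    have h4 : expLoss L μ₁ n - expLoss L μ₁ ν ≤ (∑ b, |n b - ν b|) / 2 := by
      rw [expLoss_eq_sum_right, expLoss_eq_sum_right]
      have := sub_sum_mul_le hn.2 hν.2 fun b => sum_mul_mem_Icc hμ₁ (fun a => hL a b)
      simpa only [abs_sub_comm] using this
    linarith
  have h0 := exploitabilityGap_nonneg hL hμ' hν'
  have k1 := sq_sum_abs_sub_le_klReal hm hμ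
  have k2 := sq_sum_abs_sub_le_klReal hn hν
  set X := ∑ a, |m a - μ a|
  set Y := ∑ b, |n b - ν b|
  calc exploitabilityGap L μ ν ^ 2 ≤ (τ * l + (X + Y) / 2) ^ 2 := pow_le_pow_left₀ h0 hgap 2
    -- (u + v)² ≤ 2u² + 2v² with v = (X + Y) / 2, then (X + Y)² ≤ 2 (X² + Y²).
    _ ≤ 2 * (τ * l) ^ 2 + (X ^ 2 + Y ^ 2) := by
      nlinarith [sq_nonneg (τ * l - (X + Y) / 2), sq_nonneg (X - Y)]
    _ ≤ _ := by linarith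

end GapBounds

/-! ### Lower bounds on the policies and importance-sampled mirror steps -/

section StepBounds

variable {A B : Type*} [Fintype A] [Fintype B]

theorem le_one_of_mem_openSimplex {p : A → ℝ} (hp : p ∈ openSimplex A) (a : A) : p a ≤ 1 :=
  hp.2 ▸ Finset.single_le_sum (fun i _ => (hp.1 i).le) (Finset.mem_univ a)

theorem le_normalize_of_sum_le_one [Nonempty A] {w : A → ℝ} (hw : ∀ a, 0 < w a)
    (h : ∑ a, w a ≤ 1) (a : A) : w a ≤ normalize w a :=
  le_div_self (hw a).le (sum_pos_of_pos hw) h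

/-- The unnormalized weight is a geometric mean of two numbers above δ. By the weighted AM-GM
inequality the weights sum to at most 1, so normalizing only increases them. -/
theorem le_normalize_regWeight [Nonempty A] {θ δ : ℝ} (h0 : 0 ≤ θ) (h1 : θ ≤ 1) (hδ : 0 < δ)
    (hu : δ ≤ 1 / (Fintype.card A : ℝ)) {base : A → ℝ} (hb : base ∈ openSimplex A)
    (hδb : ∀ a, δ ≤ base a) (a : A) : δ ≤ normalize (regWeight θ base) a := by
  have hU := uniformPolicy_mem (A := A)
  have hsum : ∑ a, regWeight θ base a ≤ 1 := by
    calc ∑ a, regWeight θ base a ≤ ∑ a, ((1 - θ) * base a + θ * uniformPolicy A a) :=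
          Finset.sum_le_sum fun a _ => Real.geom_mean_le_arith_mean2_weighted
            (by linarith) h0 (hb.1 a).le (hU.1 a).le (by ring)
      _ = 1 := by
        rw [Finset.sum_add_distrib, ← Finset.mul_sum, ← Finset.mul_sum, hb.2, hU.2]
        ring
  refine le_trans ?_ (le_normalize_of_sum_le_one (regWeight_pos θ hb.1) hsum a)
  calc δ = δ ^ (1 - θ) * δ ^ θ := by
        rw [← Real.rpow_add hδ, sub_add_cancel, Real.rpow_one]
    _ ≤ _ := mul_le_mul (Real.rpow_le_rpow hδ.le (hδb a) (by linarith))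
        (Real.rpow_le_rpow hδ.le hu h0) (Real.rpow_nonneg hδ.le _)
        (Real.rpow_nonneg (hb.1 a).le _)

/-- Nonnegative losses only decrease the weights, so again the normalization increases them, and
each weight has lost a factor of at most exp(-C). -/
theorem le_normalize_mirrorWeight [Nonempty A] {η C δ : ℝ} {g base : A → ℝ}
    (hg : ∀ a, 0 ≤ η * g a) (hC : ∀ a, η * g a ≤ C)
    (hb : base ∈ openSimplex A) (hδb : ∀ a, δ ≤ base a) (a : A) :
    δ * Real.exp (-C) ≤ normalize (mirrorWeight η g base) a := by
  have hsum : ∑ a, mirrorWeight η g base a ≤ 1 := by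
    rw [← hb.2]
    exact Finset.sum_le_sum fun a _ => mul_le_of_le_one_right (hb.1 a).le
      (Real.exp_le_one_iff.2 (neg_nonpos.2 (hg a)))
  refine le_trans ?_ (le_normalize_of_sum_le_one (mirrorWeight_pos η g hb.1) hsum a)
  exact mul_le_mul (hδb a) (Real.exp_le_exp.2 (neg_le_neg (hC a))) (Real.exp_pos _).le
    (hb.1 a).le

theorem klReal_le_neg_log {δ : ℝ} (hδ : 0 < δ) {p q : A → ℝ} (hp : p ∈ stdSimplex ℝ A)
    (hq : ∀ a, δ ≤ q a) : klReal p q ≤ -Real.log δ := by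
  have h : -Real.log δ = ∑ a, p a * -Real.log δ := by rw [← Finset.sum_mul, hp.2, one_mul]
  rw [h]
  refine Finset.sum_le_sum fun a _ => ?_
  rcases (hp.1 a).eq_or_lt with h0 | h0
  · simp [← h0]
  refine mul_le_mul_of_nonneg_left ?_ h0.le
  have hp1 : p a ≤ 1 := hp.2 ▸ Finset.single_le_sum (fun i _ => hp.1 i) (Finset.mem_univ a)
  rw [← Real.log_inv]
  refine Real.log_le_log (div_pos h0 (hδ.trans_le (hq a))) ?_
  rw [← one_div]
  exact div_le_div₀ zero_le_one hp1 hδ (hq a)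

theorem sum_lossEstimate_mul [DecidableEq A] (μ : A → ℝ) (a : A) (x : ℝ) (p : A → ℝ) :
    ∑ a', lossEstimate μ a x a' * p a' = x / μ a * p a := by
  simp [lossEstimate]

theorem sum_sq_lossEstimate_mul [DecidableEq A] (μ : A → ℝ) (a : A) (x : ℝ) (p : A → ℝ) :
    ∑ a', lossEstimate μ a x a' ^ 2 * p a' = (x / μ a) ^ 2 * p a := by
  rw [Finset.sum_eq_single a]
  · simp [lossEstimate]
  · intro a' _ h
    simp [lossEstimate, h]
  · simp

omit [Fintype A] in
theorem lossEstimate_nonneg [DecidableEq A] {μ : A → ℝ} (hμ : ∀ a, 0 < μ a) (a : A) {x : ℝ}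
    (hx : 0 ≤ x) (a' : A) : 0 ≤ lossEstimate μ a x a' := by
  unfold lossEstimate
  split_ifs
  · exact div_nonneg hx (hμ a).le
  · exact le_rfl

omit [Fintype A] in
theorem lossEstimate_le [DecidableEq A] {μ : A → ℝ} {δ : ℝ} (hδ : 0 < δ) (hμ : ∀ a, δ ≤ μ a)
    (a : A) {x : ℝ} (hx : x ≤ 1) (a' : A) : lossEstimate μ a x a' ≤ 1 / δ := by
  unfold lossEstimate
  split_ifs
  · exact div_le_div₀ zero_le_one hx hδ (hμ a)
  · positivity

/-- Mirror step with an importance-sampled loss. -/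
theorem klReal_mirror_lossEstimate_le [DecidableEq A] {η x : ℝ} (hη : 0 ≤ η) (hx0 : 0 ≤ x)
    (hx1 : x ≤ 1) {p base : A → ℝ} (hp : p ∈ stdSimplex ℝ A) (hb : base ∈ openSimplex A)
    (a : A) :
    klReal p (normalize (mirrorWeight η (lossEstimate base a x) base)) ≤
      klReal p base + η * (x * (p a / base a) - x) + η ^ 2 / 2 * (1 / base a) := by
  have h := klReal_mirror_le hη (lossEstimate_nonneg hb.1 a hx0) hp hb
  rw [sum_lossEstimate_mul, sum_lossEstimate_mul, sum_sq_lossEstimate_mul] at h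
  have hpos := hb.1 a
  have e1 : x / base a * p a - x / base a * base a = x * (p a / base a) - x := by
    field_simp
  have e2 : (x / base a) ^ 2 * base a ≤ 1 / base a := by
    have : (x / base a) ^ 2 * base a = x ^ 2 / base a := by field_simp
    rw [this]
    exact div_le_div_of_nonneg_right (by nlinarith) hpos.le
  rw [e1] at h
  have := mul_le_mul_of_nonneg_left e2 (show 0 ≤ η ^ 2 / 2 by positivity)
  linarith

end StepBounds

/-! ### One iteration of regularized EXP3: recursion for the potential -/

namespace InstState

variable {A B : Type*} [Fintype A] [Fintype B]

/-- Both policies of the state have full support. -/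
def Valid (st : InstState A B) : Prop :=
  st.muTau ∈ openSimplex A ∧ st.nuTau ∈ openSimplex B

theorem init_valid [Nonempty A] [Nonempty B] : (init A B).Valid :=
  ⟨uniformPolicy_mem, uniformPolicy_mem⟩

variable [Nonempty A] [Nonempty B] {st : InstState A B}

omit [Nonempty B] in
theorem mu_eq (hst : st.Valid) (q : Params) :
    st.mu q = normalize (regWeight (q.τ * q.η (st.iter + 1)) st.muTau) :=
  regularizeStep_eq _ _ hst.1.1

omit [Nonempty A] in
theorem nu_eq (hst : st.Valid) (q : Params) :
    st.nu q = normalize (regWeight (q.τ * q.η (st.iter + 1)) st.nuTau) :=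
  regularizeStep_eq _ _ hst.2.1

omit [Nonempty B] in
theorem mu_mem (hst : st.Valid) (q : Params) : st.mu q ∈ openSimplex A := by
  rw [mu_eq hst]
  exact normalize_mem (regWeight_pos _ hst.1.1)

omit [Nonempty A] in
theorem nu_mem (hst : st.Valid) (q : Params) : st.nu q ∈ openSimplex B := by
  rw [nu_eq hst]
  exact normalize_mem (regWeight_pos _ hst.2.1)

variable [DecidableEq A] [DecidableEq B]

omit [Nonempty B] in
theorem next_muTau (hst : st.Valid) (q : Params) (a : A) (b : B) (x : ℝ) :
    (st.next q a b x).muTau = normalize (mirrorWeight (q.η (st.iter + 1))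
      (lossEstimate (st.mu q) a x) (st.mu q)) :=
  mirrorStep_eq _ _ (mu_mem hst q).1

omit [Nonempty A] in
theorem next_nuTau (hst : st.Valid) (q : Params) (a : A) (b : B) (x : ℝ) :
    (st.next q a b x).nuTau = normalize (mirrorWeight (q.η (st.iter + 1))
      (lossEstimate (st.nu q) b (1 - x)) (st.nu q)) :=
  mirrorStep_eq _ _ (nu_mem hst q).1

theorem next_valid (hst : st.Valid) (q : Params) (a : A) (b : B) (x : ℝ) :
    (st.next q a b x).Valid := by
  unfold Valid
  rw [next_muTau hst, next_nuTau hst]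
  exact ⟨normalize_mem (mirrorWeight_pos _ _ (mu_mem hst q).1),
    normalize_mem (mirrorWeight_pos _ _ (nu_mem hst q).1)⟩

/-- The product equals 1 when N = 0: the first regularization step forgets its starting point
entirely. -/
theorem tau_mul_eta {τ : ℝ} (hτ : 0 < τ) (N : ℕ) :
    (paramsOf τ).τ * (paramsOf τ).η (N + 1) = 2 / ((N : ℝ) + 2) := by
  change τ * (2 / (τ * (((N + 1 : ℕ) : ℝ) + 1))) = _
  push_cast
  field_simp
  ring

theorem eta_eq {τ : ℝ} (N : ℕ) :
    (paramsOf τ).η (N + 1) = 2 / (τ * ((N : ℝ) + 2)) := by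
  change 2 / (τ * (((N + 1 : ℕ) : ℝ) + 1)) = _
  push_cast
  ring

theorem eta_nonneg {τ : ℝ} (hτ : 0 < τ) (N : ℕ) : 0 ≤ (paramsOf τ).η (N + 1) := by
  rw [eta_eq]
  positivity

theorem eta_le {τ : ℝ} (hτ : 0 < τ) (N : ℕ) : (paramsOf τ).η (N + 1) ≤ 1 / τ := by
  rw [eta_eq, div_le_div_iff₀ (by positivity) hτ]
  nlinarith [mul_nonneg hτ.le (Nat.cast_nonneg (α := ℝ) N)]

theorem two_div_le_one (N : ℕ) : 2 / ((N : ℝ) + 2) ≤ 1 := by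
  rw [div_le_one (by positivity)]
  linarith [Nat.cast_nonneg (α := ℝ) N]

/-- Policies of the state are bounded below by `δ`. -/
def BoundedBelow (δ : ℝ) (st : InstState A B) : Prop :=
  (∀ a, δ ≤ st.muTau a) ∧ ∀ b, δ ≤ st.nuTau b

omit [Nonempty B] [DecidableEq A] [DecidableEq B] in
theorem BoundedBelow.le_mu {τ δ : ℝ} (hτ : 0 < τ) (hδ : 0 < δ)
    (hA : δ ≤ 1 / (Fintype.card A : ℝ)) (hst : st.Valid) (h : st.BoundedBelow δ) (a : A) :
    δ ≤ st.mu (paramsOf τ) a := by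
  rw [mu_eq hst, tau_mul_eta hτ]
  exact le_normalize_regWeight (by positivity) (two_div_le_one _) hδ hA hst.1 h.1 a

omit [Nonempty A] [DecidableEq A] [DecidableEq B] in
theorem BoundedBelow.le_nu {τ δ : ℝ} (hτ : 0 < τ) (hδ : 0 < δ)
    (hB : δ ≤ 1 / (Fintype.card B : ℝ)) (hst : st.Valid) (h : st.BoundedBelow δ) (b : B) :
    δ ≤ st.nu (paramsOf τ) b := by
  rw [nu_eq hst, tau_mul_eta hτ]
  exact le_normalize_regWeight (by positivity) (two_div_le_one _) hδ hB hst.2 h.2 b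

/-- A crude deterministic bound (η ≤ 1/τ and loss estimates at most 1/δ), meant only to make the
random quantities bounded, hence integrable. It never enters the rates. -/
theorem BoundedBelow.next {τ δ : ℝ} (hτ : 0 < τ) (hδ : 0 < δ)
    (hA : δ ≤ 1 / (Fintype.card A : ℝ)) (hB : δ ≤ 1 / (Fintype.card B : ℝ)) (hst : st.Valid)
    (h : st.BoundedBelow δ) (a : A) (b : B) {x : ℝ} (hx : x ∈ Set.Icc (0 : ℝ) 1) :
    (st.next (paramsOf τ) a b x).BoundedBelow (δ * Real.exp (-(1 / τ * (1 / δ)))) := by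
  have hη := eta_nonneg hτ st.iter
  have hη' := eta_le hτ st.iter
  have hmu := h.le_mu hτ hδ hA hst
  have hnu := h.le_nu hτ hδ hB hst
  unfold BoundedBelow
  rw [next_muTau hst, next_nuTau hst]
  refine ⟨le_normalize_mirrorWeight (fun a' => mul_nonneg hη
      (lossEstimate_nonneg (mu_mem hst _).1 a hx.1 a')) (fun a' => ?_) (mu_mem hst _) hmu,
    le_normalize_mirrorWeight (fun a' => mul_nonneg hη
      (lossEstimate_nonneg (nu_mem hst _).1 b (sub_nonneg.2 hx.2) a')) (fun a' => ?_)
      (nu_mem hst _) hnu⟩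
  · exact mul_le_mul hη' (lossEstimate_le hδ hmu a hx.2 a')
      (lossEstimate_nonneg (mu_mem hst _).1 a hx.1 a') (by positivity)
  · exact mul_le_mul hη' (lossEstimate_le hδ hnu b (by linarith [hx.1]) a')
      (lossEstimate_nonneg (nu_mem hst _).1 b (sub_nonneg.2 hx.2) a') (by positivity)

variable (m : A → ℝ) (n : B → ℝ)

/-- Divergence of the policies `μ^{τ,s}`, `ν^{τ,s}` from `(m, n)`. -/
noncomputable def potential (st : InstState A B) : ℝ := klReal m st.muTau + klReal n st.nuTau

/-- Divergence of the policies `μ^s`, `ν^s` from `(m, n)`. -/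
noncomputable def playedPotential (q : Params) (st : InstState A B) : ℝ :=
  klReal m (st.mu q) + klReal n (st.nu q)

/-- The additive constant of the recursion for the potential. -/
noncomputable def driftConst (A B : Type*) [Fintype A] [Fintype B] (τ : ℝ) : ℝ :=
  2 * ((Fintype.card A : ℝ) + Fintype.card B) / τ ^ 2

/-- Weighted and compensated potential, a supermartingale along the iterations. -/
noncomputable def lyapunov (τ : ℝ) (st : InstState A B) : ℝ :=
  st.iter * (st.iter + 1) * st.potential m n - driftConst A B τ * st.iter

/-- Constant part of the bound on the potential after one more iteration, for the actions `a`,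
`b`; the bound is affine in the observed loss. -/
noncomputable def nextConst (τ : ℝ) (st : InstState A B) (a : A) (b : B) : ℝ :=
  st.playedPotential m n (paramsOf τ) +
    (paramsOf τ).η (st.iter + 1) * (n b / st.nu (paramsOf τ) b - 1) +
    (paramsOf τ).η (st.iter + 1) ^ 2 / 2 *
      (1 / st.mu (paramsOf τ) a + 1 / st.nu (paramsOf τ) b)

/-- Slope in the observed loss of the bound on the potential after one more iteration. -/
noncomputable def nextSlope (τ : ℝ) (st : InstState A B) (a : A) (b : B) : ℝ :=
  (paramsOf τ).η (st.iter + 1) *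
    (m a / st.mu (paramsOf τ) a - n b / st.nu (paramsOf τ) b)

variable {m n} {τ : ℝ} (hτ : 0 < τ) (hst : st.Valid)

include hτ hst

/-- The two players' mirror inequalities are added. Only terms affine in the observed loss are kept,
so that conditional averaging replaces the loss by its mean. -/
theorem potential_next_le (hm : m ∈ stdSimplex ℝ A) (hn : n ∈ stdSimplex ℝ B) (a : A) (b : B)
    {x : ℝ} (hx : x ∈ Set.Icc (0 : ℝ) 1) :
    (st.next (paramsOf τ) a b x).potential m n ≤
      st.nextConst m n τ a b + x * st.nextSlope m n τ a b := by
  have hη := eta_nonneg hτ st.iter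
  have h1 := klReal_mirror_lossEstimate_le hη hx.1 hx.2 hm (mu_mem hst (paramsOf τ)) a
  have h2 := klReal_mirror_lossEstimate_le (x := 1 - x) hη (by linarith [hx.2])
    (by linarith [hx.1]) hn (nu_mem hst (paramsOf τ)) b
  unfold potential nextConst nextSlope playedPotential
  rw [next_muTau hst, next_nuTau hst]
  refine (add_le_add h1 h2).trans (le_of_eq ?_)
  ring

theorem lyapunov_next_le (hm : m ∈ stdSimplex ℝ A) (hn : n ∈ stdSimplex ℝ B) (a : A) (b : B)
    {x : ℝ} (hx : x ∈ Set.Icc (0 : ℝ) 1) :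
    (st.next (paramsOf τ) a b x).lyapunov m n τ ≤
      (((st.iter : ℝ) + 1) * (st.iter + 2) * st.nextConst m n τ a b -
        driftConst A B τ * (st.iter + 1)) +
      x * (((st.iter : ℝ) + 1) * (st.iter + 2) * st.nextSlope m n τ a b) := by
  have h := mul_le_mul_of_nonneg_left (potential_next_le hτ hst hm hn a b hx)
    (show 0 ≤ ((st.iter : ℝ) + 1) * (st.iter + 2) by positivity)
  have e : (((st.next (paramsOf τ) a b x).iter : ℕ) : ℝ) = st.iter + 1 := by
    simp [InstState.next]
  unfold lyapunov
  rw [e]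
  linarith

omit [DecidableEq A] [DecidableEq B] in
-- The three-point inequality for both players. The entropies of the played policies are kept exact,
-- since they have to cancel in `average_next_le`.
theorem playedPotential_le (hm : m ∈ stdSimplex ℝ A) (hn : n ∈ stdSimplex ℝ B) :
    st.playedPotential m n (paramsOf τ) +
        2 / ((st.iter : ℝ) + 2) * (negEntropy (st.mu (paramsOf τ)) - negEntropy m +
          (negEntropy (st.nu (paramsOf τ)) - negEntropy n)) ≤
      (1 - 2 / ((st.iter : ℝ) + 2)) * st.potential m n := by
  have h1 := klReal_regularized_le (two_div_le_one st.iter) hm hst.1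
  have h2 := klReal_regularized_le (two_div_le_one st.iter) hn hst.2
  unfold playedPotential potential
  rw [mu_eq hst, nu_eq hst, tau_mul_eta hτ]
  linarith

omit [DecidableEq A] [DecidableEq B] in
-- The supermartingale controls the policies before regularization, whereas the gap concerns those
-- after it. The passage costs the entropy terms `Q`, here bounded below by minus the sum of the
-- log-cardinalities.
theorem playedPotential_le_lyapunov (hm : m ∈ stdSimplex ℝ A) (hn : n ∈ stdSimplex ℝ B) :
    ((st.iter : ℝ) + 1) * (st.iter + 2) * st.playedPotential m n (paramsOf τ) ≤
      st.lyapunov m n τ + (st.iter + 1) * (driftConst A B τ +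
        2 * (Real.log (Fintype.card A) + Real.log (Fintype.card B))) := by
  have h := playedPotential_le hτ hst hm hn
  have h0 : (0 : ℝ) ≤ st.iter := Nat.cast_nonneg _
  have h2 := mul_le_mul_of_nonneg_left h
    (show 0 ≤ ((st.iter : ℝ) + 1) * (st.iter + 2) by positivity)
  have e1 : ((st.iter : ℝ) + 1) * (st.iter + 2) *
      ((1 - 2 / ((st.iter : ℝ) + 2)) * st.potential m n) =
      st.iter * (st.iter + 1) * st.potential m n := by
    field_simp
    ring
  have hc : 0 ≤ driftConst A B τ := by unfold driftConst; positivity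
  set Q := negEntropy (st.mu (paramsOf τ)) - negEntropy m +
          (negEntropy (st.nu (paramsOf τ)) - negEntropy n) with hQ
  have e2 : ((st.iter : ℝ) + 1) * (st.iter + 2) *
      (st.playedPotential m n (paramsOf τ) + 2 / ((st.iter : ℝ) + 2) * Q) =
      ((st.iter : ℝ) + 1) * (st.iter + 2) * st.playedPotential m n (paramsOf τ) +
        (st.iter + 1) * (2 * Q) := by
    field_simp
  rw [e1, e2] at h2
  have h3 : -(Real.log (Fintype.card A) + Real.log (Fintype.card B)) ≤ Q := by
    linarith [negEntropy_nonpos hm, negEntropy_nonpos hn,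
      neg_log_card_le_negEntropy (openSimplex_subset (mu_mem hst (paramsOf τ))),
      neg_log_card_le_negEntropy (openSimplex_subset (nu_mem hst (paramsOf τ)))]
  have h4 := mul_le_mul_of_nonneg_left h3 (show 0 ≤ 2 * ((st.iter : ℝ) + 1) by positivity)
  unfold lyapunov
  linarith

omit [DecidableEq A] [DecidableEq B] in
/-- One-step inequality of the potential, averaged over the actions and the loss. -/
theorem average_next_le {L : A → B → ℝ} (heq : IsRegularizedEquilibrium L τ m n) :
    ∑ a, ∑ b, st.mu (paramsOf τ) a * st.nu (paramsOf τ) b *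
        (st.nextConst m n τ a b + L a b * st.nextSlope m n τ a b) ≤
      (1 - 2 / ((st.iter : ℝ) + 2)) * st.potential m n +
        (paramsOf τ).η (st.iter + 1) ^ 2 / 2 * ((Fintype.card A : ℝ) + Fintype.card B) := by
  have hμ := mu_mem hst (paramsOf τ)
  have hν := nu_mem hst (paramsOf τ)
  have hD := playedPotential_le hτ hst heq.1 heq.2.1
  have hη := eta_nonneg hτ st.iter
  have hτη := tau_mul_eta hτ st.iter
  have hE := heq.2.2 _ (openSimplex_subset hμ) _ (openSimplex_subset hν)
  -- Multiplied by η, the equilibrium inequality carries the factor τη = 2 / (N + 2), so its right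
  -- side is the entropy term on the left of `hD`, and the two cancel.
  have hE' := mul_le_mul_of_nonneg_left hE hη
  rw [← mul_assoc, mul_comm _ τ, show τ * (paramsOf τ).η (st.iter + 1) = 2 / ((st.iter : ℝ) + 2)
    from hτη] at hE'
  unfold nextConst nextSlope
  set μ := st.mu (paramsOf τ)
  set ν := st.nu (paramsOf τ)
  set η := (paramsOf τ).η (st.iter + 1)
  set D := st.playedPotential m n (paramsOf τ)
  have e : ∑ a, ∑ b, μ a * ν b * (D + η * (n b / ν b - 1) + η ^ 2 / 2 * (1 / μ a + 1 / ν b) +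
      L a b * (η * (m a / μ a - n b / ν b))) =
      D + η * (expLoss L m ν - expLoss L μ n) +
        η ^ 2 / 2 * ((Fintype.card A : ℝ) + Fintype.card B) := by
    have hprod : ∑ a, ∑ b, μ a * ν b = 1 := by
      simp_rw [← Finset.mul_sum, hν.2, mul_one, hμ.2]
    have hprod' : ∑ a, ∑ b, μ a * n b = 1 := by
      simp_rw [← Finset.mul_sum, heq.2.1.2, mul_one, hμ.2]
    have hcA : ∑ _a : A, ∑ b, ν b = (Fintype.card A : ℝ) := by simp [hν.2]
    have hcB : ∑ a, ∑ _b : B, μ a = (Fintype.card B : ℝ) := by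
      simp [← Finset.mul_sum, hμ.2]
    -- The sampling probabilities cancel the importance weights. The variance terms become ν b and μ
    -- a, whose double sums are the two cardinalities.
    have hterm : ∀ a b, μ a * ν b * (D + η * (n b / ν b - 1) +
        η ^ 2 / 2 * (1 / μ a + 1 / ν b) + L a b * (η * (m a / μ a - n b / ν b))) =
        (D - η) * (μ a * ν b) + η * (μ a * n b) + η ^ 2 / 2 * ν b + η ^ 2 / 2 * μ a +
          η * (m a * ν b * L a b) - η * (μ a * n b * L a b) := fun a b => by
      have h1 := (hμ.1 a).ne'
      have h2 := (hν.1 b).ne'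
      field_simp
      ring
    have hmul : ∀ (c : ℝ) (f : A → B → ℝ), ∑ a, ∑ b, c * f a b = c * ∑ a, ∑ b, f a b :=
      fun c f => by simp_rw [Finset.mul_sum]
    simp_rw [hterm, Finset.sum_sub_distrib, Finset.sum_add_distrib]
    rw [hmul _ fun a b => μ a * ν b, hmul _ fun a b => μ a * n b, hmul _ fun a b => ν b,
      hmul _ fun a b => μ a, hmul _ fun a b => m a * ν b * L a b,
      hmul _ fun a b => μ a * n b * L a b, hprod, hprod', hcA, hcB]
    unfold expLoss
    ring
  rw [e]
  linarith

omit [DecidableEq A] [DecidableEq B] in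
-- The weights telescope because (N + 1)(N + 2)(1 - 2 / (N + 2)) = N (N + 1). The variance becomes
-- `driftConst` times (N + 1) / (N + 2) ≤ 1, which the compensator absorbs.
theorem average_lyapunov_next_le {L : A → B → ℝ} (heq : IsRegularizedEquilibrium L τ m n) :
    ∑ a, ∑ b, st.mu (paramsOf τ) a * st.nu (paramsOf τ) b *
        ((((st.iter : ℝ) + 1) * (st.iter + 2) * st.nextConst m n τ a b -
            driftConst A B τ * (st.iter + 1)) +
          L a b * (((st.iter : ℝ) + 1) * (st.iter + 2) * st.nextSlope m n τ a b)) ≤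
      st.lyapunov m n τ := by
  have hμ := mu_mem hst (paramsOf τ)
  have hν := nu_mem hst (paramsOf τ)
  have h := average_next_le hτ hst heq
  have h0 : (0 : ℝ) ≤ st.iter := Nat.cast_nonneg _
  have h2 := mul_le_mul_of_nonneg_left h
    (show 0 ≤ ((st.iter : ℝ) + 1) * (st.iter + 2) by positivity)
  have hprod : ∑ a, ∑ b, st.mu (paramsOf τ) a * st.nu (paramsOf τ) b = 1 := by
    simp_rw [← Finset.mul_sum, hν.2, mul_one, hμ.2]
  have e : ∑ a, ∑ b, st.mu (paramsOf τ) a * st.nu (paramsOf τ) b *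
        ((((st.iter : ℝ) + 1) * (st.iter + 2) * st.nextConst m n τ a b -
            driftConst A B τ * (st.iter + 1)) +
          L a b * (((st.iter : ℝ) + 1) * (st.iter + 2) * st.nextSlope m n τ a b)) =
      ((st.iter : ℝ) + 1) * (st.iter + 2) * (∑ a, ∑ b, st.mu (paramsOf τ) a *
        st.nu (paramsOf τ) b * (st.nextConst m n τ a b + L a b * st.nextSlope m n τ a b)) -
      driftConst A B τ * (st.iter + 1) *
        ∑ a, ∑ b, st.mu (paramsOf τ) a * st.nu (paramsOf τ) b := by
    simp_rw [Finset.mul_sum]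
    rw [← Finset.sum_sub_distrib]
    refine Finset.sum_congr rfl fun a _ => ?_
    rw [← Finset.sum_sub_distrib]
    exact Finset.sum_congr rfl fun b _ => by ring
  rw [e, hprod, mul_one]
  rw [eta_eq] at h2
  have e3 : ((st.iter : ℝ) + 1) * (st.iter + 2) *
      ((1 - 2 / ((st.iter : ℝ) + 2)) * st.potential m n +
        (2 / (τ * ((st.iter : ℝ) + 2))) ^ 2 / 2 * ((Fintype.card A : ℝ) + Fintype.card B)) =
      st.iter * (st.iter + 1) * st.potential m n +
        driftConst A B τ * ((st.iter + 1) / (st.iter + 2)) := by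
    unfold driftConst
    field_simp
    ring
  rw [e3] at h2
  have hc : 0 ≤ driftConst A B τ := by unfold driftConst; positivity
  have h5 : ((st.iter : ℝ) + 1) / (st.iter + 2) ≤ 1 := by
    rw [div_le_one (by positivity)]
    linarith
  have h6 := mul_le_mul_of_nonneg_left h5 hc
  unfold lyapunov
  linarith

end InstState

/-! ### Measurability of random states -/

section StateMeasurability

variable {Ω A B : Type*}

/-- A random state all of whose components are measurable. -/
structure MeasurableState (mΩ : MeasurableSpace Ω) (s : Ω → InstState A B) : Prop where
  iter : Measurable[mΩ] fun ω => (s ω).iter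
  muTau : ∀ a, Measurable[mΩ] fun ω => (s ω).muTau a
  nuTau : ∀ b, Measurable[mΩ] fun ω => (s ω).nuTau b

theorem MeasurableState.mono {m₁ m₂ : MeasurableSpace Ω} (h : m₁ ≤ m₂) {s : Ω → InstState A B}
    (hs : MeasurableState m₁ s) : MeasurableState m₂ s :=
  ⟨hs.iter.mono h le_rfl, fun a => (hs.muTau a).mono h le_rfl,
    fun b => (hs.nuTau b).mono h le_rfl⟩

theorem MeasurableState.ite {mΩ : MeasurableSpace Ω} {p : Ω → Prop} [DecidablePred p]
    {s s' : Ω → InstState A B} (hs : MeasurableState mΩ s) (hp : MeasurableSet {ω | p ω})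
    (hs' : MeasurableState mΩ s') :
    MeasurableState mΩ fun ω => if p ω then s ω else s' ω := by
  refine ⟨?_, fun a => ?_, fun b => ?_⟩
  · simp_rw [apply_ite InstState.iter]
    exact Measurable.ite hp hs.iter hs'.iter
  · simp_rw [apply_ite fun st : InstState A B => st.muTau a]
    exact Measurable.ite hp (hs.muTau a) (hs'.muTau a)
  · simp_rw [apply_ite fun st : InstState A B => st.nuTau b]
    exact Measurable.ite hp (hs.nuTau b) (hs'.nuTau b)

theorem measurable_normalize [Fintype A] {mΩ : MeasurableSpace Ω} {w : Ω → A → ℝ}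
    (hw : ∀ a, Measurable fun ω => w ω a) (a : A) : Measurable fun ω => normalize (w ω) a := by
  unfold normalize
  exact (hw a).div (Finset.measurable_fun_sum _ fun a' _ => hw a')

variable {mΩ : MeasurableSpace Ω} {s : Ω → InstState A B}

theorem MeasurableState.comp_iter (hs : MeasurableState mΩ s) {E : Type*} [MeasurableSpace E]
    (f : ℕ → E) : Measurable fun ω => f (s ω).iter :=
  (measurable_from_nat (f := f)).comp hs.iter

theorem measurable_regWeight [Fintype A] {N : Ω → ℕ} (hN : Measurable N) {w : Ω → A → ℝ}
    (hw : ∀ a, Measurable fun ω => w ω a) (f : ℕ → ℝ) (a : A) :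
    Measurable fun ω => regWeight (f (N ω)) (w ω) a := by
  have hf : Measurable fun ω => f (N ω) := (measurable_from_nat (f := f)).comp hN
  unfold regWeight
  exact ((hw a).pow (measurable_const.sub hf)).mul (measurable_const.pow hf)

theorem measurable_mirrorWeight {N : Ω → ℕ} (hN : Measurable N) {g w : Ω → A → ℝ}
    (hg : ∀ a, Measurable fun ω => g ω a)
    (hw : ∀ a, Measurable fun ω => w ω a) (f : ℕ → ℝ) (a : A) :
    Measurable fun ω => mirrorWeight (f (N ω)) (g ω) (w ω) a := by
  have hf : Measurable fun ω => f (N ω) := (measurable_from_nat (f := f)).comp hN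
  unfold mirrorWeight
  exact (hw a).mul (Real.measurable_exp.comp (hf.mul (hg a)).neg)

variable [Fintype A] [Fintype B]

/-- The policies are defined by a choice of minimizer, so measurability is read off from the closed
form, valid for states of full support. -/
theorem MeasurableState.mu [Nonempty A] (hs : MeasurableState mΩ s) (hv : ∀ ω, (s ω).Valid) (q : Params)
    (a : A) : Measurable fun ω => (s ω).mu q a := by
  simp_rw [InstState.mu_eq (hv _)]
  exact measurable_normalize
    (fun a => measurable_regWeight hs.iter hs.muTau (fun k => q.τ * q.η (k + 1)) a) a

theorem MeasurableState.nu [Nonempty B] (hs : MeasurableState mΩ s) (hv : ∀ ω, (s ω).Valid) (q : Params)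
    (b : B) : Measurable fun ω => (s ω).nu q b := by
  simp_rw [InstState.nu_eq (hv _)]
  exact measurable_normalize
    (fun a => measurable_regWeight hs.iter hs.nuTau (fun k => q.τ * q.η (k + 1)) a) b

omit [Fintype A] in
theorem measurable_lossEstimate [DecidableEq A] [MeasurableSpace A] [DiscreteMeasurableSpace A]
    {μ : Ω → A → ℝ} (hμ : ∀ a, Measurable fun ω => μ ω a) {α : Ω → A} (hα : Measurable α)
    {ξ : Ω → ℝ} (hξ : Measurable ξ) (a : A) :
    Measurable fun ω => lossEstimate (μ ω) (α ω) (ξ ω) a := by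
  have e : (fun ω => lossEstimate (μ ω) (α ω) (ξ ω) a) =
      fun ω => if α ω = a then ξ ω / μ ω a else 0 := by
    funext ω
    unfold lossEstimate
    by_cases h : a = α ω
    · simp [h]
    · simp [h, Ne.symm h]
  rw [e]
  exact Measurable.ite (hα (MeasurableSet.of_discrete (s := {a}))) (hξ.div (hμ a))
    measurable_const

theorem MeasurableState.next [Nonempty A] [DecidableEq A] [MeasurableSpace A]
    [DiscreteMeasurableSpace A] [Nonempty B] [DecidableEq B] [MeasurableSpace B] [DiscreteMeasurableSpace B]
    (hs : MeasurableState mΩ s) (hv : ∀ ω, (s ω).Valid) (q : Params) {α : Ω → A}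
    (hα : Measurable α) {β : Ω → B} (hβ : Measurable β) {ξ : Ω → ℝ} (hξ : Measurable ξ) :
    MeasurableState mΩ fun ω => (s ω).next q (α ω) (β ω) (ξ ω) where
  iter := hs.comp_iter fun k => k + 1
  muTau := by
    simp_rw [InstState.next_muTau (hv _)]
    exact measurable_normalize (measurable_mirrorWeight hs.iter
      (measurable_lossEstimate (hs.mu hv q) hα hξ) (hs.mu hv q) fun k => q.η (k + 1))
  nuTau := by
    simp_rw [InstState.next_nuTau (hv _)]
    exact measurable_normalize (measurable_mirrorWeight hs.iter
      (measurable_lossEstimate (hs.nu hv q) hβ (measurable_const.sub hξ)) (hs.nu hv q)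
        fun k => q.η (k + 1))

end StateMeasurability

theorem measurable_callCount (T : ℕ → ℕ) (S : ℕ → ℝ) (i j : ℕ) :
    Measurable fun u => callCount T S u i j :=
  Nat.measurable_floor.comp (measurable_const.add measurable_id)

theorem measurable_activeInst (T : ℕ → ℕ) (S : ℕ → ℝ) (t : ℕ) :
    Measurable fun u => activeInst T S u t := by
  unfold activeInst
  exact Measurable.ite (measurableSet_lt (measurable_callCount _ _ _ _)
    (measurable_callCount _ _ _ _)) measurable_const measurable_const

/-! ### The filtration of the run -/

section History

variable {Ω A B : Type*} [MeasurableSpace A] [MeasurableSpace B]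
  {U : Ω → ℝ} {a : ℕ → Ω → A} {b : ℕ → Ω → B} {x : ℕ → Ω → ℝ}

theorem measurable_history_seed (t : ℕ) : Measurable[history U a b x t] U :=
  measurable_iff_comap_le.2 le_sup_left

theorem comap_le_history {s t : ℕ} (hs : s ∈ Finset.Icc 1 t) :
    MeasurableSpace.comap (a s) inferInstance ⊔ MeasurableSpace.comap (b s) inferInstance ⊔
      MeasurableSpace.comap (x s) inferInstance ≤ history U a b x t :=
  (le_iSup₂ (f := fun s (_ : s ∈ Finset.Icc 1 t) =>
    MeasurableSpace.comap (a s) inferInstance ⊔ MeasurableSpace.comap (b s) inferInstance ⊔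
      MeasurableSpace.comap (x s) inferInstance) s hs).trans le_sup_right

theorem measurable_history_min (t : ℕ) : Measurable[history U a b x (t + 1)] (a (t + 1)) :=
  measurable_iff_comap_le.2
    ((le_sup_left.trans le_sup_left).trans (comap_le_history (by simp)))

theorem measurable_history_max (t : ℕ) : Measurable[history U a b x (t + 1)] (b (t + 1)) :=
  measurable_iff_comap_le.2
    ((le_sup_right.trans le_sup_left).trans (comap_le_history (by simp)))

theorem measurable_history_loss (t : ℕ) : Measurable[history U a b x (t + 1)] (x (t + 1)) :=
  measurable_iff_comap_le.2 (le_sup_right.trans (comap_le_history (by simp)))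

theorem history_le_succ (t : ℕ) : history U a b x t ≤ history U a b x (t + 1) :=
  sup_le_sup le_rfl (iSup₂_mono' fun s hs =>
    ⟨s, Finset.Icc_subset_Icc_right t.le_succ hs, le_rfl⟩)

theorem history_le [mΩ : MeasurableSpace Ω] (hU : Measurable U) (ha : ∀ t, Measurable (a t))
    (hb : ∀ t, Measurable (b t)) (hx : ∀ t, Measurable (x t)) (t : ℕ) :
    history U a b x t ≤ mΩ :=
  sup_le hU.comap_le (iSup₂_le fun s _ =>
    sup_le (sup_le (ha s).comap_le (hb s).comap_le) (hx s).comap_le)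

end History

/-! ### States of the instances along a run -/

section States

variable {Ω A B : Type*} [Fintype A] [DecidableEq A] [Fintype B] [DecidableEq B] (par : ℕ → Params) (T : ℕ → ℕ) (S : ℕ → ℝ)

theorem statesAfter_succ_of_ne {u : ℝ} (a : ℕ → A) (b : ℕ → B) (x : ℕ → ℝ) {t i : ℕ}
    (h : activeInst T S u (t + 1) ≠ i) :
    statesAfter par T S u a b x (t + 1) i = statesAfter par T S u a b x t i :=
  Function.update_of_ne (Ne.symm h) _ _

theorem statesAfter_succ_of_eq {u : ℝ} (a : ℕ → A) (b : ℕ → B) (x : ℕ → ℝ) {t i : ℕ}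
    (h : activeInst T S u (t + 1) = i) :
    statesAfter par T S u a b x (t + 1) i = (statesAfter par T S u a b x t i).next (par i)
      (a (t + 1)) (b (t + 1)) (x (t + 1)) := by
  subst h
  exact Function.update_self _ _ _

theorem statesAfter_iter_le (u : ℝ) (a : ℕ → A) (b : ℕ → B) (x : ℕ → ℝ) (t i : ℕ) :
    (statesAfter par T S u a b x t i).iter ≤ t := by
  induction t with
  | zero => exact le_rfl
  | succ t ih =>
    by_cases h : activeInst T S u (t + 1) = i
    · rw [statesAfter_succ_of_eq _ _ _ _ _ _ h]
      exact Nat.succ_le_succ ih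
    · rw [statesAfter_succ_of_ne _ _ _ _ _ _ h]
      exact ih.trans t.le_succ

variable [Nonempty A] [Nonempty B]

theorem statesAfter_valid (u : ℝ) (a : ℕ → A) (b : ℕ → B) (x : ℕ → ℝ) (t i : ℕ) :
    (statesAfter par T S u a b x t i).Valid := by
  induction t with
  | zero => exact InstState.init_valid
  | succ t ih =>
    by_cases h : activeInst T S u (t + 1) = i
    · rw [statesAfter_succ_of_eq _ _ _ _ _ _ h]
      exact InstState.next_valid ih _ _ _ _
    · rwa [statesAfter_succ_of_ne _ _ _ _ _ _ h]

variable [MeasurableSpace A] [DiscreteMeasurableSpace A] [MeasurableSpace B]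
  [DiscreteMeasurableSpace B]

theorem measurableState_statesAfter (U : Ω → ℝ) (a : ℕ → Ω → A) (b : ℕ → Ω → B)
    (x : ℕ → Ω → ℝ) (t i : ℕ) :
    MeasurableState (history U a b x t) fun ω =>
      statesAfter par T S (U ω) (fun s => a s ω) (fun s => b s ω) (fun s => x s ω) t i := by
  induction t with
  | zero => exact ⟨measurable_const, fun _ => measurable_const, fun _ => measurable_const⟩
  | succ t ih =>
    have ih' := ih.mono (history_le_succ t)
    have hnext := ih'.next (fun ω => statesAfter_valid par T S _ _ _ _ _ _) (par i)
      (measurable_history_min t) (measurable_history_max t) (measurable_history_loss t)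
    have hact : MeasurableSet[history U a b x (t + 1)]
        {ω | activeInst T S (U ω) (t + 1) = i} :=
      ((measurable_activeInst T S (t + 1)).comp (measurable_history_seed (t + 1)))
        (MeasurableSet.of_discrete (s := {i}))
    have e : ∀ ω, statesAfter par T S (U ω) (fun s => a s ω) (fun s => b s ω)
        (fun s => x s ω) (t + 1) i = if activeInst T S (U ω) (t + 1) = i then
          (statesAfter par T S (U ω) (fun s => a s ω) (fun s => b s ω) (fun s => x s ω) t i).next
            (par i) (a (t + 1) ω) (b (t + 1) ω) (x (t + 1) ω)
        else statesAfter par T S (U ω) (fun s => a s ω) (fun s => b s ω) (fun s => x s ω) t i := by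
      intro ω
      split_ifs with h
      · exact statesAfter_succ_of_eq _ _ _ _ _ _ h
      · exact statesAfter_succ_of_ne _ _ _ _ _ _ h
    simp_rw [e]
    exact hnext.ite hact ih'

end States

/-! ### Integrals against the conditional laws of actions and losses -/

section ConditionalLaws

/-- Almost everywhere bounded real functions. -/
def AEBounded {Ω : Type*} [MeasurableSpace Ω] (P : Measure Ω) (f : Ω → ℝ) : Prop :=
  ∃ C, ∀ᵐ ω ∂P, |f ω| ≤ C

namespace AEBounded

variable {Ω : Type*} [MeasurableSpace Ω] {P : Measure Ω} {f g : Ω → ℝ}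

theorem const (c : ℝ) : AEBounded P fun _ => c := ⟨|c|, Filter.Eventually.of_forall fun _ => le_rfl⟩

theorem add (hf : AEBounded P f) (hg : AEBounded P g) : AEBounded P fun ω => f ω + g ω := by
  obtain ⟨C, hC⟩ := hf
  obtain ⟨D, hD⟩ := hg
  refine ⟨C + D, ?_⟩
  filter_upwards [hC, hD] with ω h1 h2 using (abs_add_le _ _).trans (add_le_add h1 h2)

theorem mul (hf : AEBounded P f) (hg : AEBounded P g) : AEBounded P fun ω => f ω * g ω := by
  obtain ⟨C, hC⟩ := hf
  obtain ⟨D, hD⟩ := hg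
  refine ⟨C * D, ?_⟩
  filter_upwards [hC, hD] with ω h1 h2
  rw [abs_mul]
  exact mul_le_mul h1 h2 (abs_nonneg _) ((abs_nonneg _).trans h1)

theorem sub (hf : AEBounded P f) (hg : AEBounded P g) : AEBounded P fun ω => f ω - g ω := by
  simpa [sub_eq_add_neg] using hf.add ((const (-1)).mul hg)

theorem sum {ι : Type*} (s : Finset ι) {F : ι → Ω → ℝ} (h : ∀ i, AEBounded P (F i)) :
    AEBounded P fun ω => ∑ i ∈ s, F i ω := by
  classical
  induction s using Finset.induction_on with
  | empty => simpa using const (P := P) 0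
  | insert i s hi ih => simpa [Finset.sum_insert hi] using (h i).add ih

theorem integrable [IsFiniteMeasure P] (hf : AEBounded P f) (hm : Measurable f) :
    Integrable f P := by
  obtain ⟨C, hC⟩ := hf
  exact Integrable.of_bound hm.aestronglyMeasurable C hC

theorem of_mem_Icc {c d : ℝ} (h : ∀ᵐ ω ∂P, f ω ∈ Set.Icc c d) : AEBounded P f := by
  refine ⟨max |c| |d|, ?_⟩
  filter_upwards [h] with ω hω using abs_le_max_abs_abs hω.1 hω.2

end AEBounded

/-- Replacing a factor by its conditional expectation. -/
theorem integral_mul_eq_of_condExp {Ω : Type*} {m mΩ : MeasurableSpace Ω} (hm : m ≤ mΩ)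
    {P : Measure Ω} [IsFiniteMeasure P] {K f g : Ω → ℝ} (hK : Measurable[m] K)
    (hKb : AEBounded P K) (hf : Integrable f P) (h : P[f | m] =ᵐ[P] g) :
    ∫ ω, K ω * f ω ∂P = ∫ ω, K ω * g ω ∂P := by
  obtain ⟨C, hC⟩ := hKb
  have h1 := condExp_stronglyMeasurable_mul_of_bound hm hK.stronglyMeasurable hf C hC
  change ∫ ω, (K * f) ω ∂P = _
  rw [← integral_condExp hm]
  refine integral_congr_ae ?_
  filter_upwards [h1, h] with ω e1 e2
  rw [e1, Pi.mul_apply, e2]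

theorem measurableSet_actions {Ω A B : Type*} [MeasurableSpace A] [DiscreteMeasurableSpace A]
    [MeasurableSpace B] [DiscreteMeasurableSpace B] (U : Ω → ℝ) (a : ℕ → Ω → A) (b : ℕ → Ω → B)
    (x : ℕ → Ω → ℝ) (t : ℕ) (a₀ : A) (b₀ : B) :
    MeasurableSet[history U a b x t ⊔ MeasurableSpace.comap (a (t + 1)) inferInstance ⊔
      MeasurableSpace.comap (b (t + 1)) inferInstance]
      {ω | a (t + 1) ω = a₀ ∧ b (t + 1) ω = b₀} := by
  refine MeasurableSet.inter ?_ ?_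
  · exact (le_sup_right.trans le_sup_left :
      MeasurableSpace.comap (a (t + 1)) inferInstance ≤ _) _
        ⟨{a₀}, MeasurableSet.of_discrete, rfl⟩
  · exact (le_sup_right : MeasurableSpace.comap (b (t + 1)) inferInstance ≤ _) _
        ⟨{b₀}, MeasurableSet.of_discrete, rfl⟩

variable {Ω A B : Type*} [MeasurableSpace Ω]
  [Fintype A] [DecidableEq A] [MeasurableSpace A]
  [Fintype B] [DecidableEq B] [MeasurableSpace B]
  {P : Measure Ω} {p : A → B → Measure ℝ}
  {par : ℕ → Params} {T : ℕ → ℕ} {S : ℕ → ℝ}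
  {U : Ω → ℝ} {a : ℕ → Ω → A} {b : ℕ → Ω → B} {x : ℕ → Ω → ℝ}

namespace IsDoublingRun

variable (hrun : IsDoublingRun P p par T S U a b x)

include hrun

theorem history_le (t : ℕ) : history U a b x t ≤ (inferInstance : MeasurableSpace Ω) :=
  MatrixGame.history_le hrun.measurable_seed hrun.measurable_min hrun.measurable_max
    hrun.measurable_loss t

theorem historyActions_le (t : ℕ) :
    history U a b x t ⊔ MeasurableSpace.comap (a (t + 1)) inferInstance ⊔
      MeasurableSpace.comap (b (t + 1)) inferInstance ≤ (inferInstance : MeasurableSpace Ω) :=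
  sup_le (sup_le (hrun.history_le t) (hrun.measurable_min _).comap_le)
    (hrun.measurable_max _).comap_le

variable [DiscreteMeasurableSpace A] [DiscreteMeasurableSpace B] [IsProbabilityMeasure P]
  [∀ a b, IsProbabilityMeasure (p a b)]

omit [DiscreteMeasurableSpace A] [DiscreteMeasurableSpace B] in
/-- Law of the loss on an event of the past on which the actions are fixed. -/
theorem map_loss_restrict (t : ℕ) (a₀ : A) (b₀ : B) {F : Set Ω}
    (hF : MeasurableSet[history U a b x t ⊔ MeasurableSpace.comap (a (t + 1)) inferInstance ⊔
      MeasurableSpace.comap (b (t + 1)) inferInstance] F)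
    (hsub : F ⊆ {ω | a (t + 1) ω = a₀ ∧ b (t + 1) ω = b₀}) :
    (P.restrict F).map (x (t + 1)) = P F • p a₀ b₀ := by
  have hx := hrun.measurable_loss (t + 1)
  have hm := hrun.historyActions_le t
  ext E hE
  have hxE : MeasurableSet {ω | x (t + 1) ω ∈ E} := hx hE
  have hFm := hm _ hF
  rw [Measure.map_apply hx hE, Measure.restrict_apply (hx hE), Measure.smul_apply, smul_eq_mul]
  have hint : Integrable ({ω | x (t + 1) ω ∈ E}.indicator fun _ => (1 : ℝ)) P :=
    (integrable_const _).indicator hxE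
  have h1 := setIntegral_condExp hm hint hF
  -- On `F` the two actions are constant, so the conditional law of the loss is the fixed measure `p
  -- a₀ b₀`.
  rw [setIntegral_congr_ae (g := fun _ => (p a₀ b₀).real E) hFm
    (by filter_upwards [hrun.loss_law t E hE] with ω h hω
        rw [h, (hsub hω).1, (hsub hω).2])] at h1
  rw [setIntegral_const, setIntegral_indicator hxE, setIntegral_const] at h1
  simp only [smul_eq_mul, mul_one, Measure.real] at h1
  rw [← ENNReal.toReal_mul, ENNReal.toReal_eq_toReal_iff' (by finiteness) (by finiteness)] at h1
  rw [h1, Set.inter_comm]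
  rfl

/-- There are finitely many action pairs, and on the event of each of them the loss has a law
proportional to `p a₀ b₀`. -/
theorem loss_mem_Icc (hp : ∀ a b, ∀ᵐ y ∂(p a b), y ∈ Set.Icc (0 : ℝ) 1) (t : ℕ) :
    ∀ᵐ ω ∂P, x (t + 1) ω ∈ Set.Icc (0 : ℝ) 1 := by
  have h : ∀ a₀ b₀, ∀ᵐ ω ∂P, a (t + 1) ω = a₀ ∧ b (t + 1) ω = b₀ →
      x (t + 1) ω ∈ Set.Icc (0 : ℝ) 1 := by
    intro a₀ b₀
    have hF := measurableSet_actions U a b x t a₀ b₀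
    have h1 := hrun.map_loss_restrict t a₀ b₀ hF subset_rfl
    have h2 : ∀ᵐ y ∂((P.restrict {ω | a (t + 1) ω = a₀ ∧ b (t + 1) ω = b₀}).map (x (t + 1))),
        y ∈ Set.Icc (0 : ℝ) 1 := by
      rw [h1]
      exact Measure.ae_smul_measure (hp a₀ b₀) _
    exact (ae_restrict_iff' (hrun.historyActions_le t _ hF)).1
      (ae_of_ae_map (hrun.measurable_loss _).aemeasurable h2)
  have h' := ae_all_iff.2 fun a₀ => ae_all_iff.2 (h a₀)
  filter_upwards [h'] with ω hω using hω _ _ ⟨rfl, rfl⟩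

omit [DiscreteMeasurableSpace A] [DiscreteMeasurableSpace B] in
theorem setIntegral_loss (t : ℕ) (a₀ : A) (b₀ : B) {F : Set Ω}
    (hF : MeasurableSet[history U a b x t ⊔ MeasurableSpace.comap (a (t + 1)) inferInstance ⊔
      MeasurableSpace.comap (b (t + 1)) inferInstance] F)
    (hsub : F ⊆ {ω | a (t + 1) ω = a₀ ∧ b (t + 1) ω = b₀}) :
    ∫ ω in F, x (t + 1) ω ∂P = P.real F * meanLoss p a₀ b₀ := by
  have h := hrun.map_loss_restrict t a₀ b₀ hF hsub
  rw [← integral_map (f := fun y : ℝ => y) (hrun.measurable_loss _).aemeasurable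
    measurable_id.aestronglyMeasurable, h, integral_smul_measure]
  rfl

omit [∀ a b, IsProbabilityMeasure (p a b)] in
/-- Conditional law of the actions, times a bounded variable of the past. -/
theorem integral_mul_actions (t : ℕ) (a₀ : A) (b₀ : B) {K : Ω → ℝ}
    (hK : Measurable[history U a b x t] K) (hKb : AEBounded P K) :
    ∫ ω, K ω * {ω | a (t + 1) ω = a₀ ∧ b (t + 1) ω = b₀}.indicator (fun _ => (1 : ℝ)) ω ∂P =
      ∫ ω, K ω * (playedMu par T S (U ω) (fun s => a s ω) (fun s => b s ω) (fun s => x s ω)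
        (t + 1) a₀ * playedNu par T S (U ω) (fun s => a s ω) (fun s => b s ω)
        (fun s => x s ω) (t + 1) b₀) ∂P :=
  integral_mul_eq_of_condExp (hrun.history_le t) hK hKb
    ((integrable_const _).indicator
      (hrun.historyActions_le t _ (measurableSet_actions U a b x t a₀ b₀)))
    (hrun.action_law t a₀ b₀)

/-- Conditional law of the actions and the loss, times a bounded variable of the past. -/
theorem integral_mul_actions_loss (hp : ∀ a b, ∀ᵐ y ∂(p a b), y ∈ Set.Icc (0 : ℝ) 1) (t : ℕ)
    (a₀ : A) (b₀ : B) {K : Ω → ℝ}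
    (hK : Measurable[history U a b x t] K) (hKb : AEBounded P K) :
    ∫ ω, K ω * {ω | a (t + 1) ω = a₀ ∧ b (t + 1) ω = b₀}.indicator (x (t + 1)) ω ∂P =
      ∫ ω, K ω * (meanLoss p a₀ b₀ * (playedMu par T S (U ω) (fun s => a s ω) (fun s => b s ω)
        (fun s => x s ω) (t + 1) a₀ * playedNu par T S (U ω) (fun s => a s ω)
        (fun s => b s ω) (fun s => x s ω) (t + 1) b₀)) ∂P := by
  have hm := hrun.history_le t
  have hE := measurableSet_actions U a b x t a₀ b₀
  have hE' := hrun.historyActions_le t _ hE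
  have hxi : Integrable (x (t + 1)) P :=
    (AEBounded.of_mem_Icc (hrun.loss_mem_Icc hp t)).integrable (hrun.measurable_loss _)
  set E := {ω | a (t + 1) ω = a₀ ∧ b (t + 1) ω = b₀} with hEdef
  have hi1 : Integrable (E.indicator fun _ => (1 : ℝ)) P := (integrable_const _).indicator hE'
  -- Tower property by hand: given the past, the mean of the loss on the event `E` is the mean loss
  -- times the probability of `E`. It is checked on sets `F` of the past, through `F ∩ E`, on which
  -- the actions are fixed.
  have hcond : (fun ω => meanLoss p a₀ b₀ * P[E.indicator (fun _ => (1 : ℝ)) |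
      history U a b x t] ω) =ᵐ[P] P[E.indicator (x (t + 1)) | history U a b x t] := by
    refine ae_eq_condExp_of_forall_setIntegral_eq hm (hxi.indicator hE')
      (fun F _ _ => (integrable_condExp.const_mul _).integrableOn) (fun F hF _ => ?_)
      (stronglyMeasurable_condExp.const_mul _).aestronglyMeasurable
    rw [integral_const_mul, setIntegral_condExp hm hi1 hF, setIntegral_indicator hE',
      setIntegral_indicator hE', setIntegral_const, hrun.setIntegral_loss t a₀ b₀
        (MeasurableSet.inter ((le_sup_left.trans le_sup_left : history U a b x t ≤ _) _ hF) hE)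
        Set.inter_subset_right]
    simp [mul_comm]
  refine integral_mul_eq_of_condExp hm hK hKb (hxi.indicator hE') (hcond.symm.trans ?_)
  filter_upwards [hrun.action_law t a₀ b₀] with ω h
  rw [h]

/-- Conditional expectation of a function of the past and the actions that is affine in the
loss. -/
theorem integral_affine_loss (hp : ∀ a b, ∀ᵐ y ∂(p a b), y ∈ Set.Icc (0 : ℝ) 1) (t : ℕ)
    {G H : A → B → Ω → ℝ}
    (hG : ∀ a₀ b₀, Measurable[history U a b x t] (G a₀ b₀))
    (hGb : ∀ a₀ b₀, AEBounded P (G a₀ b₀))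
    (hH : ∀ a₀ b₀, Measurable[history U a b x t] (H a₀ b₀))
    (hHb : ∀ a₀ b₀, AEBounded P (H a₀ b₀)) :
    Integrable (fun ω => G (a (t + 1) ω) (b (t + 1) ω) ω +
      x (t + 1) ω * H (a (t + 1) ω) (b (t + 1) ω) ω) P ∧
    ∫ ω, (G (a (t + 1) ω) (b (t + 1) ω) ω +
        x (t + 1) ω * H (a (t + 1) ω) (b (t + 1) ω) ω) ∂P =
      ∑ a₀, ∑ b₀, (∫ ω, G a₀ b₀ ω * (playedMu par T S (U ω) (fun s => a s ω)
        (fun s => b s ω) (fun s => x s ω) (t + 1) a₀ * playedNu par T S (U ω)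
        (fun s => a s ω) (fun s => b s ω) (fun s => x s ω) (t + 1) b₀) ∂P +
        ∫ ω, H a₀ b₀ ω * (meanLoss p a₀ b₀ * (playedMu par T S (U ω) (fun s => a s ω)
        (fun s => b s ω) (fun s => x s ω) (t + 1) a₀ * playedNu par T S (U ω)
        (fun s => a s ω) (fun s => b s ω) (fun s => x s ω) (t + 1) b₀)) ∂P) := by
  have hm := hrun.history_le t
  have hE := fun a₀ b₀ => hrun.historyActions_le t _ (measurableSet_actions U a b x t a₀ b₀)
  have hxm := hrun.measurable_loss (t + 1)
  have hxb : AEBounded P (x (t + 1)) := AEBounded.of_mem_Icc (hrun.loss_mem_Icc hp t)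
  -- Splitting according to the finitely many action pairs separates coefficients known from the
  -- past and indicators whose conditional laws are known.
  have e : (fun ω => G (a (t + 1) ω) (b (t + 1) ω) ω +
      x (t + 1) ω * H (a (t + 1) ω) (b (t + 1) ω) ω) = fun ω => ∑ a₀, ∑ b₀,
      (G a₀ b₀ ω * {ω | a (t + 1) ω = a₀ ∧ b (t + 1) ω = b₀}.indicator (fun _ => (1 : ℝ)) ω +
        H a₀ b₀ ω * {ω | a (t + 1) ω = a₀ ∧ b (t + 1) ω = b₀}.indicator (x (t + 1)) ω) := by
    funext ω
    rw [Finset.sum_eq_single (a (t + 1) ω), Finset.sum_eq_single (b (t + 1) ω)]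
    · simp [mul_comm]
    · intro b₀ _ h
      simp [Ne.symm h]
    · simp
    · intro a₀ _ h
      simp [Ne.symm h]
    · simp
  have hi1 : ∀ a₀ b₀, Integrable (fun ω => G a₀ b₀ ω *
      {ω | a (t + 1) ω = a₀ ∧ b (t + 1) ω = b₀}.indicator (fun _ => (1 : ℝ)) ω) P :=
    fun a₀ b₀ => ((hGb a₀ b₀).mul ((AEBounded.of_mem_Icc (c := 0) (d := 1)
      (Filter.Eventually.of_forall fun ω => by
        by_cases h : ω ∈ {ω | a (t + 1) ω = a₀ ∧ b (t + 1) ω = b₀} <;>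
          simp [Set.indicator, h])))).integrable
      (((hG a₀ b₀).mono hm le_rfl).mul (measurable_const.indicator (hE a₀ b₀)))
  have hi2 : ∀ a₀ b₀, Integrable (fun ω => H a₀ b₀ ω *
      {ω | a (t + 1) ω = a₀ ∧ b (t + 1) ω = b₀}.indicator (x (t + 1)) ω) P :=
    fun a₀ b₀ => ((hHb a₀ b₀).mul ((AEBounded.of_mem_Icc (c := 0) (d := 1)
      (by
        filter_upwards [hrun.loss_mem_Icc hp t] with ω hω
        by_cases h : ω ∈ {ω | a (t + 1) ω = a₀ ∧ b (t + 1) ω = b₀}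
        · rw [Set.indicator_of_mem h]
          exact hω
        · rw [Set.indicator_of_notMem h]
          simp)))).integrable
      (((hH a₀ b₀).mono hm le_rfl).mul (hxm.indicator (hE a₀ b₀)))
  have hi : ∀ a₀ b₀, Integrable (fun ω => G a₀ b₀ ω *
      {ω | a (t + 1) ω = a₀ ∧ b (t + 1) ω = b₀}.indicator (fun _ => (1 : ℝ)) ω + H a₀ b₀ ω *
      {ω | a (t + 1) ω = a₀ ∧ b (t + 1) ω = b₀}.indicator (x (t + 1)) ω) P :=
    fun a₀ b₀ => (hi1 a₀ b₀).add (hi2 a₀ b₀)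
  rw [e]
  refine ⟨integrable_finsetSum _ fun a₀ _ => integrable_finsetSum _ fun b₀ _ => hi a₀ b₀, ?_⟩
  rw [integral_finsetSum _ fun a₀ _ => integrable_finsetSum _ fun b₀ _ => hi a₀ b₀]
  refine Finset.sum_congr rfl fun a₀ _ => ?_
  rw [integral_finsetSum _ fun b₀ _ => hi a₀ b₀]
  refine Finset.sum_congr rfl fun b₀ _ => ?_
  rw [integral_add (hi1 a₀ b₀) (hi2 a₀ b₀), hrun.integral_mul_actions t a₀ b₀ (hG a₀ b₀)
    (hGb a₀ b₀), hrun.integral_mul_actions_loss hp t a₀ b₀ (hH a₀ b₀) (hHb a₀ b₀)]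

end IsDoublingRun

end ConditionalLaws

/-! ### Numbers of iterations as functions of the seed -/

section Counting

/-- Number of the rounds `1, ..., t` in which instance `i` is played with the seed `u`. -/
noncomputable def playCount (T : ℕ → ℕ) (S : ℕ → ℝ) (u : ℝ) (t i : ℕ) : ℕ :=
  ∑ s ∈ Finset.range t, if activeInst T S u (s + 1) = i then 1 else 0

theorem measurable_playCount (T : ℕ → ℕ) (S : ℕ → ℝ) (t i : ℕ) :
    Measurable fun u => playCount T S u t i :=
  Finset.measurable_fun_sum _ fun s _ =>
    Measurable.ite ((measurable_activeInst T S (s + 1)) (MeasurableSet.of_discrete (s := {i})))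
      measurable_const measurable_const

/-- The iteration number does not depend on actions or losses. Weights built from it are therefore
functions of the seed, as the reweighted supermartingale requires. -/
theorem statesAfter_iter {A B : Type*} [Fintype A] [DecidableEq A] [Fintype B] [DecidableEq B]
    (par : ℕ → Params) (T : ℕ → ℕ) (S : ℕ → ℝ) (u : ℝ) (a : ℕ → A) (b : ℕ → B) (x : ℕ → ℝ)
    (t i : ℕ) : (statesAfter par T S u a b x t i).iter = playCount T S u t i := by
  induction t with
  | zero => rfl
  | succ t ih =>
    unfold playCount at ih ⊢
    rw [Finset.sum_range_succ, ← ih]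
    by_cases h : activeInst T S u (t + 1) = i
    · rw [statesAfter_succ_of_eq _ _ _ _ _ _ h, if_pos h]
      rfl
    · rw [statesAfter_succ_of_ne _ _ _ _ _ _ h, if_neg h, add_zero]

end Counting

/-! ### Measurability of the exploitability gap -/

section GapMeasurability

variable {A B : Type*} [Fintype A] [Fintype B]

theorem iSup_stdSimplex_eq [Nonempty A] (c : A → ℝ) :
    ⨆ p : stdSimplex ℝ A, ∑ a, (p : A → ℝ) a * c a = ⨆ a, c a := by
  classical
  have : Nonempty (stdSimplex ℝ A) := ⟨⟨_, openSimplex_subset uniformPolicy_mem⟩⟩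
  have hle : ∀ p : stdSimplex ℝ A, ∑ a, (p : A → ℝ) a * c a ≤ ⨆ a, c a := fun p => by
    calc ∑ a, (p : A → ℝ) a * c a ≤ ∑ a, (p : A → ℝ) a * ⨆ a, c a :=
          Finset.sum_le_sum fun a _ => mul_le_mul_of_nonneg_left
            (le_ciSup (Set.finite_range c).bddAbove a) (p.2.1 a)
      _ = ⨆ a, c a := by rw [← Finset.sum_mul, show ∑ a, (p : A → ℝ) a = 1 from p.2.2, one_mul]
  refine le_antisymm (ciSup_le hle) (ciSup_le fun a => ?_)
  have h := le_ciSup (f := fun p : stdSimplex ℝ A => ∑ a, (p : A → ℝ) a * c a)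
    ⟨_, by rintro _ ⟨p, rfl⟩; exact hle p⟩ ⟨Pi.single a 1, single_mem_stdSimplex ℝ a⟩
  simpa [Pi.single_apply] using h

/-- A linear function on the simplex is extremal at a vertex. The uncountable extrema become finite
ones, from which measurability follows. -/
theorem exploitabilityGap_eq [Nonempty A] [Nonempty B] (L : A → B → ℝ) (μ : A → ℝ) (ν : B → ℝ) :
    exploitabilityGap L μ ν = (⨆ b, ∑ a, μ a * L a b) + ⨆ a, -∑ b, ν b * L a b := by
  unfold exploitabilityGap
  have h1 : (⨅ μ' : stdSimplex ℝ A, expLoss L (μ' : A → ℝ) ν) =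
      -⨆ μ' : stdSimplex ℝ A, ∑ a, (μ' : A → ℝ) a * -∑ b, ν b * L a b := by
    rw [iInf, iSup, Real.sInf_def]
    congr 2
    ext y
    simp only [Set.mem_neg, Set.mem_range, expLoss_eq_sum_left, mul_neg, Finset.sum_neg_distrib,
      neg_eq_iff_eq_neg, eq_neg_iff_add_eq_zero, eq_comm]
  rw [h1, iSup_stdSimplex_eq, sub_neg_eq_add]
  simp_rw [expLoss_eq_sum_right]
  rw [iSup_stdSimplex_eq]

theorem measurable_exploitabilityGap [Nonempty A] [Nonempty B] {Ω : Type*}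
    {mΩ : MeasurableSpace Ω} (L : A → B → ℝ)
    {μ : Ω → A → ℝ} {ν : Ω → B → ℝ} (hμ : ∀ a, Measurable fun ω => μ ω a)
    (hν : ∀ b, Measurable fun ω => ν ω b) :
    Measurable fun ω => exploitabilityGap L (μ ω) (ν ω) := by
  simp_rw [exploitabilityGap_eq]
  refine Measurable.add (Measurable.iSup fun b => ?_) (Measurable.iSup fun a => ?_)
  · exact Finset.measurable_fun_sum _ fun a _ => (hμ a).mul_const _
  · exact (Finset.measurable_fun_sum _ fun b _ => (hν b).mul_const _).neg

end GapMeasurability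

/-! ### Boundedness and measurability of the functionals of a state -/

section Bounded

/-- Regularity of a random state which makes all its functionals bounded and measurable. -/
structure RegularState {Ω A B : Type*} [Fintype A] [Fintype B] (m' : MeasurableSpace Ω)
    [MeasurableSpace Ω] (P : Measure Ω) (δ : ℝ) (s : Ω → InstState A B) : Prop where
  pos : 0 < δ
  le_min : δ ≤ 1 / (Fintype.card A : ℝ)
  le_max : δ ≤ 1 / (Fintype.card B : ℝ)
  valid : ∀ ω, (s ω).Valid
  measurable : MeasurableState m' s
  below : ∀ᵐ ω ∂P, (s ω).BoundedBelow δ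
  iter_le : ∃ N, ∀ ω, (s ω).iter ≤ N

theorem measurable_klReal {Ω A : Type*} [Fintype A] {m' : MeasurableSpace Ω} (p : A → ℝ)
    {q : Ω → A → ℝ} (hq : ∀ a, Measurable fun ω => q ω a) :
    Measurable fun ω => klReal p (q ω) :=
  Finset.measurable_fun_sum _ fun a _ =>
    (Real.measurable_log.comp ((hq a).const_div _)).const_mul _

theorem bounded_eta {Ω A B : Type*} [MeasurableSpace Ω] {P : Measure Ω} {τ : ℝ} (hτ : 0 < τ)
    (s : Ω → InstState A B) : AEBounded P fun ω => (paramsOf τ).η ((s ω).iter + 1) :=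
  AEBounded.of_mem_Icc (c := 0) (d := 1 / τ) (Filter.Eventually.of_forall fun _ =>
    ⟨InstState.eta_nonneg hτ _, InstState.eta_le hτ _⟩)

variable {Ω A B : Type*} {m' : MeasurableSpace Ω} [MeasurableSpace Ω] [Fintype A] [Nonempty A]
  [Fintype B] [Nonempty B]
  {P : Measure Ω} {s : Ω → InstState A B} {τ δ : ℝ} {m : A → ℝ} {n : B → ℝ}
  (hs : RegularState m' P δ s)

include hs

namespace RegularState

omit [Nonempty A] [Nonempty B] in
theorem bounded_iter : AEBounded P fun ω => ((s ω).iter : ℝ) := by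
  obtain ⟨N, hN⟩ := hs.iter_le
  exact AEBounded.of_mem_Icc (c := 0) (d := N) (Filter.Eventually.of_forall fun ω =>
    ⟨Nat.cast_nonneg _, Nat.cast_le.2 (hN ω)⟩)

omit [Nonempty B] in
theorem bounded_klReal_mu (hτ : 0 < τ) (hm : m ∈ stdSimplex ℝ A) :
    AEBounded P fun ω => klReal m ((s ω).mu (paramsOf τ)) :=
  AEBounded.of_mem_Icc (c := 0) (d := -Real.log δ) (by
    filter_upwards [hs.below] with ω h
    exact ⟨klReal_nonneg hm (InstState.mu_mem (hs.valid ω) _),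
      klReal_le_neg_log hs.pos hm (h.le_mu hτ hs.pos hs.le_min (hs.valid ω))⟩)

omit [Nonempty A] in
theorem bounded_klReal_nu (hτ : 0 < τ) (hn : n ∈ stdSimplex ℝ B) :
    AEBounded P fun ω => klReal n ((s ω).nu (paramsOf τ)) :=
  AEBounded.of_mem_Icc (c := 0) (d := -Real.log δ) (by
    filter_upwards [hs.below] with ω h
    exact ⟨klReal_nonneg hn (InstState.nu_mem (hs.valid ω) _),
      klReal_le_neg_log hs.pos hn (h.le_nu hτ hs.pos hs.le_max (hs.valid ω))⟩)

omit [Nonempty B] in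
theorem bounded_div_mu (hτ : 0 < τ) (c : ℝ) (a : A) :
    AEBounded P fun ω => c / (s ω).mu (paramsOf τ) a := by
  refine (AEBounded.const c).mul (AEBounded.of_mem_Icc (c := 0) (d := δ⁻¹) ?_)
  filter_upwards [hs.below] with ω h
  exact ⟨inv_nonneg.2 ((InstState.mu_mem (hs.valid ω) _).1 a).le,
    inv_anti₀ hs.pos (h.le_mu hτ hs.pos hs.le_min (hs.valid ω) a)⟩

omit [Nonempty A] in
theorem bounded_div_nu (hτ : 0 < τ) (c : ℝ) (b : B) :
    AEBounded P fun ω => c / (s ω).nu (paramsOf τ) b := by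
  refine (AEBounded.const c).mul (AEBounded.of_mem_Icc (c := 0) (d := δ⁻¹) ?_)
  filter_upwards [hs.below] with ω h
  exact ⟨inv_nonneg.2 ((InstState.nu_mem (hs.valid ω) _).1 b).le,
    inv_anti₀ hs.pos (h.le_nu hτ hs.pos hs.le_max (hs.valid ω) b)⟩

omit [Nonempty A] [Nonempty B] in
theorem bounded_potential (hm : m ∈ stdSimplex ℝ A) (hn : n ∈ stdSimplex ℝ B) :
    AEBounded P fun ω => (s ω).potential m n := by
  refine AEBounded.of_mem_Icc (c := 0) (d := -Real.log δ + -Real.log δ) ?_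
  filter_upwards [hs.below] with ω h
  exact ⟨add_nonneg (klReal_nonneg hm (hs.valid ω).1) (klReal_nonneg hn (hs.valid ω).2),
    add_le_add (klReal_le_neg_log hs.pos hm h.1) (klReal_le_neg_log hs.pos hn h.2)⟩

omit [Nonempty A] [Nonempty B] in
theorem bounded_lyapunov (hm : m ∈ stdSimplex ℝ A) (hn : n ∈ stdSimplex ℝ B) :
    AEBounded P fun ω => (s ω).lyapunov m n τ :=
  ((hs.bounded_iter.mul (hs.bounded_iter.add (AEBounded.const 1))).mul
    (hs.bounded_potential hm hn)).sub ((AEBounded.const _).mul hs.bounded_iter)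

theorem bounded_nextConst (hτ : 0 < τ) (hm : m ∈ stdSimplex ℝ A) (hn : n ∈ stdSimplex ℝ B)
    (a : A) (b : B) : AEBounded P fun ω => (s ω).nextConst m n τ a b := by
  have h1 : AEBounded P fun ω => (paramsOf τ).η ((s ω).iter + 1) ^ 2 / 2 := by
    simpa [div_eq_mul_inv, sq] using
      ((bounded_eta hτ s).mul (bounded_eta hτ s)).mul (AEBounded.const (2⁻¹))
  exact (((hs.bounded_klReal_mu hτ hm).add (hs.bounded_klReal_nu hτ hn)).add
    ((bounded_eta hτ s).mul ((hs.bounded_div_nu hτ _ b).sub (AEBounded.const 1)))).add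
    (h1.mul ((hs.bounded_div_mu hτ 1 a).add (hs.bounded_div_nu hτ 1 b)))

theorem bounded_nextSlope (hτ : 0 < τ) (a : A) (b : B) :
    AEBounded P fun ω => (s ω).nextSlope m n τ a b :=
  (bounded_eta hτ s).mul ((hs.bounded_div_mu hτ _ a).sub (hs.bounded_div_nu hτ _ b))

omit [Nonempty A] [Nonempty B] in
theorem measurable_iter : Measurable[m'] fun ω => ((s ω).iter : ℝ) :=
  hs.measurable.comp_iter fun k => (k : ℝ)

omit [Nonempty A] [Nonempty B] in
theorem measurable_lyapunov : Measurable[m'] fun ω => (s ω).lyapunov m n τ :=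
  ((hs.measurable_iter.mul (hs.measurable_iter.add_const 1)).mul
    ((measurable_klReal m hs.measurable.muTau).add
      (measurable_klReal n hs.measurable.nuTau))).sub (hs.measurable_iter.const_mul _)

theorem measurable_nextConst (a : A) (b : B) :
    Measurable[m'] fun ω => (s ω).nextConst m n τ a b := by
  have hη : Measurable[m'] fun ω => (paramsOf τ).η ((s ω).iter + 1) :=
    hs.measurable.comp_iter fun k => (paramsOf τ).η (k + 1)
  have hμ := hs.measurable.mu hs.valid (paramsOf τ)
  have hν := hs.measurable.nu hs.valid (paramsOf τ)
  exact (((measurable_klReal m hμ).add (measurable_klReal n hν)).add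
    (hη.mul (((hν b).const_div _).sub_const 1))).add
    (((hη.pow_const 2).div_const 2).mul (((hμ a).const_div 1).add ((hν b).const_div 1)))

theorem measurable_nextSlope (a : A) (b : B) :
    Measurable[m'] fun ω => (s ω).nextSlope m n τ a b :=
  (hs.measurable.comp_iter fun k => (paramsOf τ).η (k + 1)).mul
    (((hs.measurable.mu hs.valid (paramsOf τ) a).const_div _).sub
      ((hs.measurable.nu hs.valid (paramsOf τ) b).const_div _))

end RegularState

end Bounded

/-- State of instance `i` after `t` rounds of a random run. -/
noncomputable def runState {Ω A B : Type*} [Fintype A] [DecidableEq A] [Fintype B]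
    [DecidableEq B] (par : ℕ → Params) (T : ℕ → ℕ) (S : ℕ → ℝ) (U : Ω → ℝ) (a : ℕ → Ω → A)
    (b : ℕ → Ω → B) (x : ℕ → Ω → ℝ) (t i : ℕ) (ω : Ω) : InstState A B :=
  statesAfter par T S (U ω) (fun s => a s ω) (fun s => b s ω) (fun s => x s ω) t i

/-! ### The reweighted supermartingale and the second moment of the gap -/

section Supermartingale

variable {Ω A B : Type*} [MeasurableSpace Ω]
  [Fintype A] [DecidableEq A] [Nonempty A] [MeasurableSpace A] [DiscreteMeasurableSpace A]
  [Fintype B] [DecidableEq B] [Nonempty B] [MeasurableSpace B] [DiscreteMeasurableSpace B]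
  {P : Measure Ω} [IsProbabilityMeasure P] {p : A → B → Measure ℝ}
  [∀ a b, IsProbabilityMeasure (p a b)]
  {par : ℕ → Params} {T : ℕ → ℕ} {S : ℕ → ℝ}
  {U : Ω → ℝ} {a : ℕ → Ω → A} {b : ℕ → Ω → B} {x : ℕ → Ω → ℝ}

namespace IsDoublingRun

variable (hrun : IsDoublingRun P p par T S U a b x)
  (hp : ∀ a b, ∀ᵐ y ∂(p a b), y ∈ Set.Icc (0 : ℝ) 1)
  {i : ℕ} {τ : ℝ} (hτ : 0 < τ) (hpar : par i = paramsOf τ)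

include hrun hp hτ hpar

/-- The constant δ depends on t and may be tiny, but it is deterministic. This is all that
integrability after t rounds needs. -/
theorem exists_regularState (t : ℕ) :
    ∃ δ, RegularState (history U a b x t) P δ (runState par T S U a b x t i) := by
  suffices h : ∃ δ, 0 < δ ∧ δ ≤ 1 / (Fintype.card A : ℝ) ∧ δ ≤ 1 / (Fintype.card B : ℝ) ∧
      ∀ᵐ ω ∂P, (runState par T S U a b x t i ω).BoundedBelow δ by
    obtain ⟨δ, h1, h2, h3, h4⟩ := h
    exact ⟨δ, h1, h2, h3, fun ω => statesAfter_valid _ _ _ _ _ _ _ _ _,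
      measurableState_statesAfter par T S U a b x t i, h4,
      t, fun ω => statesAfter_iter_le _ _ _ _ _ _ _ _ _⟩
  induction t with
  | zero =>
    have hA : (0 : ℝ) < 1 / Fintype.card A := by
      have : (0 : ℝ) < Fintype.card A := by exact_mod_cast Fintype.card_pos
      positivity
    have hB : (0 : ℝ) < 1 / Fintype.card B := by
      have : (0 : ℝ) < Fintype.card B := by exact_mod_cast Fintype.card_pos
      positivity
    exact ⟨min (1 / (Fintype.card A : ℝ)) (1 / (Fintype.card B : ℝ)), lt_min hA hB,
      min_le_left _ _, min_le_right _ _, Filter.Eventually.of_forall fun ω =>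
        ⟨fun _ => min_le_left _ _, fun _ => min_le_right _ _⟩⟩
  | succ t ih =>
    obtain ⟨δ, h1, h2, h3, h4⟩ := ih
    have hle : δ * Real.exp (-(1 / τ * (1 / δ))) ≤ δ :=
      mul_le_of_le_one_right h1.le (Real.exp_le_one_iff.2 (neg_nonpos.2 (by positivity)))
    refine ⟨δ * Real.exp (-(1 / τ * (1 / δ))), by positivity, hle.trans h2, hle.trans h3, ?_⟩
    filter_upwards [h4, hrun.loss_mem_Icc hp t] with ω hω hx
    unfold runState at hω ⊢
    by_cases h : activeInst T S (U ω) (t + 1) = i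
    · rw [statesAfter_succ_of_eq _ _ _ _ _ _ h, hpar]
      exact hω.next hτ h1 h2 h3 (statesAfter_valid _ _ _ _ _ _ _ _ _) _ _ hx
    · rw [statesAfter_succ_of_ne _ _ _ _ _ _ h]
      exact ⟨fun a => hle.trans (hω.1 a), fun b => hle.trans (hω.2 b)⟩

variable {m : A → ℝ} {n : B → ℝ}
  (heq : IsRegularizedEquilibrium (meanLoss p) τ m n)

include heq

/-- The compensated potential of an instance is a supermartingale, also after reweighting by a
function of the seed. -/
theorem integral_lyapunov_succ_le (t : ℕ) {f : ℝ → ℝ} (hf : Measurable f) (hf0 : ∀ u, 0 ≤ f u)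
    {C : ℝ} (hfC : ∀ u, f u ≤ C) :
    ∫ ω, f (U ω) * (runState par T S U a b x (t + 1) i ω).lyapunov m n τ ∂P ≤
      ∫ ω, f (U ω) * (runState par T S U a b x t i ω).lyapunov m n τ ∂P := by
  obtain ⟨δ, hs⟩ := hrun.exists_regularState hp hτ hpar t
  obtain ⟨δ', hs'⟩ := hrun.exists_regularState hp hτ hpar (t + 1)
  set s := runState par T S U a b x t i with hsdef
  have hm := heq.1
  have hn := heq.2.1
  have hF := hrun.history_le t
  have hUm : Measurable[history U a b x t] U := measurable_history_seed t
  have hact : MeasurableSet {u | activeInst T S u (t + 1) = i} :=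
    (measurable_activeInst T S (t + 1)) (MeasurableSet.of_discrete (s := {i}))
  -- The weight is split according to whether the instance plays in the next round: the state moves
  -- on the support of `e` and is frozen on that of `e'`.
  set e : ℝ → ℝ := fun u => if activeInst T S u (t + 1) = i then f u else 0 with he
  set e' : ℝ → ℝ := fun u => if activeInst T S u (t + 1) = i then 0 else f u with he'
  have hem : Measurable e := Measurable.ite hact hf measurable_const
  have hem' : Measurable e' := Measurable.ite hact measurable_const hf
  have heU : Measurable[history U a b x t] fun ω => e (U ω) := hem.comp hUm
  have hC : 0 ≤ C := (hf0 0).trans (hfC 0)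
  have heb : AEBounded P fun ω => e (U ω) := AEBounded.of_mem_Icc (c := 0) (d := C)
    (Filter.Eventually.of_forall fun ω => by
      simp only [he]
      split_ifs
      exacts [⟨hf0 _, hfC _⟩, ⟨le_rfl, hC⟩])
  have heb' : AEBounded P fun ω => e' (U ω) := AEBounded.of_mem_Icc (c := 0) (d := C)
    (Filter.Eventually.of_forall fun ω => by
      simp only [he']
      split_ifs
      exacts [⟨le_rfl, hC⟩, ⟨hf0 _, hfC _⟩])
  have hfb : AEBounded P fun ω => f (U ω) := AEBounded.of_mem_Icc (c := 0) (d := C)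
    (Filter.Eventually.of_forall fun ω => ⟨hf0 _, hfC _⟩)
  have hfm : Measurable fun ω => f (U ω) := hf.comp hrun.measurable_seed
  set G : A → B → Ω → ℝ := fun a₀ b₀ ω => e (U ω) *
    ((((s ω).iter : ℝ) + 1) * ((s ω).iter + 2) * (s ω).nextConst m n τ a₀ b₀ -
            InstState.driftConst A B τ * ((s ω).iter + 1)) with hG
  set H : A → B → Ω → ℝ := fun a₀ b₀ ω => e (U ω) *
    ((((s ω).iter : ℝ) + 1) * ((s ω).iter + 2) * (s ω).nextSlope m n τ a₀ b₀) with hH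
  have hN1 : AEBounded P fun ω => ((s ω).iter : ℝ) + 1 := hs.bounded_iter.add (AEBounded.const 1)
  have hN2 : AEBounded P fun ω => (((s ω).iter : ℝ) + 1) * ((s ω).iter + 2) :=
    hN1.mul (hs.bounded_iter.add (AEBounded.const 2))
  have hN1m : Measurable[history U a b x t] fun ω => ((s ω).iter : ℝ) + 1 :=
    hs.measurable_iter.add_const 1
  have hN2m : Measurable[history U a b x t] fun ω => (((s ω).iter : ℝ) + 1) * ((s ω).iter + 2) :=
    hN1m.mul (hs.measurable_iter.add_const 2)
  have hGm : ∀ a₀ b₀, Measurable[history U a b x t] (G a₀ b₀) := fun a₀ b₀ =>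
    heU.mul ((hN2m.mul (hs.measurable_nextConst a₀ b₀)).sub (hN1m.const_mul _))
  have hGb : ∀ a₀ b₀, AEBounded P (G a₀ b₀) := fun a₀ b₀ =>
    heb.mul ((hN2.mul (hs.bounded_nextConst hτ hm hn a₀ b₀)).sub ((AEBounded.const _).mul hN1))
  have hHm : ∀ a₀ b₀, Measurable[history U a b x t] (H a₀ b₀) := fun a₀ b₀ =>
    heU.mul (hN2m.mul (hs.measurable_nextSlope a₀ b₀))
  have hHb : ∀ a₀ b₀, AEBounded P (H a₀ b₀) := fun a₀ b₀ =>
    heb.mul (hN2.mul (hs.bounded_nextSlope hτ a₀ b₀))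
  obtain ⟨hint, hval⟩ := hrun.integral_affine_loss hp t hGm hGb hHm hHb
  have hLm : Measurable fun ω => (s ω).lyapunov m n τ := hs.measurable_lyapunov.mono hF le_rfl
  have hLb : AEBounded P fun ω => (s ω).lyapunov m n τ := hs.bounded_lyapunov hm hn
  have hint_e : Integrable (fun ω => e (U ω) * (s ω).lyapunov m n τ) P :=
    (heb.mul hLb).integrable ((hem.comp hrun.measurable_seed).mul hLm)
  have hint_e' : Integrable (fun ω => e' (U ω) * (s ω).lyapunov m n τ) P :=
    (heb'.mul hLb).integrable ((hem'.comp hrun.measurable_seed).mul hLm)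
  have hint_succ : Integrable (fun ω =>
      f (U ω) * (runState par T S U a b x (t + 1) i ω).lyapunov m n τ) P :=
    (hfb.mul (hs'.bounded_lyapunov hm hn)).integrable
      (hfm.mul (hs'.measurable_lyapunov.mono (hrun.history_le (t + 1)) le_rfl))
  have hstep : ∀ᵐ ω ∂P, f (U ω) * (runState par T S U a b x (t + 1) i ω).lyapunov m n τ ≤
      (G (a (t + 1) ω) (b (t + 1) ω) ω + x (t + 1) ω * H (a (t + 1) ω) (b (t + 1) ω) ω) +
        e' (U ω) * (s ω).lyapunov m n τ := by
    filter_upwards [hrun.loss_mem_Icc hp t] with ω hx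
    by_cases h : activeInst T S (U ω) (t + 1) = i
    · have e1 : runState par T S U a b x (t + 1) i ω =
          (s ω).next (paramsOf τ) (a (t + 1) ω) (b (t + 1) ω) (x (t + 1) ω) := by
        rw [← hpar]
        exact statesAfter_succ_of_eq _ _ _ _ _ _ h
      have h1 := mul_le_mul_of_nonneg_left (InstState.lyapunov_next_le hτ (hs.valid ω) hm hn
        (a (t + 1) ω) (b (t + 1) ω) hx) (hf0 (U ω))
      rw [e1]
      simp only [hG, hH, he, he', if_pos h]
      linarith
    · have e1 : runState par T S U a b x (t + 1) i ω = s ω :=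
        statesAfter_succ_of_ne _ _ _ _ _ _ h
      rw [e1]
      simp [hG, hH, he, he', h]
  -- The profile played belongs to the active instance. Since `e` vanishes when that is not instance
  -- i, the policies of instance i may be substituted.
  have hplayed : ∀ a₀ b₀ ω, e (U ω) * (playedMu par T S (U ω) (fun s => a s ω)
        (fun s => b s ω) (fun s => x s ω) (t + 1) a₀ * playedNu par T S (U ω)
        (fun s => a s ω) (fun s => b s ω) (fun s => x s ω) (t + 1) b₀) =
      e (U ω) * ((s ω).mu (paramsOf τ) a₀ * (s ω).nu (paramsOf τ) b₀) := by
    intro a₀ b₀ ω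
    by_cases h : activeInst T S (U ω) (t + 1) = i
    · unfold playedMu playedNu
      rw [h, hpar]
      rfl
    · simp [he, h]
  have hmub : ∀ a₀ b₀, AEBounded P fun ω =>
      (s ω).mu (paramsOf τ) a₀ * (s ω).nu (paramsOf τ) b₀ := fun a₀ b₀ =>
    (AEBounded.of_mem_Icc (c := 0) (d := 1) (Filter.Eventually.of_forall fun ω =>
      ⟨((InstState.mu_mem (hs.valid ω) _).1 a₀).le,
        le_one_of_mem_openSimplex (InstState.mu_mem (hs.valid ω) _) a₀⟩)).mul
    (AEBounded.of_mem_Icc (c := 0) (d := 1) (Filter.Eventually.of_forall fun ω =>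
      ⟨((InstState.nu_mem (hs.valid ω) _).1 b₀).le,
        le_one_of_mem_openSimplex (InstState.nu_mem (hs.valid ω) _) b₀⟩))
  have hmum : ∀ a₀ b₀, Measurable fun ω =>
      (s ω).mu (paramsOf τ) a₀ * (s ω).nu (paramsOf τ) b₀ := fun a₀ b₀ =>
    ((hs.measurable.mu hs.valid _ a₀).mul (hs.measurable.nu hs.valid _ b₀)).mono hF le_rfl
  have hGi : ∀ a₀ b₀, Integrable (fun ω => G a₀ b₀ ω *
      ((s ω).mu (paramsOf τ) a₀ * (s ω).nu (paramsOf τ) b₀)) P := fun a₀ b₀ =>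
    ((hGb a₀ b₀).mul (hmub a₀ b₀)).integrable (((hGm a₀ b₀).mono hF le_rfl).mul (hmum a₀ b₀))
  have hHi : ∀ a₀ b₀, Integrable (fun ω => H a₀ b₀ ω * (meanLoss p a₀ b₀ *
      ((s ω).mu (paramsOf τ) a₀ * (s ω).nu (paramsOf τ) b₀))) P := fun a₀ b₀ =>
    ((hHb a₀ b₀).mul ((AEBounded.const _).mul (hmub a₀ b₀))).integrable
      (((hHm a₀ b₀).mono hF le_rfl).mul ((hmum a₀ b₀).const_mul _))
  have hGH : ∀ a₀ b₀, Integrable (fun ω => G a₀ b₀ ω *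
      ((s ω).mu (paramsOf τ) a₀ * (s ω).nu (paramsOf τ) b₀) + H a₀ b₀ ω * (meanLoss p a₀ b₀ *
      ((s ω).mu (paramsOf τ) a₀ * (s ω).nu (paramsOf τ) b₀))) P := fun a₀ b₀ =>
    (hGi a₀ b₀).add (hHi a₀ b₀)
  have hval' : ∫ ω, (G (a (t + 1) ω) (b (t + 1) ω) ω +
        x (t + 1) ω * H (a (t + 1) ω) (b (t + 1) ω) ω) ∂P =
      ∫ ω, ∑ a₀, ∑ b₀, (G a₀ b₀ ω *
      ((s ω).mu (paramsOf τ) a₀ * (s ω).nu (paramsOf τ) b₀) + H a₀ b₀ ω * (meanLoss p a₀ b₀ *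
      ((s ω).mu (paramsOf τ) a₀ * (s ω).nu (paramsOf τ) b₀))) ∂P := by
    rw [hval, integral_finsetSum _ fun a₀ _ => integrable_finsetSum _ fun b₀ _ => hGH a₀ b₀]
    refine Finset.sum_congr rfl fun a₀ _ => ?_
    rw [integral_finsetSum _ fun b₀ _ => hGH a₀ b₀]
    refine Finset.sum_congr rfl fun b₀ _ => ?_
    rw [integral_add (hGi a₀ b₀) (hHi a₀ b₀)]
    congr 1
    · refine integral_congr_ae (Filter.Eventually.of_forall fun ω => ?_)
      have := hplayed a₀ b₀ ω
      simp only [hG]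
      linear_combination ((((s ω).iter : ℝ) + 1) * ((s ω).iter + 2) *
        (s ω).nextConst m n τ a₀ b₀ - InstState.driftConst A B τ * ((s ω).iter + 1)) * this
    · refine integral_congr_ae (Filter.Eventually.of_forall fun ω => ?_)
      have := hplayed a₀ b₀ ω
      simp only [hH]
      linear_combination ((((s ω).iter : ℝ) + 1) * ((s ω).iter + 2) *
        (s ω).nextSlope m n τ a₀ b₀) * meanLoss p a₀ b₀ * this
  have havg : ∫ ω, ∑ a₀, ∑ b₀, (G a₀ b₀ ω *
      ((s ω).mu (paramsOf τ) a₀ * (s ω).nu (paramsOf τ) b₀) + H a₀ b₀ ω * (meanLoss p a₀ b₀ *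
      ((s ω).mu (paramsOf τ) a₀ * (s ω).nu (paramsOf τ) b₀))) ∂P ≤
      ∫ ω, e (U ω) * (s ω).lyapunov m n τ ∂P := by
    refine integral_mono (integrable_finsetSum _ fun a₀ _ => integrable_finsetSum _ fun b₀ _ =>
      hGH a₀ b₀) hint_e fun ω => ?_
    have h1 : 0 ≤ e (U ω) := by
      simp only [he]
      split_ifs
      exacts [hf0 _, le_rfl]
    refine le_trans (le_of_eq ?_) (mul_le_mul_of_nonneg_left
      (InstState.average_lyapunov_next_le hτ (hs.valid ω) heq) h1)
    simp_rw [Finset.mul_sum]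
    refine Finset.sum_congr rfl fun a₀ _ => Finset.sum_congr rfl fun b₀ _ => ?_
    simp only [hG, hH]
    ring
  calc ∫ ω, f (U ω) * (runState par T S U a b x (t + 1) i ω).lyapunov m n τ ∂P
      ≤ ∫ ω, ((G (a (t + 1) ω) (b (t + 1) ω) ω +
          x (t + 1) ω * H (a (t + 1) ω) (b (t + 1) ω) ω) +
          e' (U ω) * (s ω).lyapunov m n τ) ∂P :=
        integral_mono_ae hint_succ (hint.add hint_e') hstep
    _ = ∫ ω, (G (a (t + 1) ω) (b (t + 1) ω) ω +
          x (t + 1) ω * H (a (t + 1) ω) (b (t + 1) ω) ω) ∂P +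
          ∫ ω, e' (U ω) * (s ω).lyapunov m n τ ∂P := integral_add hint hint_e'
    _ ≤ ∫ ω, e (U ω) * (s ω).lyapunov m n τ ∂P + ∫ ω, e' (U ω) * (s ω).lyapunov m n τ ∂P := by
        rw [hval']
        linarith
    _ = ∫ ω, f (U ω) * (s ω).lyapunov m n τ ∂P := by
        rw [← integral_add hint_e hint_e']
        refine integral_congr_ae (Filter.Eventually.of_forall fun ω => ?_)
        by_cases h : activeInst T S (U ω) (t + 1) = i <;> simp [he, he', h]

/-- At time 0 the factor N (N + 1) vanishes, so the initial divergence plays no role. The weight `f`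
stays the same along the induction and may thus encode the schedule up to any later round. -/
theorem integral_lyapunov_nonpos (t : ℕ) {f : ℝ → ℝ} (hf : Measurable f) (hf0 : ∀ u, 0 ≤ f u)
    {C : ℝ} (hfC : ∀ u, f u ≤ C) :
    ∫ ω, f (U ω) * (runState par T S U a b x t i ω).lyapunov m n τ ∂P ≤ 0 := by
  induction t with
  | zero =>
    refine le_of_eq (integral_eq_zero_of_ae (Filter.Eventually.of_forall fun ω => ?_))
    simp [runState, statesAfter, InstState.lyapunov, InstState.init]
  | succ t ih => exact (hrun.integral_lyapunov_succ_le hp hτ hpar heq t hf hf0 hfC).trans ih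

omit heq

/-- Second moment of the exploitability gap in round `t + 1`, on the event that instance `i` is
played. -/
theorem integral_indicator_sq_gap_le (hA : ∀ a b, meanLoss p a b ∈ Set.Icc (0 : ℝ) 1) (t : ℕ) :
    Integrable (fun ω => if activeInst T S (U ω) (t + 1) = i then
      exploitabilityGap (meanLoss p) ((runState par T S U a b x t i ω).mu (paramsOf τ))
        ((runState par T S U a b x t i ω).nu (paramsOf τ)) ^ 2 else 0) P ∧
    ∫ ω, (if activeInst T S (U ω) (t + 1) = i then
      exploitabilityGap (meanLoss p) ((runState par T S U a b x t i ω).mu (paramsOf τ))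
        ((runState par T S U a b x t i ω).nu (paramsOf τ)) ^ 2 else 0) ∂P ≤
    ∫ ω, (if activeInst T S (U ω) (t + 1) = i then
      2 * (τ * (Real.log (Fintype.card A) + Real.log (Fintype.card B))) ^ 2 +
        4 * ((InstState.driftConst A B τ +
          2 * (Real.log (Fintype.card A) + Real.log (Fintype.card B))) /
            (playCount T S (U ω) t i + 2)) else 0) ∂P := by
  obtain ⟨m, n, heq⟩ := exists_isRegularizedEquilibrium (meanLoss p) hτ.le
  obtain ⟨δ, hs⟩ := hrun.exists_regularState hp hτ hpar t
  set s := runState par T S U a b x t i with hsdef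
  set l := Real.log (Fintype.card A) + Real.log (Fintype.card B) with hl
  have hl0 : 0 ≤ l := add_nonneg (Real.log_natCast_nonneg _) (Real.log_natCast_nonneg _)
  have hd0 : 0 ≤ InstState.driftConst A B τ := by unfold InstState.driftConst; positivity
  have hUm := hrun.measurable_seed
  have hF := hrun.history_le t
  have hact : MeasurableSet {u | activeInst T S u (t + 1) = i} :=
    (measurable_activeInst T S (t + 1)) (MeasurableSet.of_discrete (s := {i}))
  have hactU : MeasurableSet {ω | activeInst T S (U ω) (t + 1) = i} := hUm hact
  have hN : ∀ ω, (s ω).iter = playCount T S (U ω) t i := fun ω =>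
    statesAfter_iter _ _ _ _ _ _ _ _ _
  have hgapm : Measurable fun ω => exploitabilityGap (meanLoss p) ((s ω).mu (paramsOf τ))
      ((s ω).nu (paramsOf τ)) :=
    (measurable_exploitabilityGap _ (hs.measurable.mu hs.valid _)
      (hs.measurable.nu hs.valid _)).mono hF le_rfl
  have hgap01 : ∀ ω, exploitabilityGap (meanLoss p) ((s ω).mu (paramsOf τ))
      ((s ω).nu (paramsOf τ)) ∈ Set.Icc (0 : ℝ) 1 := fun ω =>
    ⟨exploitabilityGap_nonneg hA (openSimplex_subset (InstState.mu_mem (hs.valid ω) _))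
      (openSimplex_subset (InstState.nu_mem (hs.valid ω) _)),
    exploitabilityGap_le_one hA (openSimplex_subset (InstState.mu_mem (hs.valid ω) _))
      (openSimplex_subset (InstState.nu_mem (hs.valid ω) _))⟩
  have hint : Integrable (fun ω => if activeInst T S (U ω) (t + 1) = i then
      exploitabilityGap (meanLoss p) ((s ω).mu (paramsOf τ)) ((s ω).nu (paramsOf τ)) ^ 2
        else 0) P := by
    refine (AEBounded.of_mem_Icc (c := 0) (d := 1) (Filter.Eventually.of_forall
      fun ω => ?_)).integrable (Measurable.ite hactU (hgapm.pow_const 2) measurable_const)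
    have := hgap01 ω
    split_ifs
    · exact ⟨sq_nonneg _, pow_le_one₀ this.1 this.2⟩
    · simp
  refine ⟨hint, ?_⟩
  -- This weight undoes the factor (N + 1)(N + 2) of `playedPotential_le_lyapunov` and restricts to
  -- the event that instance i plays; it depends on the seed only.
  set f : ℝ → ℝ := fun u => if activeInst T S u (t + 1) = i then
    1 / (((playCount T S u t i : ℝ) + 1) * (playCount T S u t i + 2)) else 0 with hf
  have hcm : Measurable fun u => (playCount T S u t i : ℝ) :=
    (measurable_from_nat (f := fun k : ℕ => (k : ℝ))).comp (measurable_playCount T S t i)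
  have hfm : Measurable f := Measurable.ite hact
    (((hcm.add_const 1).mul (hcm.add_const 2)).const_div 1) measurable_const
  have hf0 : ∀ u, 0 ≤ f u := fun u => by
    simp only [hf]
    split_ifs
    · positivity
    · exact le_rfl
  have hf1 : ∀ u, f u ≤ 1 := fun u => by
    simp only [hf]
    split_ifs
    · rw [div_le_one (by positivity)]
      nlinarith [Nat.cast_nonneg (α := ℝ) (playCount T S u t i)]
    · exact zero_le_one
  have hmain := hrun.integral_lyapunov_nonpos hp hτ hpar heq t hfm hf0 hf1
  set R : ℝ → ℝ := fun u => if activeInst T S u (t + 1) = i then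
      2 * (τ * l) ^ 2 + 4 * ((InstState.driftConst A B τ + 2 * l) / (playCount T S u t i + 2))
      else 0 with hR
  have hRm : Measurable R := Measurable.ite hact
    ((((hcm.add_const 2).const_div _).const_mul _).const_add _) measurable_const
  have hRi : Integrable (fun ω => R (U ω)) P := by
    refine (AEBounded.of_mem_Icc (c := 0) (d := 2 * (τ * l) ^ 2 +
      4 * (InstState.driftConst A B τ + 2 * l)) (Filter.Eventually.of_forall
      fun ω => ?_)).integrable (hRm.comp hUm)
    simp only [hR]
    split_ifs
    · refine ⟨by positivity, ?_⟩
      gcongr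
      exact div_le_self (by positivity)
        (by linarith [Nat.cast_nonneg (α := ℝ) (playCount T S (U ω) t i)])
    · exact ⟨le_rfl, by positivity⟩
  have hLi : Integrable (fun ω => f (U ω) * (s ω).lyapunov m n τ) P :=
    ((AEBounded.of_mem_Icc (c := 0) (d := 1) (Filter.Eventually.of_forall
      fun ω => ⟨hf0 _, hf1 _⟩)).mul (hs.bounded_lyapunov heq.1 heq.2.1)).integrable
      ((hfm.comp hUm).mul (hs.measurable_lyapunov.mono hF le_rfl))
  have hle : ∀ ω, (if activeInst T S (U ω) (t + 1) = i then
      exploitabilityGap (meanLoss p) ((s ω).mu (paramsOf τ)) ((s ω).nu (paramsOf τ)) ^ 2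
        else 0) ≤ R (U ω) + 4 * (f (U ω) * (s ω).lyapunov m n τ) := by
    intro ω
    simp only [hR, hf]
    split_ifs with h
    · have h1 := sq_exploitabilityGap_le hA hτ.le heq (InstState.mu_mem (hs.valid ω) (paramsOf τ))
        (InstState.nu_mem (hs.valid ω) (paramsOf τ))
      have h2 := InstState.playedPotential_le_lyapunov hτ (hs.valid ω) heq.1 heq.2.1
      rw [hN ω, ← hl] at h2
      rw [← hl] at h1
      unfold InstState.playedPotential at h2
      set N : ℝ := (playCount T S (U ω) t i : ℝ) with hNdef
      have hN0 : 0 ≤ N := Nat.cast_nonneg _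
      have h3 : klReal m ((s ω).mu (paramsOf τ)) + klReal n ((s ω).nu (paramsOf τ)) ≤
          (InstState.driftConst A B τ + 2 * l) / (N + 2) +
            1 / ((N + 1) * (N + 2)) * (s ω).lyapunov m n τ := by
        have hpos : 0 < (N + 1) * (N + 2) := by positivity
        refine le_of_mul_le_mul_left (h2.trans (le_of_eq ?_)) hpos
        field_simp
        ring
      linarith
    · simp
  calc _ ≤ ∫ ω, (R (U ω) + 4 * (f (U ω) * (s ω).lyapunov m n τ)) ∂P :=
        integral_mono hint (hRi.add (hLi.const_mul 4)) hle
    _ = ∫ ω, R (U ω) ∂P + 4 * ∫ ω, f (U ω) * (s ω).lyapunov m n τ ∂P := by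
        rw [integral_add hRi (hLi.const_mul 4), integral_const_mul]
    _ ≤ _ := by linarith

end IsDoublingRun

end Supermartingale

/-! ### The randomized schedule: play counts and probability of a call -/

section Schedule

theorem newProb_nonneg (T : ℕ → ℕ) (S : ℕ → ℝ) (i j : ℕ) : 0 ≤ newProb T S i j :=
  le_min zero_le_one (by positivity)

theorem newProb_le_one (T : ℕ → ℕ) (S : ℕ → ℝ) (i j : ℕ) : newProb T S i j ≤ 1 := min_le_left _ _

/-- Cumulated probability `p_i^1 + ... + p_i^j`. -/
noncomputable def cumProb (T : ℕ → ℕ) (S : ℕ → ℝ) (i j : ℕ) : ℝ :=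
  ∑ l ∈ Finset.Icc 1 j, newProb T S i l

theorem cumProb_nonneg (T : ℕ → ℕ) (S : ℕ → ℝ) (i j : ℕ) : 0 ≤ cumProb T S i j :=
  Finset.sum_nonneg fun _ _ => newProb_nonneg T S i _

theorem cumProb_succ (T : ℕ → ℕ) (S : ℕ → ℝ) (i j : ℕ) :
    cumProb T S i (j + 1) = cumProb T S i j + newProb T S i (j + 1) :=
  Finset.sum_Icc_succ_top (by omega) _

theorem callCount_eq (T : ℕ → ℕ) (S : ℕ → ℝ) (u : ℝ) (i j : ℕ) :
    callCount T S u i j = ⌊cumProb T S i j + u⌋₊ := rfl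

/-- Each p is at most 1, so the floor rises by at most one, and one call per round keeps up with it.
-/
theorem callCount_succ_le {T : ℕ → ℕ} {S : ℕ → ℝ} {u : ℝ} (hu : 0 ≤ u) (i j : ℕ) :
    callCount T S u i (j + 1) ≤ callCount T S u i j + 1 := by
  have h0 := cumProb_nonneg T S i j
  rw [callCount_eq, callCount_eq, ← Nat.floor_add_one (by positivity), cumProb_succ]
  exact Nat.floor_le_floor (by linarith [newProb_le_one T S i (j + 1)])

theorem roundPos_succ (T : ℕ → ℕ) (t : ℕ) : roundPos T (t + 1) =
    if (roundPos T t).2 < T (roundPos T t).1 then ((roundPos T t).1, (roundPos T t).2 + 1)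
    else ((roundPos T t).1 + 1, 1) := rfl

/-- Position of a round in the loops. -/
theorem roundPos_spec {T : ℕ → ℕ} (hT0 : T 0 = 0) (hT : ∀ i, 1 ≤ i → 1 ≤ T i) (t : ℕ) :
    1 ≤ (roundPos T t).1 ∧ (roundPos T t).2 ≤ T (roundPos T t).1 ∧
      t = ∑ l ∈ Finset.range (roundPos T t).1, T l + (roundPos T t).2 ∧
      (1 ≤ t → 1 ≤ (roundPos T t).2) := by
  induction t with
  | zero => simp [roundPos, hT0]
  | succ t ih =>
    obtain ⟨h1, h2, h3, -⟩ := ih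
    rw [roundPos_succ]
    split_ifs with h
    · exact ⟨h1, h, by simp only; omega, fun _ => by simp⟩
    · refine ⟨by simp, hT _ (by simp), ?_, fun _ => le_rfl⟩
      simp only [Finset.sum_range_succ]
      omega

theorem playCount_mono (T : ℕ → ℕ) (S : ℕ → ℝ) (u : ℝ) (t i : ℕ) :
    playCount T S u t i ≤ playCount T S u (t + 1) i := by
  unfold playCount
  rw [Finset.sum_range_succ]
  exact Nat.le_add_right _ _

theorem playCount_succ_of_eq {T : ℕ → ℕ} {S : ℕ → ℝ} {u : ℝ} {t i : ℕ}
    (h : activeInst T S u (t + 1) = i) : playCount T S u (t + 1) i = playCount T S u t i + 1 := by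
  unfold playCount
  rw [Finset.sum_range_succ, if_pos h]

/-- The offset `callCount T S u i 0` is ⌊u⌋, zero for u < 1; keeping it makes the bound valid for
every u ≥ 0. -/
theorem callCount_le_playCount_step {T : ℕ → ℕ} {S : ℕ → ℝ} {u : ℝ} (hu : 0 ≤ u) {t i j : ℕ}
    (hpos : roundPos T (t + 1) = (i, j + 1))
    (h : callCount T S u i j ≤ playCount T S u t i + callCount T S u i 0) :
    callCount T S u i (j + 1) ≤ playCount T S u (t + 1) i + callCount T S u i 0 := by
  by_cases hlt : callCount T S u i j < callCount T S u i (j + 1)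
  · have hact : activeInst T S u (t + 1) = i := by
      unfold activeInst
      rw [hpos]
      exact if_pos hlt
    have := callCount_succ_le (T := T) (S := S) hu i j
    rw [playCount_succ_of_eq hact]
    omega
  · have := playCount_mono T S u t i
    omega

/-- Lower bounds on the numbers of iterations of the new and of the old instance. -/
theorem callCount_le_playCount {T : ℕ → ℕ} (hT0 : T 0 = 0) (hT : ∀ i, 1 ≤ i → 1 ≤ T i)
    {S : ℕ → ℝ} {u : ℝ} (hu : 0 ≤ u) (t : ℕ) :
    callCount T S u (roundPos T t).1 (roundPos T t).2 ≤
        playCount T S u t (roundPos T t).1 + callCount T S u (roundPos T t).1 0 ∧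
      ∀ k, 1 ≤ k → (roundPos T t).1 = k + 1 →
        callCount T S u k (T k) ≤ playCount T S u t k + callCount T S u k 0 := by
  induction t with
  | zero =>
    refine ⟨by simp [roundPos], fun k hk h => ?_⟩
    simp only [roundPos] at h
    omega
  | succ t ih =>
    obtain ⟨h1, h2⟩ := ih
    have hle := (roundPos_spec hT0 hT t).2.1
    by_cases h : (roundPos T t).2 < T (roundPos T t).1
    · have hpos : roundPos T (t + 1) = ((roundPos T t).1, (roundPos T t).2 + 1) := by
        rw [roundPos_succ, if_pos h]
      have h3 := callCount_le_playCount_step hu hpos h1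
      rw [hpos]
      exact ⟨h3, fun k hk e => (h2 k hk e).trans
        (Nat.add_le_add_right (playCount_mono T S u t k) _)⟩
    · have hpos : roundPos T (t + 1) = ((roundPos T t).1 + 1, 0 + 1) := by
        rw [roundPos_succ, if_neg h]
      -- Entering a new loop, the bound is trivial at j = 0. The final bound of the loop just left
      -- becomes the statement on the old instance, and it persists because play counts only grow.
      have h3 := callCount_le_playCount_step (S := S) hu hpos (Nat.le_add_left _ _)
      rw [hpos]
      refine ⟨h3, fun k hk e => ?_⟩
      have e' : (roundPos T t).1 = k := by simpa using e
      rw [e'] at h1 h hle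
      rw [show (roundPos T t).2 = T k by omega] at h1
      exact h1.trans (Nat.add_le_add_right (playCount_mono T S u t k) _)

/-- ⌊c + u⌋ exceeds c + u - 1, while the offset ⌊u⌋ is at most u, so the seed cancels and less than
one unit is lost. -/
theorem cumProb_lt_of_callCount_le {T : ℕ → ℕ} {S : ℕ → ℝ} {u : ℝ} (hu : 0 ≤ u) {i j N : ℕ}
    (h : callCount T S u i j ≤ N + callCount T S u i 0) : cumProb T S i j < (N : ℝ) + 1 := by
  have h1 := Nat.lt_floor_add_one (cumProb T S i j + u)
  have h2 : ((callCount T S u i 0 : ℕ) : ℝ) ≤ u := by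
    rw [callCount_eq]
    simpa [cumProb] using Nat.floor_le hu
  have h3 : ((callCount T S u i j : ℕ) : ℝ) ≤ N + (callCount T S u i 0 : ℕ) := by
    exact_mod_cast h
  rw [callCount_eq T S u i j] at h3
  linarith

/-- The new instance has been played about as often as planned. -/
theorem cumProb_lt_playCount_new {T : ℕ → ℕ} (hT0 : T 0 = 0) (hT : ∀ i, 1 ≤ i → 1 ≤ T i)
    {S : ℕ → ℝ} {u : ℝ} (hu : 0 ≤ u) {t i j : ℕ} (hpos : roundPos T (t + 1) = (i, j))
    (hact : activeInst T S u (t + 1) = i) : cumProb T S i j < (playCount T S u t i : ℝ) + 2 := by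
  have h := (callCount_le_playCount hT0 hT (S := S) hu (t + 1)).1
  rw [hpos] at h
  have := cumProb_lt_of_callCount_le hu h
  -- The current round is itself a call of the instance: one unit for it and one for the floor give
  -- N + 2, the denominator of the gap bound.
  rw [playCount_succ_of_eq hact] at this
  push_cast at this
  linarith

theorem cumProb_lt_playCount_old {T : ℕ → ℕ} (hT0 : T 0 = 0) (hT : ∀ i, 1 ≤ i → 1 ≤ T i)
    {S : ℕ → ℝ} {u : ℝ} (hu : 0 ≤ u) {t k j : ℕ} (hk : 1 ≤ k)
    (hpos : roundPos T (t + 1) = (k + 1, j)) (hact : activeInst T S u (t + 1) = k) :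
    cumProb T S k (T k) < (playCount T S u t k : ℝ) + 2 := by
  have h := (callCount_le_playCount hT0 hT (S := S) hu (t + 1)).2 k hk (by rw [hpos])
  have := cumProb_lt_of_callCount_le hu h
  rw [playCount_succ_of_eq hact] at this
  push_cast at this
  linarith

theorem activeInst_eq_or {T : ℕ → ℕ} {S : ℕ → ℝ} {u : ℝ} {t i j : ℕ}
    (hpos : roundPos T t = (i, j)) : activeInst T S u t = i ∨ activeInst T S u t = i - 1 := by
  unfold activeInst
  rw [hpos]
  split_ifs
  exacts [Or.inl rfl, Or.inr rfl]

/-- The floor of `y + u` jumps, when `y` is increased by `q`, with probability of order `q`. -/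
theorem volume_floor_jump_le {y q : ℝ} (hy : 0 ≤ y) (hq0 : 0 ≤ q) (hq1 : q ≤ 1) :
    volume ({u : ℝ | ⌊y + u⌋₊ < ⌊y + q + u⌋₊} ∩ Set.Icc 0 1) ≤ ENNReal.ofReal (2 * q) := by
  -- A jump means that some integer k satisfies y + u < k ≤ y + q + u. As u lies in [0, 1], only two
  -- values of k are possible, each confining u to an interval of length q.
  have hsub : {u : ℝ | ⌊y + u⌋₊ < ⌊y + q + u⌋₊} ∩ Set.Icc 0 1 ⊆
      Set.Icc (((⌊y⌋₊ + 1 : ℕ) : ℝ) - y - q) (((⌊y⌋₊ + 1 : ℕ) : ℝ) - y) ∪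
        Set.Icc (((⌊y⌋₊ + 2 : ℕ) : ℝ) - y - q) (((⌊y⌋₊ + 2 : ℕ) : ℝ) - y) := by
    rintro u ⟨hu, hu0, hu1⟩
    simp only [Set.mem_ofPred_eq] at hu
    set k := ⌊y + q + u⌋₊ with hk
    have h1 : y + u < k := (Nat.floor_lt (by positivity)).1 hu
    have h2 : (k : ℝ) ≤ y + q + u := Nat.floor_le (by positivity)
    have h3 : ⌊y⌋₊ < k := (Nat.floor_lt hy).2 (by linarith)
    have h4 : k ≤ ⌊y⌋₊ + 2 := by
      have h5 := Nat.lt_floor_add_one y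
      have h6 : (k : ℝ) < ((⌊y⌋₊ + 3 : ℕ) : ℝ) := by
        push_cast
        linarith
      have : k < ⌊y⌋₊ + 3 := by exact_mod_cast h6
      omega
    rcases (show k = ⌊y⌋₊ + 1 ∨ k = ⌊y⌋₊ + 2 by omega) with h | h
    · left
      rw [← h]
      constructor <;> linarith
    · right
      rw [← h]
      constructor <;> linarith
  refine (measure_mono hsub).trans ((measure_union_le _ _).trans ?_)
  rw [Real.volume_Icc, Real.volume_Icc, ← ENNReal.ofReal_add (by linarith) (by linarith)]
  exact ENNReal.ofReal_le_ofReal (by linarith)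

end Schedule

/-! ### Estimates for the horizons, the probabilities and the tuning -/

section Parameters

theorem horizon_zero : horizon 0 = 0 := by simp [horizon]

theorem one_le_horizon {i : ℕ} (hi : 1 ≤ i) : 1 ≤ horizon i := by
  unfold horizon
  have := Nat.mul_pos hi (Nat.two_pow_pos i)
  omega

theorem two_mul_horizon_le (i : ℕ) : 2 * horizon i ≤ horizon (i + 1) := by
  unfold horizon
  rw [pow_succ]
  nlinarith [Nat.two_pow_pos i]

theorem horizon_succ_le {i : ℕ} (hi : 1 ≤ i) : horizon (i + 1) ≤ 4 * horizon i := by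
  unfold horizon
  rw [pow_succ]
  nlinarith [Nat.two_pow_pos i]

/-- Horizons at least double from one loop to the next, so all earlier loops together last no longer
than the current one. -/
theorem sum_horizon_le (i : ℕ) : ∑ l ∈ Finset.range i, horizon l ≤ horizon i := by
  induction i with
  | zero => simp
  | succ i ih =>
    rw [Finset.sum_range_succ]
    have := two_mul_horizon_le i
    omega

theorem horizon_mono : Monotone horizon :=
  monotone_nat_of_le_succ fun i => by
    have := two_mul_horizon_le i
    omega

theorem scale_eq (i : ℕ) : scale i = ((8 * 2 ^ i : ℕ) : ℝ) := by simp [scale]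

theorem scale_pos (i : ℕ) : 0 < scale i := by unfold scale; positivity

theorem horizon_eq (i : ℕ) : (horizon i : ℝ) = 4 * i * scale i := by
  unfold horizon scale
  push_cast
  ring

/-- Over at most S_i rounds the exponential grows by a factor of at most e; truncation at 1 is
harmless since e ≥ 1. -/
theorem newProb_shift {i j l : ℕ} (h : (j : ℝ) ≤ l + scale i) :
    newProb horizon scale i j ≤ Real.exp 1 * newProb horizon scale i l := by
  unfold newProb
  rw [mul_min_of_nonneg _ _ (Real.exp_pos 1).le]
  refine min_le_min ?_ ?_
  · rw [mul_one]
    exact Real.one_le_exp zero_le_one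
  · rw [← mul_div_assoc, ← Real.exp_add]
    refine div_le_div_of_nonneg_right (Real.exp_le_exp.2 ?_) (Nat.cast_nonneg _)
    rw [div_le_iff₀ (scale_pos i), add_mul, div_mul_cancel₀ _ (scale_pos i).ne']
    linarith

/-- Late in the loop, the probability is small compared to its sum. -/
theorem scale_mul_newProb_le {i j : ℕ} (h : 8 * 2 ^ i ≤ j) :
    scale i * newProb horizon scale i j ≤ Real.exp 1 * cumProb horizon scale i j := by
  -- The window of the last S_i rounds: each has a probability of at least 1/e times the current
  -- one.
  have hsub : Finset.Ioc (j - 8 * 2 ^ i) j ⊆ Finset.Icc 1 j := fun l hl => by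
    rw [Finset.mem_Ioc] at hl
    rw [Finset.mem_Icc]
    omega
  calc scale i * newProb horizon scale i j
      = ∑ _l ∈ Finset.Ioc (j - 8 * 2 ^ i) j, newProb horizon scale i j := by
        rw [Finset.sum_const, Nat.card_Ioc, nsmul_eq_mul, Nat.sub_sub_self h, scale_eq]
    _ ≤ ∑ l ∈ Finset.Ioc (j - 8 * 2 ^ i) j, Real.exp 1 * newProb horizon scale i l := by
        refine Finset.sum_le_sum fun l hl => newProb_shift ?_
        rw [scale_eq]
        rw [Finset.mem_Ioc] at hl
        have : j ≤ l + 8 * 2 ^ i := by omega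
        exact_mod_cast this
    _ = Real.exp 1 * ∑ l ∈ Finset.Ioc (j - 8 * 2 ^ i) j, newProb horizon scale i l := by
        rw [Finset.mul_sum]
    _ ≤ _ := mul_le_mul_of_nonneg_left
        (Finset.sum_le_sum_of_subset_of_nonneg hsub fun l _ _ => newProb_nonneg _ _ _ _)
        (Real.exp_pos 1).le

theorem newProb_le_of_le_scale {i j : ℕ} (h : j ≤ 8 * 2 ^ i) :
    newProb horizon scale i j ≤ Real.exp 1 / horizon i := by
  refine (min_le_right _ _).trans
    (div_le_div_of_nonneg_right (Real.exp_le_exp.2 ?_) (Nat.cast_nonneg _))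
  rw [div_le_one (scale_pos i), scale_eq]
  exact_mod_cast h

/-- The horizon grows by a factor of at most 4 per loop. The base case 2048 ≤ 2401 holds at k = 4,
whereas 768 > 343 at k = 3; hence the condition 4 ≤ k used below. The base 7 is chosen just below
e². -/
theorem seven_pow_ge {k : ℕ} (hk : 4 ≤ k) : horizon k ≤ 7 ^ k := by
  induction k, hk using Nat.le_induction with
  | base => norm_num [horizon]
  | succ k hk ih =>
    have := horizon_succ_le (i := k) (by omega)
    rw [pow_succ]
    omega

theorem seven_le_exp_two : (7 : ℝ) ≤ Real.exp 2 := by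
  have h := Real.exp_one_gt_d9
  rw [show (2 : ℝ) = 1 + 1 by norm_num, Real.exp_add]
  nlinarith

theorem newProb_eq_one {k l : ℕ} (hk : 4 ≤ k) (hl : horizon k ≤ 2 * l) :
    newProb horizon scale k l = 1 := by
  have hT : (0 : ℝ) < horizon k := by exact_mod_cast one_le_horizon (i := k) (by omega)
  refine min_eq_left ?_
  rw [le_div_iff₀ hT, one_mul]
  -- Since T_k = 4 k S_k, half of the loop is 2 k S_k rounds.
  have h1 : ((k : ℕ) : ℝ) * 2 ≤ l / scale k := by
    rw [le_div_iff₀ (scale_pos k)]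
    have h2 : ((horizon k : ℕ) : ℝ) ≤ 2 * l := by exact_mod_cast hl
    rw [horizon_eq] at h2
    linarith
  calc (horizon k : ℝ) ≤ 7 ^ k := by exact_mod_cast seven_pow_ge hk
    _ ≤ Real.exp 2 ^ k := pow_le_pow_left₀ (by norm_num) seven_le_exp_two k
    _ = Real.exp (k * 2) := (Real.exp_nat_mul 2 k).symm
    _ ≤ _ := Real.exp_le_exp.2 h1

/-- An instance is played in at least half of the rounds of its own loop. -/
theorem half_horizon_le_cumProb {k : ℕ} (hk : 4 ≤ k) :
    (horizon k : ℝ) / 2 ≤ cumProb horizon scale k (horizon k) := by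
  obtain ⟨h, hh⟩ : ∃ h, horizon k = 2 * h := ⟨16 * (k * 2 ^ k), by unfold horizon; ring⟩
  have hsub : Finset.Ioc h (horizon k) ⊆ Finset.Icc 1 (horizon k) := fun l hl => by
    rw [Finset.mem_Ioc] at hl
    rw [Finset.mem_Icc]
    omega
  calc (horizon k : ℝ) / 2 = ∑ _l ∈ Finset.Ioc h (horizon k), (1 : ℝ) := by
        rw [Finset.sum_const, Nat.card_Ioc, hh, show 2 * h - h = h by omega]
        push_cast
        simp
    _ = ∑ l ∈ Finset.Ioc h (horizon k), newProb horizon scale k l :=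
        Finset.sum_congr rfl fun l hl => by
          rw [Finset.mem_Ioc] at hl
          rw [newProb_eq_one hk (by omega)]
    _ ≤ _ := Finset.sum_le_sum_of_subset_of_nonneg hsub fun l _ _ => newProb_nonneg _ _ _ _

variable {nA nB T : ℕ}

theorem tuning_pos (hA : 1 ≤ nA) (hB : 1 ≤ nB) (hT : 1 ≤ T)
    (hl : 0 < Real.log nA + Real.log nB) : 0 < tuning nA nB T := by
  have h1 : (0 : ℝ) < nA := by exact_mod_cast hA
  have h2 : (0 : ℝ) < nB := by exact_mod_cast hB
  have h3 : (0 : ℝ) < T := by exact_mod_cast hT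
  unfold tuning
  positivity

theorem sq_rpow_quarter {y : ℝ} (hy : 0 ≤ y) : (y ^ (1 / 4 : ℝ)) ^ 2 = √y := by
  rw [← Real.rpow_natCast, ← Real.rpow_mul hy, Real.sqrt_eq_rpow]
  norm_num

theorem sq_tuning (hl : 0 < Real.log nA + Real.log nB) :
    tuning nA nB T ^ 2 = √(((nA : ℝ) + nB) / T) * (2 / (Real.log nA + Real.log nB)) := by
  unfold tuning
  rw [mul_pow, sq_rpow_quarter (by positivity), Real.sq_sqrt (by positivity)]

/-- The squared bias of the regularization. Together with `driftConst_tuning` it shows that the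
tuning gives bias and variance after T iterations the same order log(AB) √((A + B) / T). -/
theorem sq_tuning_mul (hl : 0 < Real.log nA + Real.log nB) :
    (tuning nA nB T * (Real.log nA + Real.log nB)) ^ 2 =
      2 * ((Real.log nA + Real.log nB) * √(((nA : ℝ) + nB) / T)) := by
  rw [mul_pow, sq_tuning hl]
  field_simp

theorem driftConst_tuning {A B : Type*} [Fintype A] [Fintype B] (hA : 1 ≤ Fintype.card A)
    (hT : 1 ≤ T)
    (hl : 0 < Real.log (Fintype.card A) + Real.log (Fintype.card B)) :
    InstState.driftConst A B (tuning (Fintype.card A) (Fintype.card B) T) =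
      (Real.log (Fintype.card A) + Real.log (Fintype.card B)) *
        (T * √(((Fintype.card A : ℝ) + Fintype.card B) / T)) := by
  have h1 : (0 : ℝ) < Fintype.card A := by exact_mod_cast hA
  have h3 : (0 : ℝ) < T := by exact_mod_cast hT
  have hn : (0 : ℝ) < ((Fintype.card A : ℝ) + Fintype.card B) / T := by positivity
  unfold InstState.driftConst
  rw [sq_tuning hl]
  have hr := Real.sqrt_pos.2 hn
  have hr2 : √(((Fintype.card A : ℝ) + Fintype.card B) / T) ^ 2 * T =
      (Fintype.card A : ℝ) + Fintype.card B := by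
    rw [Real.sq_sqrt hn.le]
    field_simp
  set r := √(((Fintype.card A : ℝ) + Fintype.card B) / T)
  rw [← hr2]
  field_simp

end Parameters

theorem meanLoss_mem_Icc {A B : Type*} {p : A → B → Measure ℝ}
    [∀ a b, IsProbabilityMeasure (p a b)] (hp : ∀ a b, ∀ᵐ y ∂(p a b), y ∈ Set.Icc (0 : ℝ) 1)
    (a : A) (b : B) : meanLoss p a b ∈ Set.Icc (0 : ℝ) 1 := by
  refine ⟨integral_nonneg_of_ae ((hp a b).mono fun y hy => hy.1), ?_⟩
  calc meanLoss p a b ≤ ∫ _y, (1 : ℝ) ∂(p a b) :=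
        integral_mono_of_nonneg ((hp a b).mono fun y hy => hy.1) (integrable_const _)
          ((hp a b).mono fun y hy => hy.2)
    _ = 1 := by simp

/-! ### Averaging over the seed: the old and the new instance -/

section SeedBounds

variable {Ω : Type*} [MeasurableSpace Ω] {P : Measure Ω} [IsProbabilityMeasure P] {U : Ω → ℝ}

omit [IsProbabilityMeasure P] in
theorem seed_mem_Icc (hU : Measurable U)
    (hlaw : P.map U = volume.restrict (Set.Icc (0 : ℝ) 1)) :
    ∀ᵐ ω ∂P, U ω ∈ Set.Icc (0 : ℝ) 1 := by
  refine ae_of_ae_map hU.aemeasurable (p := fun u => u ∈ Set.Icc (0 : ℝ) 1) ?_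
  rw [hlaw]
  exact ae_restrict_mem measurableSet_Icc

omit [IsProbabilityMeasure P] in
/-- The new instance is played with a probability of order `p_i^j`. -/
theorem prob_activeInst_le (hU : Measurable U)
    (hlaw : P.map U = volume.restrict (Set.Icc (0 : ℝ) 1)) {T : ℕ → ℕ} {S : ℕ → ℝ}
    {t i j : ℕ} (hi : 1 ≤ i) (hpos : roundPos T t = (i, j + 1)) :
    P.real {ω | activeInst T S (U ω) t = i} ≤ 2 * newProb T S i (j + 1) := by
  have hset : {u | activeInst T S u t = i} =
      {u : ℝ | ⌊cumProb T S i j + u⌋₊ < ⌊cumProb T S i j + newProb T S i (j + 1) + u⌋₊} := by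
    ext u
    simp only [Set.mem_ofPred_eq]
    unfold activeInst
    rw [hpos]
    simp only [Nat.add_sub_cancel]
    rw [callCount_eq, callCount_eq, cumProb_succ]
    split_ifs with h
    · simp [h]
    · simp only [h, iff_false]
      omega
  have hm : MeasurableSet {u | activeInst T S u t = i} :=
    (measurable_activeInst T S t) (MeasurableSet.of_discrete (s := {i}))
  have h1 : P {ω | activeInst T S (U ω) t = i} ≤
      ENNReal.ofReal (2 * newProb T S i (j + 1)) := by
    calc P {ω | activeInst T S (U ω) t = i} = P.map U {u | activeInst T S u t = i} :=
          (Measure.map_apply hU hm).symm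
      _ = volume ({u | activeInst T S u t = i} ∩ Set.Icc 0 1) := by
          rw [hlaw, Measure.restrict_apply hm]
      _ ≤ _ := by
          rw [hset]
          exact volume_floor_jump_le (cumProb_nonneg T S i j) (newProb_nonneg T S i (j + 1))
            (newProb_le_one T S i (j + 1))
  exact ENNReal.toReal_le_of_le_ofReal (mul_nonneg zero_le_two (newProb_nonneg _ _ _ _)) h1

/-- Bound on the contribution of the old instance. -/
theorem integral_old_le (hU : Measurable U)
    (hlaw : P.map U = volume.restrict (Set.Icc (0 : ℝ) 1)) {t k j : ℕ} (hk : 4 ≤ k)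
    (hpos : roundPos horizon (t + 1) = (k + 1, j)) {α β : ℝ} (hα : 0 ≤ α) (hβ : 0 ≤ β) :
    ∫ ω, (if activeInst horizon scale (U ω) (t + 1) = k then
      α + β / (playCount horizon scale (U ω) t k + 2) else 0) ∂P ≤ α + 2 * β / horizon k := by
  have hT : (0 : ℝ) < horizon k := by exact_mod_cast one_le_horizon (i := k) (by omega)
  calc _ ≤ ∫ _ω, (α + 2 * β / horizon k) ∂P := by
        refine integral_mono_of_nonneg (Filter.Eventually.of_forall fun ω => ?_)
          (integrable_const _) ?_
        · simp only [Pi.zero_apply]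
          split_ifs
          · positivity
          · exact le_rfl
        · filter_upwards [seed_mem_Icc hU hlaw] with ω hω
          split_ifs with h
          · have h1 := cumProb_lt_playCount_old horizon_zero (fun i => one_le_horizon) hω.1
              (show 1 ≤ k by omega) hpos h
            have h2 := half_horizon_le_cumProb hk
            -- N + 2 exceeds the cumulated probability of the whole loop of instance k, which is at
            -- least half of its horizon.
            have h3 : β / (playCount horizon scale (U ω) t k + 2) ≤ 2 * β / horizon k := by
              rw [div_le_div_iff₀ (by positivity) hT]
              nlinarith
            linarith
          · positivity
    _ = _ := by simp

/-- Bound on the contribution of the new instance. -/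
theorem integral_new_le (hU : Measurable U)
    (hlaw : P.map U = volume.restrict (Set.Icc (0 : ℝ) 1)) {t i j : ℕ} (hi : 1 ≤ i)
    (hpos : roundPos horizon (t + 1) = (i, j + 1)) {α β : ℝ} (hα : 0 ≤ α) (hβ : 0 ≤ β) :
    ∫ ω, (if activeInst horizon scale (U ω) (t + 1) = i then
      α + β / (playCount horizon scale (U ω) t i + 2) else 0) ∂P ≤
      α + 8 * Real.exp 1 * i * β / horizon i := by
  have hT : (0 : ℝ) < horizon i := by exact_mod_cast one_le_horizon hi
  have hi' : (1 : ℝ) ≤ i := by exact_mod_cast hi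
  have hS := scale_pos i
  have he := Real.exp_pos 1
  set q := newProb horizon scale i (j + 1) with hq
  have hq0 : 0 ≤ q := newProb_nonneg _ _ _ _
  have hact : MeasurableSet {ω | activeInst horizon scale (U ω) (t + 1) = i} :=
    hU ((measurable_activeInst horizon scale (t + 1)) (MeasurableSet.of_discrete (s := {i})))
  have hprob := prob_activeInst_le hU hlaw (S := scale) hi hpos
  rw [← hq] at hprob
  -- ρ bounds 1 / (N + 2) uniformly in the seed, and 2q bounds the probability of a call, so only
  -- the product 2qρ has to be small. The cases are j + 1 ≥ S_i and j + 1 < S_i.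
  obtain ⟨ρ, hρ0, hρ, hqρ⟩ : ∃ ρ : ℝ, 0 ≤ ρ ∧
      (∀ u : ℝ, 0 ≤ u → activeInst horizon scale u (t + 1) = i →
        1 / ((playCount horizon scale u t i : ℝ) + 2) ≤ ρ) ∧
      2 * q * ρ ≤ 8 * Real.exp 1 * i / horizon i := by
    rcases le_or_gt (8 * 2 ^ i) (j + 1) with hj | hj
    · have h1 := scale_mul_newProb_le hj
      rw [← hq] at h1
      have hqpos : 0 < q := lt_min one_pos (div_pos (Real.exp_pos _) hT)
      have hc : 0 < cumProb horizon scale i (j + 1) := by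
        by_contra hneg
        nlinarith [mul_pos hS hqpos]
      refine ⟨1 / cumProb horizon scale i (j + 1), by positivity, fun u hu h => ?_, ?_⟩
      · exact one_div_le_one_div_of_le hc
          (cumProb_lt_playCount_new horizon_zero (fun i => one_le_horizon) hu hpos h).le
      -- 2q divided by the cumulated probability is at most 2e / S_i, and T_i = 4 i S_i turns this
      -- into 8 e i / T_i.
      · rw [mul_one_div, div_le_div_iff₀ hc hT, horizon_eq]
        nlinarith [mul_le_mul_of_nonneg_left h1 (show 0 ≤ 8 * (i : ℝ) by positivity)]
    -- Early in the loop no iteration can be guaranteed, but q itself is at most e / T_i.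
    · refine ⟨1, zero_le_one, fun u _ _ => ?_, ?_⟩
      · rw [div_le_one (by positivity)]
        linarith [Nat.cast_nonneg (α := ℝ) (playCount horizon scale u t i)]
      · have h1 := newProb_le_of_le_scale hj.le
        rw [← hq] at h1
        calc 2 * q * 1 ≤ 2 * (Real.exp 1 / horizon i) := by linarith
          _ = 2 * Real.exp 1 * 1 / horizon i := by ring
          _ ≤ _ := by
            refine div_le_div_of_nonneg_right ?_ hT.le
            nlinarith
  calc _ ≤ ∫ ω, (α + {ω | activeInst horizon scale (U ω) (t + 1) = i}.indicator
          (fun _ => β * ρ) ω) ∂P := by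
        refine integral_mono_of_nonneg (Filter.Eventually.of_forall fun ω => ?_)
          ((integrable_const _).add ((integrable_const _).indicator hact)) ?_
        · simp only [Pi.zero_apply]
          split_ifs
          · positivity
          · exact le_rfl
        · filter_upwards [seed_mem_Icc hU hlaw] with ω hω
          split_ifs with h
          · rw [Set.indicator_of_mem (show ω ∈ {ω | activeInst horizon scale (U ω) (t + 1) = i}
              from h)]
            have h1 := mul_le_mul_of_nonneg_left (hρ _ hω.1 h) hβ
            rw [mul_one_div] at h1
            linarith
          · rw [Set.indicator_of_notMem (show ω ∉ {ω | activeInst horizon scale (U ω) (t + 1) = i}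
              from h), add_zero]
            exact hα
    _ = α + P.real {ω | activeInst horizon scale (U ω) (t + 1) = i} * (β * ρ) := by
        rw [integral_add (integrable_const _) ((integrable_const _).indicator hact),
          integral_indicator_const _ hact]
        simp
    _ ≤ α + 2 * q * (β * ρ) := by
        have := mul_le_mul_of_nonneg_right hprob (mul_nonneg hβ hρ0)
        linarith
    _ ≤ _ := by
        have := mul_le_mul_of_nonneg_left hqρ hβ
        have e : β * (8 * Real.exp 1 * i / horizon i) = 8 * Real.exp 1 * i * β / horizon i := by
          ring
        linarith

end SeedBounds

/-- Parameters of the instances in terms of their regularizations. -/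
theorem exists_instParams_eq {nA nB : ℕ} (hA : 1 ≤ nA) (hB : 1 ≤ nB)
    (hl : 0 < Real.log nA + Real.log nB) {τ₀ : ℝ} (hτ₀ : 0 < τ₀) (i : ℕ) :
    ∃ τ, 0 < τ ∧ instParams nA nB τ₀ i = paramsOf τ ∧
      (1 ≤ i → τ = tuning nA nB (horizon i)) := by
  unfold instParams
  split_ifs with h
  · exact ⟨τ₀, hτ₀, rfl, fun hi => by omega⟩
  · exact ⟨_, tuning_pos hA hB (one_le_horizon (Nat.pos_of_ne_zero h)) hl, rfl, fun _ => rfl⟩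

/-- The entropy cost 2 log(AB) is dominated by the drift: T √(n / T) = √(n T) ≥ 2 as soon as T ≥ 4
and n ≥ 1. -/
theorem gap_constants_le {A B : Type*} [Fintype A] [Fintype B] {T : ℕ}
    (hA : 1 ≤ Fintype.card A) (hT : 4 ≤ T)
    (hl : 0 < Real.log (Fintype.card A) + Real.log (Fintype.card B)) :
    InstState.driftConst A B (tuning (Fintype.card A) (Fintype.card B) T) +
        2 * (Real.log (Fintype.card A) + Real.log (Fintype.card B)) ≤
      2 * ((Real.log (Fintype.card A) + Real.log (Fintype.card B)) *
        (T * √(((Fintype.card A : ℝ) + Fintype.card B) / T))) := by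
  rw [driftConst_tuning hA (by omega) hl]
  have h1 : (1 : ℝ) ≤ Fintype.card A := by exact_mod_cast hA
  have h2 : (0 : ℝ) ≤ Fintype.card B := Nat.cast_nonneg _
  have h3 : (4 : ℝ) ≤ T := by exact_mod_cast hT
  have h4 : 2 ≤ (T : ℝ) * √(((Fintype.card A : ℝ) + Fintype.card B) / T) := by
    rw [← div_le_iff₀' (by linarith)]
    refine Real.le_sqrt_of_sq_le ?_
    rw [div_pow, div_le_div_iff₀ (by positivity) (by positivity)]
    nlinarith
  nlinarith

/-- Comparison of the bounds of the loops with the bound in terms of the round. -/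
theorem loop_bound_le {n l : ℝ} (hn : 0 ≤ n) (hl : 0 ≤ l) {t k j : ℕ} (hk : 4 ≤ k)
    (hpos : roundPos horizon t = (k + 1, j)) (ht : 1 ≤ t) :
    (4 * (l * √(n / horizon (k + 1))) +
        64 * Real.exp 1 * ((k + 1 : ℕ) : ℝ) * (l * √(n / horizon (k + 1)))) +
        (4 * (l * √(n / horizon k)) + 16 * (l * √(n / horizon k))) ≤
      900 * √(n / t) * (l * Real.log t) := by
  obtain ⟨-, h2, h3, h4⟩ := roundPos_spec horizon_zero (fun i => one_le_horizon) t
  rw [hpos] at h2 h3 h4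
  simp only at h2 h3 h4
  have h4 := h4 ht
  have hsum := sum_horizon_le (k + 1)
  -- Earlier loops and the current one each last at most T_{k+1} rounds, and T_{k+1} ≤ 4 T_k. The
  -- constants 3/2 and 3 below are upper bounds for √2 and √8.
  have hT1 : t ≤ 2 * horizon (k + 1) := by omega
  have hT2 : t ≤ 8 * horizon k := by
    have := horizon_succ_le (i := k) (by omega)
    omega
  have hT3 : 2 ^ (k + 1) ≤ t := by
    rw [Finset.sum_range_succ] at h3
    have : 2 ^ (k + 1) ≤ horizon k := by
      unfold horizon
      rw [pow_succ]
      nlinarith [Nat.two_pow_pos k]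
    omega
  have hk0 := one_le_horizon (i := k) (by omega)
  have hk1 := one_le_horizon (i := k + 1) (by omega)
  have hTk : (0 : ℝ) < horizon k := by exact_mod_cast hk0
  have hTk1 : (0 : ℝ) < horizon (k + 1) := by exact_mod_cast hk1
  have ht0 : (0 : ℝ) < t := by exact_mod_cast ht
  set Q := √(n / t) with hQ
  have hQ0 : 0 ≤ Q := Real.sqrt_nonneg _
  have hr1 : √(n / horizon (k + 1)) ≤ 3 / 2 * Q := by
    refine Real.sqrt_le_iff.2 ⟨by positivity, ?_⟩
    rw [mul_pow, hQ, Real.sq_sqrt (by positivity), mul_div_assoc', div_le_div_iff₀ hTk1 ht0]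
    have : (t : ℝ) ≤ 2 * horizon (k + 1) := by exact_mod_cast hT1
    nlinarith [mul_le_mul_of_nonneg_left this hn, mul_nonneg hn hTk1.le]
  have hr2 : √(n / horizon k) ≤ 3 * Q := by
    refine Real.sqrt_le_iff.2 ⟨by positivity, ?_⟩
    rw [mul_pow, hQ, Real.sq_sqrt (by positivity), mul_div_assoc', div_le_div_iff₀ hTk ht0]
    have : (t : ℝ) ≤ 8 * horizon k := by exact_mod_cast hT2
    nlinarith [mul_le_mul_of_nonneg_left this hn, mul_nonneg hn hTk.le]
  have hlog : ((k + 1 : ℕ) : ℝ) * 0.69 ≤ Real.log t := by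
    calc ((k + 1 : ℕ) : ℝ) * 0.69 ≤ ((k + 1 : ℕ) : ℝ) * Real.log 2 :=
          mul_le_mul_of_nonneg_left (by linarith [Real.log_two_gt_d9]) (Nat.cast_nonneg _)
      _ = Real.log ((2 : ℝ) ^ (k + 1)) := by rw [Real.log_pow]
      _ ≤ Real.log t := Real.log_le_log (by positivity) (by exact_mod_cast hT3)
  have hi : (1 : ℝ) ≤ ((k + 1 : ℕ) : ℝ) := by exact_mod_cast Nat.le_add_left 1 k
  set i : ℝ := ((k + 1 : ℕ) : ℝ) with hidef
  have he := Real.exp_one_lt_d9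
  have he0 := Real.exp_pos 1
  have hc : 0 ≤ 4 + 64 * Real.exp 1 * i := by positivity
  calc _ = l * ((4 + 64 * Real.exp 1 * i) * √(n / horizon (k + 1)) + 20 * √(n / horizon k)) := by
        ring
    _ ≤ l * ((4 + 64 * Real.exp 1 * i) * (3 / 2 * Q) + 20 * (3 * Q)) := by gcongr
    _ = l * Q * (66 + 96 * Real.exp 1 * i) := by ring
    -- 96 e < 261 and i ≥ 1, so the bracket is below 327 i, whereas 900 · 0.69 = 621.
    _ ≤ l * Q * (900 * (i * 0.69)) := by
        refine mul_le_mul_of_nonneg_left ?_ (mul_nonneg hl hQ0)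
        nlinarith
    _ ≤ l * Q * (900 * Real.log t) := by gcongr
    _ = _ := by ring

/-! ### Assembly of the bound over the rounds -/

section Main

variable {Ω A B : Type*} [MeasurableSpace Ω]
  [Fintype A] [DecidableEq A] [Nonempty A] [MeasurableSpace A] [DiscreteMeasurableSpace A]
  [Fintype B] [DecidableEq B] [Nonempty B] [MeasurableSpace B] [DiscreteMeasurableSpace B]
  {P : Measure Ω} [IsProbabilityMeasure P] {p : A → B → Measure ℝ}
  [∀ a b, IsProbabilityMeasure (p a b)] {τ₀ : ℝ}
  {U : Ω → ℝ} {a : ℕ → Ω → A} {b : ℕ → Ω → B} {x : ℕ → Ω → ℝ}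

/-- Exploitability gap of the profile played in round `t`. -/
noncomputable def playedGap (L : A → B → ℝ) (par : ℕ → Params) (T : ℕ → ℕ) (S : ℕ → ℝ)
    (U : Ω → ℝ) (a : ℕ → Ω → A) (b : ℕ → Ω → B) (x : ℕ → Ω → ℝ) (t : ℕ) (ω : Ω) : ℝ :=
  exploitabilityGap L
    (playedMu par T S (U ω) (fun s => a s ω) (fun s => b s ω) (fun s => x s ω) t)
    (playedNu par T S (U ω) (fun s => a s ω) (fun s => b s ω) (fun s => x s ω) t)

omit [MeasurableSpace Ω] [MeasurableSpace A] [DiscreteMeasurableSpace A] [MeasurableSpace B]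
  [DiscreteMeasurableSpace B] in
theorem playedGap_mem_Icc {L : A → B → ℝ} (hL : ∀ a b, L a b ∈ Set.Icc (0 : ℝ) 1)
    (par : ℕ → Params) (T : ℕ → ℕ) (S : ℕ → ℝ) (t : ℕ) (ω : Ω) :
    playedGap L par T S U a b x t ω ∈ Set.Icc (0 : ℝ) 1 := by
  have h1 := openSimplex_subset (InstState.mu_mem (statesAfter_valid par T S (U ω)
    (fun s => a s ω) (fun s => b s ω) (fun s => x s ω) (t - 1) (activeInst T S (U ω) t))
    (par (activeInst T S (U ω) t)))
  have h2 := openSimplex_subset (InstState.nu_mem (statesAfter_valid par T S (U ω)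
    (fun s => a s ω) (fun s => b s ω) (fun s => x s ω) (t - 1) (activeInst T S (U ω) t))
    (par (activeInst T S (U ω) t)))
  exact ⟨exploitabilityGap_nonneg hL h1 h2, exploitabilityGap_le_one hL h1 h2⟩

variable (hl : 0 < Real.log (Fintype.card A) + Real.log (Fintype.card B))
  (hp : ∀ a b, ∀ᵐ y ∂(p a b), y ∈ Set.Icc (0 : ℝ) 1) (hτ₀ : 0 < τ₀)
  (hrun : IsDoublingRun P p (instParams (Fintype.card A) (Fintype.card B) τ₀)
    horizon scale U a b x)

include hl hp hτ₀ hrun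

/-- Decomposition of the second moment of the gap according to the instance that is played. -/
theorem integral_sq_playedGap_eq (t : ℕ) {i j : ℕ} (hi : 1 ≤ i)
    (hpos : roundPos horizon (t + 1) = (i, j)) :
    ∃ f : ℕ → Ω → ℝ,
      Integrable (fun ω => playedGap (meanLoss p)
        (instParams (Fintype.card A) (Fintype.card B) τ₀) horizon scale U a b x (t + 1) ω ^ 2) P ∧
      ∫ ω, playedGap (meanLoss p) (instParams (Fintype.card A) (Fintype.card B) τ₀)
        horizon scale U a b x (t + 1) ω ^ 2 ∂P = ∫ ω, f i ω ∂P + ∫ ω, f (i - 1) ω ∂P ∧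
      ∀ k, 1 ≤ k → ∫ ω, f k ω ∂P ≤
        ∫ ω, (if activeInst horizon scale (U ω) (t + 1) = k then
          4 * ((Real.log (Fintype.card A) + Real.log (Fintype.card B)) *
            √(((Fintype.card A : ℝ) + Fintype.card B) / horizon k)) +
          8 * ((Real.log (Fintype.card A) + Real.log (Fintype.card B)) *
            (horizon k * √(((Fintype.card A : ℝ) + Fintype.card B) / horizon k))) /
            (playCount horizon scale (U ω) t k + 2) else 0) ∂P := by
  have hA : 1 ≤ Fintype.card A := Fintype.card_pos
  have hB : 1 ≤ Fintype.card B := Fintype.card_pos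
  have hL := meanLoss_mem_Icc hp
  -- Instance 0 has a positive but arbitrary regularization: integrability covers it, whereas the
  -- quantitative bound is claimed for k ≥ 1 only.
  choose τ hτ hpar hτk using fun k => exists_instParams_eq hA hB hl hτ₀ k
  have hk := fun k => hrun.integral_indicator_sq_gap_le hp (hτ k) (hpar k) hL t
  have hsplit : (fun ω => playedGap (meanLoss p)
        (instParams (Fintype.card A) (Fintype.card B) τ₀) horizon scale U a b x (t + 1) ω ^ 2) =
      fun ω => (if activeInst horizon scale (U ω) (t + 1) = i then
        exploitabilityGap (meanLoss p) ((runState (instParams (Fintype.card A) (Fintype.card B) τ₀)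
          horizon scale U a b x t i ω).mu (paramsOf (τ i)))
        ((runState (instParams (Fintype.card A) (Fintype.card B) τ₀)
          horizon scale U a b x t i ω).nu (paramsOf (τ i))) ^ 2 else 0) +
        (if activeInst horizon scale (U ω) (t + 1) = i - 1 then
        exploitabilityGap (meanLoss p) ((runState (instParams (Fintype.card A) (Fintype.card B) τ₀)
          horizon scale U a b x t (i - 1) ω).mu (paramsOf (τ (i - 1))))
        ((runState (instParams (Fintype.card A) (Fintype.card B) τ₀)
          horizon scale U a b x t (i - 1) ω).nu (paramsOf (τ (i - 1)))) ^ 2 else 0) := by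
    funext ω
    have hg : ∀ k, activeInst horizon scale (U ω) (t + 1) = k →
        playedGap (meanLoss p) (instParams (Fintype.card A) (Fintype.card B) τ₀)
          horizon scale U a b x (t + 1) ω =
        exploitabilityGap (meanLoss p) ((runState (instParams (Fintype.card A) (Fintype.card B) τ₀)
          horizon scale U a b x t k ω).mu (paramsOf (τ k)))
        ((runState (instParams (Fintype.card A) (Fintype.card B) τ₀)
          horizon scale U a b x t k ω).nu (paramsOf (τ k))) := by
      intro k h
      unfold playedGap playedMu playedNu runState
      rw [h, ← hpar k, Nat.add_sub_cancel]
    rcases activeInst_eq_or (S := scale) (u := U ω) hpos with h | h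
    · rw [if_pos h, if_neg (by omega), hg _ h, add_zero]
    · rw [if_neg (by omega), if_pos h, hg _ h, zero_add]
  refine ⟨fun k ω => if activeInst horizon scale (U ω) (t + 1) = k then
        exploitabilityGap (meanLoss p) ((runState (instParams (Fintype.card A) (Fintype.card B) τ₀)
          horizon scale U a b x t k ω).mu (paramsOf (τ k)))
        ((runState (instParams (Fintype.card A) (Fintype.card B) τ₀)
          horizon scale U a b x t k ω).nu (paramsOf (τ k))) ^ 2 else 0, ?_, ?_, fun k hk1 => ?_⟩
  · rw [hsplit]
    exact (hk i).1.add (hk (i - 1)).1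
  · rw [hsplit]
    exact integral_add (hk i).1 (hk (i - 1)).1
  · refine (hk k).2.trans (integral_mono_of_nonneg (Filter.Eventually.of_forall fun ω => ?_)
      ?_ (Filter.Eventually.of_forall fun ω => ?_))
    · have : 0 ≤ InstState.driftConst A B (τ k) := by unfold InstState.driftConst; positivity
      simp only [Pi.zero_apply]
      split_ifs
      · positivity
      · exact le_rfl
    · have hcm : Measurable fun ω => (playCount horizon scale (U ω) t k : ℝ) :=
        (measurable_from_nat (f := fun k : ℕ => (k : ℝ))).comp
          ((measurable_playCount horizon scale t k).comp hrun.measurable_seed)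
      refine (AEBounded.of_mem_Icc (c := 0) (d := 4 * ((Real.log (Fintype.card A) + Real.log (Fintype.card B)) *
            √(((Fintype.card A : ℝ) + Fintype.card B) / horizon k)) +
          8 * ((Real.log (Fintype.card A) + Real.log (Fintype.card B)) *
            (horizon k * √(((Fintype.card A : ℝ) + Fintype.card B) / horizon k))))
        (Filter.Eventually.of_forall fun ω => ?_)).integrable (Measurable.ite (hrun.measurable_seed
          ((measurable_activeInst horizon scale (t + 1)) (MeasurableSet.of_discrete (s := {k}))))
          (((hcm.add_const 2).const_div _).const_add _) measurable_const)
      split_ifs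
      · refine ⟨by positivity, ?_⟩
        gcongr
        exact div_le_self (by positivity)
          (by linarith [Nat.cast_nonneg (α := ℝ) (playCount horizon scale (U ω) t k)])
      · exact ⟨le_rfl, by positivity⟩
    · simp only
      split_ifs
      -- The constants 4 = 2 · 2 and 8 = 4 · 2 come from 2 (τ l)² and from 4 times the bound of
      -- `gap_constants_le`.
      · rw [hτk k hk1, sq_tuning_mul hl]
        have hT : 4 ≤ horizon k := by
          unfold horizon
          have := Nat.mul_pos hk1 (Nat.two_pow_pos k)
          omega
        have hc := gap_constants_le (A := A) (B := B) hA hT hl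
        have h1 := div_le_div_of_nonneg_right hc
          (show 0 ≤ (playCount horizon scale (U ω) t k : ℝ) + 2 by positivity)
        have e : ∀ y N : ℝ, 8 * y / N = 4 * (2 * y / N) := fun y N => by ring
        rw [e]
        linarith
      · exact le_rfl

/-- Loops 1 to 4 end by round 2 T_4 = 4096. Afterwards the old instance has index at least 4, as its
half-loop estimate requires, and in particular it is never the untuned instance 0. -/
theorem integral_sq_playedGap_le_of_large {t : ℕ} (ht : 4096 < t) :
    ∫ ω, playedGap (meanLoss p) (instParams (Fintype.card A) (Fintype.card B) τ₀)
        horizon scale U a b x t ω ^ 2 ∂P ≤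
      900 * √(((Fintype.card A : ℝ) + Fintype.card B) / t) *
        ((Real.log (Fintype.card A) + Real.log (Fintype.card B)) * Real.log t) := by
  obtain ⟨t, rfl⟩ : ∃ t', t = t' + 1 := ⟨t - 1, by omega⟩
  obtain ⟨h1, h2, h3, h4⟩ := roundPos_spec horizon_zero (fun i => one_le_horizon) (t + 1)
  obtain ⟨i, j, hpos⟩ : ∃ i j, roundPos horizon (t + 1) = (i, j) := ⟨_, _, rfl⟩
  rw [hpos] at h1 h2 h3 h4
  simp only at h1 h2 h3 h4
  have hi5 : 5 ≤ i := by
    by_contra h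
    have e := sum_horizon_le i
    have e' := horizon_mono (show i ≤ 4 by omega)
    have e'' : horizon 4 = 2048 := by norm_num [horizon]
    omega
  obtain ⟨k, rfl⟩ : ∃ k, i = k + 1 := ⟨i - 1, by omega⟩
  obtain ⟨j, rfl⟩ : ∃ j', j = j' + 1 := ⟨j - 1, by omega⟩
  have hk : 4 ≤ k := by omega
  obtain ⟨f, -, hf, hfk⟩ := integral_sq_playedGap_eq hl hp hτ₀ hrun t h1 hpos
  rw [hf, Nat.add_sub_cancel]
  set l := Real.log (Fintype.card A) + Real.log (Fintype.card B)
  set n := (Fintype.card A : ℝ) + Fintype.card B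
  have hn : 0 ≤ n := by positivity
  have hTk : (0 : ℝ) < horizon k := by exact_mod_cast one_le_horizon (i := k) (by omega)
  have hTk1 : (0 : ℝ) < horizon (k + 1) := by exact_mod_cast one_le_horizon h1
  have hnew := (hfk (k + 1) h1).trans (integral_new_le hrun.measurable_seed hrun.seed_law h1 hpos
    (by positivity) (by positivity))
  have hold := (hfk k (by omega)).trans (integral_old_le hrun.measurable_seed hrun.seed_law hk hpos
    (by positivity) (by positivity))
  refine (add_le_add hnew hold).trans (le_trans (le_of_eq ?_)
    (loop_bound_le hn hl.le hk hpos (Nat.le_add_left 1 t)))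
  congr 2
  · field_simp
    ring
  · field_simp
    ring

end Main

end MatrixGame

theorem theorem4 {A B Ω : Type*}
    [Fintype A] [DecidableEq A] [MeasurableSpace A] [DiscreteMeasurableSpace A]
    [Fintype B] [DecidableEq B] [MeasurableSpace B] [DiscreteMeasurableSpace B]
    (hAB : 2 ≤ Fintype.card A * Fintype.card B)
    (p : A → B → Measure ℝ) [∀ a b, IsProbabilityMeasure (p a b)]
    (hp : ∀ a b, ∀ᵐ y ∂(p a b), y ∈ Set.Icc (0 : ℝ) 1)
    (τ₀ : ℝ) (hτ₀ : 0 < τ₀)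
    [MeasurableSpace Ω] (P : Measure Ω) [IsProbabilityMeasure P]
    (U : Ω → ℝ) (a : ℕ → Ω → A) (b : ℕ → Ω → B) (x : ℕ → Ω → ℝ)
    (hrun : MatrixGame.IsDoublingRun P p
      (MatrixGame.instParams (Fintype.card A) (Fintype.card B) τ₀)
      MatrixGame.horizon MatrixGame.scale U a b x)
    (μ : ℕ → Ω → A → ℝ)
    (hμ : ∀ t ω, μ t ω = MatrixGame.playedMu
      (MatrixGame.instParams (Fintype.card A) (Fintype.card B) τ₀)
      MatrixGame.horizon MatrixGame.scale (U ω)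
      (fun s => a s ω) (fun s => b s ω) (fun s => x s ω) t)
    (ν : ℕ → Ω → B → ℝ)
    (hν : ∀ t ω, ν t ω = MatrixGame.playedNu
      (MatrixGame.instParams (Fintype.card A) (Fintype.card B) τ₀)
      MatrixGame.horizon MatrixGame.scale (U ω)
      (fun s => a s ω) (fun s => b s ω) (fun s => x s ω) t)
    (t : ℕ) (ht : 2 ≤ t) :
    MemLp (fun ω => MatrixGame.exploitabilityGap (MatrixGame.meanLoss p) (μ t ω) (ν t ω)) 2 P ∧
    (∫ ω, |MatrixGame.exploitabilityGap (MatrixGame.meanLoss p) (μ t ω) (ν t ω)| ^ 2 ∂P)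
        ^ (1 / 2 : ℝ)
      ≤ 30 * (((Fintype.card A : ℝ) + Fintype.card B) / t) ^ (1 / 4 : ℝ) *
        Real.sqrt (Real.log ((Fintype.card A : ℝ) * Fintype.card B) * Real.log t) := by
  have hApos : 0 < Fintype.card A := Nat.pos_of_ne_zero fun h => by simp [h] at hAB
  have hBpos : 0 < Fintype.card B := Nat.pos_of_ne_zero fun h => by simp [h] at hAB
  have : Nonempty A := Fintype.card_pos_iff.1 hApos
  have : Nonempty B := Fintype.card_pos_iff.1 hBpos
  have hA0 : (0 : ℝ) < Fintype.card A := by exact_mod_cast hApos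
  have hB0 : (0 : ℝ) < Fintype.card B := by exact_mod_cast hBpos
  have hlog : Real.log ((Fintype.card A : ℝ) * Fintype.card B) =
      Real.log (Fintype.card A) + Real.log (Fintype.card B) := Real.log_mul hA0.ne' hB0.ne'
  have hlog2 : Real.log 2 ≤ Real.log (Fintype.card A) + Real.log (Fintype.card B) := by
    rw [← hlog]
    exact Real.log_le_log two_pos (by exact_mod_cast hAB)
  have hl : 0 < Real.log (Fintype.card A) + Real.log (Fintype.card B) :=
    (Real.log_pos one_lt_two).trans_le hlog2
  have ht0 : (0 : ℝ) < t := by exact_mod_cast (by omega : 0 < t)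
  have hlogt : Real.log 2 ≤ Real.log t := Real.log_le_log two_pos (by exact_mod_cast ht)
  have hgap : (fun ω => MatrixGame.exploitabilityGap (MatrixGame.meanLoss p) (μ t ω) (ν t ω)) =
      MatrixGame.playedGap (MatrixGame.meanLoss p)
        (MatrixGame.instParams (Fintype.card A) (Fintype.card B) τ₀)
        MatrixGame.horizon MatrixGame.scale U a b x t := by
    funext ω
    rw [hμ, hν]
    rfl
  have hmem := MatrixGame.playedGap_mem_Icc (U := U) (a := a) (b := b) (x := x)
    (MatrixGame.meanLoss_mem_Icc hp)
    (MatrixGame.instParams (Fintype.card A) (Fintype.card B) τ₀)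
    MatrixGame.horizon MatrixGame.scale t
  have hint : Integrable (fun ω => MatrixGame.playedGap (MatrixGame.meanLoss p)
        (MatrixGame.instParams (Fintype.card A) (Fintype.card B) τ₀)
        MatrixGame.horizon MatrixGame.scale U a b x t ω ^ 2) P := by
    obtain ⟨t, rfl⟩ : ∃ t', t = t' + 1 := ⟨t - 1, by omega⟩
    obtain ⟨f, h, -⟩ := MatrixGame.integral_sq_playedGap_eq hl hp hτ₀ hrun t
      (MatrixGame.roundPos_spec MatrixGame.horizon_zero
        (fun i => MatrixGame.one_le_horizon) (t + 1)).1 rfl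
    exact h
  have hmeas : AEStronglyMeasurable (MatrixGame.playedGap (MatrixGame.meanLoss p)
        (MatrixGame.instParams (Fintype.card A) (Fintype.card B) τ₀)
        MatrixGame.horizon MatrixGame.scale U a b x t) P := by
    -- The gap is nonnegative, so its measurability is recovered from that of its square.
    have h := Real.continuous_sqrt.comp_aestronglyMeasurable hint.aestronglyMeasurable
    refine h.congr (Filter.Eventually.of_forall fun ω => ?_)
    exact Real.sqrt_sq (hmem ω).1
  have hsq : ∫ ω, MatrixGame.playedGap (MatrixGame.meanLoss p)
        (MatrixGame.instParams (Fintype.card A) (Fintype.card B) τ₀)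
        MatrixGame.horizon MatrixGame.scale U a b x t ω ^ 2 ∂P ≤
      900 * √(((Fintype.card A : ℝ) + Fintype.card B) / t) *
        ((Real.log (Fintype.card A) + Real.log (Fintype.card B)) * Real.log t) := by
    rcases le_or_gt t 4096 with h | h
    -- For t ≤ 4096 = 64² the right side exceeds 1, as 900 · 0.69² / 64 > 6, and the gap is at most
    -- 1.
    · have h1 : ∫ ω, MatrixGame.playedGap (MatrixGame.meanLoss p)
          (MatrixGame.instParams (Fintype.card A) (Fintype.card B) τ₀)
          MatrixGame.horizon MatrixGame.scale U a b x t ω ^ 2 ∂P ≤ ∫ _ω, (1 : ℝ) ∂P :=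
        integral_mono hint (integrable_const _) fun ω => pow_le_one₀ (hmem ω).1 (hmem ω).2
      have h2 : 1 / 64 ≤ √(((Fintype.card A : ℝ) + Fintype.card B) / t) := by
        refine Real.le_sqrt_of_sq_le ?_
        rw [le_div_iff₀ ht0]
        have hA1 : (1 : ℝ) ≤ Fintype.card A := by exact_mod_cast hApos
        have ht' : (t : ℝ) ≤ 4096 := by exact_mod_cast h
        linarith
      have h3 : 0.69 ≤ Real.log 2 := by linarith [Real.log_two_gt_d9]
      have h4 : (0.69 : ℝ) * 0.69 ≤
          (Real.log (Fintype.card A) + Real.log (Fintype.card B)) * Real.log t :=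
        mul_le_mul (h3.trans hlog2) (h3.trans hlogt) (by norm_num) hl.le
      have h5 := mul_le_mul h2 h4 (by norm_num) (Real.sqrt_nonneg _)
      have h6 : ∫ _ω, (1 : ℝ) ∂P = 1 := by simp
      rw [h6] at h1
      linarith
    · exact MatrixGame.integral_sq_playedGap_le_of_large hl hp hτ₀ hrun h
  -- An integral that does not exist is 0 by convention; membership in L² makes the norm bound
  -- meaningful.
  constructor
  · rw [hgap]
    exact MemLp.of_bound hmeas 1 (Filter.Eventually.of_forall fun ω => by
      rw [Real.norm_eq_abs, abs_of_nonneg (hmem ω).1]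
      exact (hmem ω).2)
  · have e : ∫ ω, |MatrixGame.exploitabilityGap (MatrixGame.meanLoss p) (μ t ω) (ν t ω)| ^ 2 ∂P =
        ∫ ω, MatrixGame.playedGap (MatrixGame.meanLoss p)
          (MatrixGame.instParams (Fintype.card A) (Fintype.card B) τ₀)
          MatrixGame.horizon MatrixGame.scale U a b x t ω ^ 2 ∂P := by
      refine integral_congr_ae (Filter.Eventually.of_forall fun ω => ?_)
      simp only [sq_abs]
      rw [show MatrixGame.exploitabilityGap (MatrixGame.meanLoss p) (μ t ω) (ν t ω) = _ from
        congrFun hgap ω]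
    rw [e, ← Real.sqrt_eq_rpow, hlog]
    -- Squaring the claimed bound gives the constant 900 = 30² and turns the fourth root into a
    -- square root.
    refine Real.sqrt_le_iff.2 ⟨by positivity, hsq.trans (le_of_eq ?_)⟩
    rw [mul_pow, mul_pow, MatrixGame.sq_rpow_quarter (by positivity), Real.sq_sqrt
      (mul_nonneg hl.le ((Real.log_pos one_lt_two).le.trans hlogt))]
    norm_num
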